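/- Let $U:\mathbb{R}^2\to[0,\infty)$ be continuous, with positive phase $\Omega=\{U>0\}$ and free boundary $F(U)=\partial\Omega\neq\emptyset$. Suppose that $U$ is a classical solution of the one-phase free boundary problem, that is: $\Delta U=0$ in $\Omega$; $F(U)$ is a $C^\infty$ hypersurface (curve) with $U=0$ on one side and $U>0$ on the other; $U\in C^\infty(\overline{\Omega})$; and $|\nabla U|=1$ on $F(U)$, the gradient being evaluated from the positive side. Suppose moreover that $U$ is stable with respect to compactly supported domain deformations, that is, for every vector field $\Phi\in C_0^\infty(\mathbb{R}^2,\mathbb{R}^2)$ and every ball $B_R$ centered at the origin that contains the support of $\Phi$, \[ \left.\frac{d^2}{dt^2}\right|_{t=0} J\big(U(x+t\Phi(x)),B_R\big)\ \ge\ 0,\qquad J(v,D)=\int_D\big(|\nabla v|^2+1_{\{v>0\}}\big)\,dx . \] Then, up to a rigid motion of $\mathbb{R}^2$, $U$ is either the one-plane solution $U(x_1,x_2)=x_2^+$ or a two-plane solution $U(x_1,x_2)=x_2^++(x_2+a)^-$ for some $a>0$, where $s^+=\max(s,0)$ and $s^-=\max(-s,0)$. -/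

import Mathlib

open Set Metric
open scoped ContDiff Gradient

noncomputable section

namespace OnePhase

/-- The positive phase `{u > 0}` of a function on `ℝⁿ`. -/
def posPhase {n : ℕ} (u : EuclideanSpace ℝ (Fin n) → ℝ) : Set (EuclideanSpace ℝ (Fin n)) :=
  {x | 0 < u x}

/-- The free boundary `F(u) = ∂{u > 0}`. -/
def freeBoundary {n : ℕ} (u : EuclideanSpace ℝ (Fin n) → ℝ) : Set (EuclideanSpace ℝ (Fin n)) :=
  frontier (posPhase u)

/-- `F(u)` is a smooth (embedded) hypersurface with `u > 0` on one side of it and `u = 0` on the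
other: near each of its points it is the regular zero set of a smooth function `g`, the positive
phase being `{g > 0}`. (For `u ≥ 0`, `u = 0` exactly where `g ≤ 0`.) -/
def HasSmoothOneSidedBoundary {n : ℕ} (u : EuclideanSpace ℝ (Fin n) → ℝ) : Prop :=
  ∀ p ∈ freeBoundary u, ∃ (V : Set (EuclideanSpace ℝ (Fin n)))
    (g : EuclideanSpace ℝ (Fin n) → ℝ),
    IsOpen V ∧ p ∈ V ∧ ContDiffOn ℝ ∞ g V ∧ (∀ x ∈ V, ∇ g x ≠ 0) ∧
      ∀ x ∈ V, (x ∈ freeBoundary u ↔ g x = 0) ∧ (x ∈ posPhase u ↔ 0 < g x)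

/-- Entire classical solutions `u : ℝⁿ → [0, ∞)` of the one-phase free boundary problem
`Δu = 0` in `{u > 0}`, `|∇u| = 1` on `F(u)`. The gradient at a point of the free boundary is the
one-sided gradient, taken within the closure of the positive phase. -/
structure IsEntireClassicalSolution {n : ℕ} (u : EuclideanSpace ℝ (Fin n) → ℝ) : Prop where
  nonneg : ∀ x, 0 ≤ u x
  continuous : Continuous u
  harmonic : InnerProductSpace.HarmonicOnNhd u (posPhase u)
  smooth_boundary : HasSmoothOneSidedBoundary u
  smooth_up_to_boundary : ContDiffOn ℝ ∞ u (closure (posPhase u))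
  gradient_eq_one : ∀ p ∈ freeBoundary u, ‖gradientWithin u (closure (posPhase u)) p‖ = 1

/-- The energy `J(v, D) = ∫_D (|∇v|² + 1_{v > 0}) dx`. -/
def energy {n : ℕ} (v : EuclideanSpace ℝ (Fin n) → ℝ) (D : Set (EuclideanSpace ℝ (Fin n))) : ℝ :=
  ∫ x in D, (‖∇ v x‖ ^ 2 + (posPhase v).indicator (fun _ => (1 : ℝ)) x)

/-- Stability with respect to compactly supported domain deformations: the second derivative at
`t = 0` of `J(u(x + tΦ(x)))` is nonnegative for every smooth compactly supported vector field `Φ`.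
The energy of an entire function over `ℝⁿ` being infinite, it is computed on balls that contain
the support of `Φ`, outside which `u(x + tΦ(x)) = u(x)`. -/
def IsStable {n : ℕ} (u : EuclideanSpace ℝ (Fin n) → ℝ) : Prop :=
  ∀ Φ : EuclideanSpace ℝ (Fin n) → EuclideanSpace ℝ (Fin n),
    ContDiff ℝ ∞ Φ → HasCompactSupport Φ →
    ∀ R : ℝ, tsupport Φ ⊆ ball 0 R →
      0 ≤ iteratedDeriv 2 (fun t : ℝ => energy (fun x => u (x + t • Φ x)) (ball 0 R)) 0

/-- The one-plane solution `x₂⁺` in the plane. -/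
def onePlane (x : EuclideanSpace ℝ (Fin 2)) : ℝ := (x 1)⁺

/-- The two-plane solution `x₂⁺ + (x₂ + a)⁻` in the plane. -/
def twoPlane (a : ℝ) (x : EuclideanSpace ℝ (Fin 2)) : ℝ := (x 1)⁺ + (x 1 + a)⁻

end OnePhase

end

noncomputable section

namespace OnePhase

open Filter Topology MeasureTheory

local notation "𝔼" => EuclideanSpace ℝ (Fin 2)

/-! Write Ω for the positive phase and s = |∇U|². Pulling the energy of U(x + tΦ(x)) back by the
inverse deformation puts it on the fixed set Ω, with t appearing only in smooth coefficients, so it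
can be differentiated twice under the integral. Since |∇U| = 1 on the free boundary, U is critical,
and the terms with second derivatives of Φ form a first variation and drop out
(`secondVariationDensity_eq`, `integral_firstVariation_eq_zero`). What remains is ∫_Ω |DPᵀ∇U|² + det
DP (1 - s) ≥ 0, first for smooth P and then, by mollification, for P that is only Lipschitz up to
the free boundary (`stability_of_lipschitz`).

The decisive test field is P = φ∇U. In two dimensions the square of the Hessian of a harmonic
function is a multiple of the identity, and the terms in φ² cancel against ¼ div(φ²(1 - s)∇s), whose
flux through the free boundary vanishes because s = 1 there (`stabilityDensity_mul_gradient`). This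
leaves 0 ≤ ∫ s²|∇φ|² + sφ∇φ·∇s. Taking φ = ψ(1 - s/128), where s ≤ 32, turns it into ∫ sψ²|∇s|² ≤
C∫|∇ψ|² (`integral_gradSq_le`). The plane has cutoffs equal to one on any given ball with
arbitrarily small Dirichlet energy, so s|∇s|² = 0, and this forces D²U = 0 in Ω.

A flat U is affine around each positive point and continues as the same affine function up to the
line where that function vanishes, so Ω is a union of open half-planes of slope one. Two different
ones have opposite normals, so there are at most two; two half-planes sharing their edge are
excluded because the free boundary is regular with U = 0 on one side.

The analytic input is collected in `IsRegular`. Harnack's inequality and the slope one at a touching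
boundary point give a global gradient bound. Interior cones make ∇U locally Lipschitz up to the
boundary. The divergence theorem in Ω is proved without surface measure, by integrating against
cutoffs of U and bounding the mass of the boundary layer uniformly
(`integral_deriv_phaseCutoff_le`). -/

/-! ### Second-order jets of functions of one variable -/

/-- `f` is differentiable near `0`, twice differentiable at `0`, and its value and first two
derivatives at `0` are `a`, `b`, `c`. -/
def HasTwoJet (f : ℝ → ℝ) (a b c : ℝ) : Prop :=
  ∃ f' : ℝ → ℝ, (∀ᶠ t in 𝓝 0, HasDerivAt f (f' t) t) ∧ f 0 = a ∧ f' 0 = b ∧ HasDerivAt f' c 0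

namespace HasTwoJet

variable {f g : ℝ → ℝ} {a b c a₂ b₂ c₂ : ℝ}

/-- The first derivative stays as computed: its value is never needed for the second variation. -/
lemma congr (hf : HasTwoJet f a b c) (h : g = f) (ha : a = a₂) (hc : c = c₂) :
    HasTwoJet g a₂ b c₂ := by
  subst h ha hc; exact hf

lemma const (a : ℝ) : HasTwoJet (fun _ => a) a 0 0 :=
  ⟨fun _ => 0, Eventually.of_forall fun t => hasDerivAt_const t a, rfl, rfl, hasDerivAt_const 0 0⟩

lemma add (hf : HasTwoJet f a b c) (hg : HasTwoJet g a₂ b₂ c₂) :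
    HasTwoJet (fun t => f t + g t) (a + a₂) (b + b₂) (c + c₂) := by
  obtain ⟨f', hf1, rfl, rfl, hf4⟩ := hf
  obtain ⟨g', hg1, rfl, rfl, hg4⟩ := hg
  refine ⟨fun t => f' t + g' t, ?_, rfl, rfl, hf4.add hg4⟩
  filter_upwards [hf1, hg1] with t h1 h2 using h1.add h2

lemma mul (hf : HasTwoJet f a b c) (hg : HasTwoJet g a₂ b₂ c₂) :
    HasTwoJet (fun t => f t * g t) (a * a₂) (b * a₂ + a * b₂) (c * a₂ + 2 * b * b₂ + a * c₂) := by
  obtain ⟨f', hf1, rfl, rfl, hf4⟩ := hf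
  obtain ⟨g', hg1, rfl, rfl, hg4⟩ := hg
  refine ⟨fun t => f' t * g t + f t * g' t, ?_, rfl, rfl, ?_⟩
  · filter_upwards [hf1, hg1] with t h1 h2 using h1.mul h2
  · have := (hf4.mul hg1.self_of_nhds).add (hf1.self_of_nhds.mul hg4)
    exact this.congr_deriv (by ring)

lemma inv (hf : HasTwoJet f a b c) (ha : a ≠ 0) :
    HasTwoJet (fun t => (f t)⁻¹) a⁻¹ (-b / a ^ 2) (-c / a ^ 2 + 2 * b ^ 2 / a ^ 3) := by
  obtain ⟨f', hf1, rfl, rfl, hf4⟩ := hf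
  refine ⟨fun t => -f' t / f t ^ 2, ?_, rfl, rfl, ?_⟩
  · have : ∀ᶠ t in 𝓝 0, f t ≠ 0 := hf1.self_of_nhds.continuousAt.eventually_ne ha
    filter_upwards [hf1, this] with t h1 h2 using h1.inv h2
  · have := hf4.neg.div (hf1.self_of_nhds.pow 2) (pow_ne_zero 2 ha)
    convert! this using 1
    simp only [Pi.neg_apply, Pi.pow_apply]
    field_simp
    ring

lemma of_contDiff (hf : ContDiff ℝ 2 f) :
    HasTwoJet f (f 0) (deriv f 0) (deriv (deriv f) 0) := by
  have h1 : ContDiff ℝ 1 (deriv f) := (contDiff_succ_iff_deriv (n := 1)).1 hf |>.2.2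
  exact ⟨deriv f, Eventually.of_forall fun t => (hf.differentiable two_ne_zero t).hasDerivAt,
    rfl, rfl, (h1.differentiable one_ne_zero 0).hasDerivAt⟩

lemma deriv_deriv (hf : HasTwoJet f a b c) : deriv (deriv f) 0 = c := by
  obtain ⟨f', hf1, -, -, hf4⟩ := hf
  have : deriv f =ᶠ[𝓝 0] f' := by
    filter_upwards [hf1] with t h using h.deriv
  rw [this.deriv_eq, hf4.deriv]

end HasTwoJet

/-! ### Integrals depending smoothly on a parameter -/

/-- The rough factor b does not depend on t and need only be integrable. Compactness of [t - 1, t +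
1] times the ball bounds the derivative of c by a constant C, so C‖b‖ dominates. -/
lemma hasDerivAt_setIntegral_mul {c : ℝ × 𝔼 → ℝ} (hc : ContDiff ℝ 1 c) {b : 𝔼 → ℝ} {D : Set 𝔼}
    {R : ℝ} (hD : D ⊆ closedBall 0 R) (hDm : MeasurableSet D) (hb : IntegrableOn b D) (t : ℝ) :
    IntegrableOn (fun y => fderiv ℝ c (t, y) (1, 0) * b y) D ∧
    HasDerivAt (fun t => ∫ y in D, c (t, y) * b y)
      (∫ y in D, fderiv ℝ c (t, y) (1, 0) * b y) t := by
  have hc' : Continuous fun p : ℝ × 𝔼 => fderiv ℝ c p (1, 0) :=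
    (hc.continuous_fderiv one_ne_zero).clm_apply continuous_const
  have hK : IsCompact (Icc (t - 1) (t + 1) ×ˢ closedBall (0 : 𝔼) R) :=
    isCompact_Icc.prod (isCompact_closedBall _ _)
  obtain ⟨C, hC⟩ := hK.exists_bound_of_continuousOn hc'.continuousOn
  obtain ⟨C₀, hC₀⟩ := hK.exists_bound_of_continuousOn hc.continuous.continuousOn
  have hs : Ioo (t - 1) (t + 1) ∈ 𝓝 t := Ioo_mem_nhds (by linarith) (by linarith)
  have ht : t ∈ Icc (t - 1) (t + 1) := ⟨by linarith, by linarith⟩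
  have key : ∀ {h : ℝ × 𝔼 → ℝ} (_ : Continuous h) (t : ℝ),
      AEStronglyMeasurable (fun y => h (t, y) * b y) (volume.restrict D) := fun hh t =>
    (hh.comp (by fun_prop : Continuous fun y : 𝔼 => (t, y))).aestronglyMeasurable.mul
      hb.aestronglyMeasurable
  refine hasDerivAt_integral_of_dominated_loc_of_deriv_le (bound := fun y => C * ‖b y‖)
    (F := fun t y => c (t, y) * b y) (F' := fun t y => fderiv ℝ c (t, y) (1, 0) * b y) hs
    (Eventually.of_forall fun t => key hc.continuous t) ?_ (key hc' t) ?_ (hb.norm.const_mul C) ?_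
  · refine Integrable.mono' (hb.norm.const_mul C₀) (key hc.continuous t) ?_
    filter_upwards [ae_restrict_mem hDm] with y hy
    rw [norm_mul]
    exact mul_le_mul_of_nonneg_right (hC₀ _ ⟨ht, hD hy⟩) (norm_nonneg _)
  · filter_upwards [ae_restrict_mem hDm] with y hy x hx
    rw [norm_mul]
    exact mul_le_mul_of_nonneg_right (hC _ ⟨Ioo_subset_Icc_self hx, hD hy⟩) (norm_nonneg _)
  · filter_upwards with y x _
    have h1 : HasFDerivAt c (fderiv ℝ c (x, y)) (x, y) :=
      (hc.differentiable one_ne_zero _).hasFDerivAt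
    have h2 : HasDerivAt (fun t : ℝ => (t, y)) ((1 : ℝ), (0 : 𝔼)) x :=
      (hasDerivAt_id x).prodMk (hasDerivAt_const x y)
    exact (h1.comp_hasDerivAt x h2).mul_const (b y)

lemma deriv_apply_prodMk {c : ℝ × 𝔼 → ℝ} (hc : ContDiff ℝ 1 c) (y : 𝔼) (t : ℝ) :
    HasDerivAt (fun t => c (t, y)) (fderiv ℝ c (t, y) (1, 0)) t := by
  have h1 : HasFDerivAt c (fderiv ℝ c (t, y)) (t, y) :=
    (hc.differentiable one_ne_zero _).hasFDerivAt
  have h2 : HasDerivAt (fun t : ℝ => (t, y)) ((1 : ℝ), (0 : 𝔼)) t :=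
    (hasDerivAt_id t).prodMk (hasDerivAt_const t y)
  exact h1.comp_hasDerivAt t h2

/-- Differentiating twice under the integral sign. -/
lemma iteratedDeriv_two_setIntegral {ι : Type*} (I : Finset ι) {c : ι → ℝ × 𝔼 → ℝ}
    (hc : ∀ k ∈ I, ContDiff ℝ 2 (c k)) {b : ι → 𝔼 → ℝ} {D : Set 𝔼} {R : ℝ}
    (hD : D ⊆ closedBall 0 R) (hDm : MeasurableSet D) (hb : ∀ k ∈ I, IntegrableOn (b k) D)
    {j₀ j₁ j₂ : 𝔼 → ℝ}
    (hj : ∀ y ∈ D, HasTwoJet (fun t => ∑ k ∈ I, c k (t, y) * b k y) (j₀ y) (j₁ y) (j₂ y)) :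
    iteratedDeriv 2 (fun t => ∫ y in D, ∑ k ∈ I, c k (t, y) * b k y) 0 = ∫ y in D, j₂ y := by
  classical
  have hc1 : ∀ k ∈ I, ContDiff ℝ 1 (c k) := fun k hk => (hc k hk).of_le (by norm_num)
  set c' : ι → ℝ × 𝔼 → ℝ := fun k p => fderiv ℝ (c k) p (1, 0) with hc'
  have hc'1 : ∀ k ∈ I, ContDiff ℝ 1 (c' k) := fun k hk =>
    ((hc k hk).fderiv_right (m := 1) (by norm_num)).clm_apply contDiff_const
  have hint : ∀ k ∈ I, ∀ t, IntegrableOn (fun y => c k (t, y) * b k y) D := by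
    intro k hk t
    obtain ⟨C₀, hC₀⟩ := (isCompact_closedBall (0 : 𝔼) R).exists_bound_of_continuousOn
      (f := fun y => c k (t, y)) ((hc1 k hk).continuous.comp (by fun_prop)).continuousOn
    refine Integrable.mono' ((hb k hk).norm.const_mul C₀) ?_ ?_
    · exact ((hc1 k hk).continuous.comp
        (by fun_prop : Continuous fun y : 𝔼 => (t, y))).aestronglyMeasurable.mul
        (hb k hk).aestronglyMeasurable
    filter_upwards [ae_restrict_mem hDm] with y hy
    rw [norm_mul]
    exact mul_le_mul_of_nonneg_right (hC₀ _ (hD hy)) (norm_nonneg _)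
  have e1 : (fun t => ∫ y in D, ∑ k ∈ I, c k (t, y) * b k y) =
      fun t => ∑ k ∈ I, ∫ y in D, c k (t, y) * b k y := by
    ext t
    exact integral_finsetSum _ fun k hk => hint k hk t
  have d1 : deriv (fun t => ∑ k ∈ I, ∫ y in D, c k (t, y) * b k y) =
      fun t => ∑ k ∈ I, ∫ y in D, c' k (t, y) * b k y := by
    ext t
    exact (HasDerivAt.fun_sum fun k hk =>
      (hasDerivAt_setIntegral_mul (hc1 k hk) hD hDm (hb k hk) t).2).deriv
  have d2 : deriv (fun t => ∑ k ∈ I, ∫ y in D, c' k (t, y) * b k y) 0 =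
      ∑ k ∈ I, ∫ y in D, fderiv ℝ (c' k) (0, y) (1, 0) * b k y :=
    (HasDerivAt.fun_sum fun k hk =>
      (hasDerivAt_setIntegral_mul (hc'1 k hk) hD hDm (hb k hk) 0).2).deriv
  rw [e1, iteratedDeriv_succ, iteratedDeriv_one, d1, d2, ← integral_finsetSum]
  · refine setIntegral_congr_fun hDm fun y hy => ?_
    have h1 : deriv (fun t => ∑ k ∈ I, c k (t, y) * b k y) =
        fun t => ∑ k ∈ I, c' k (t, y) * b k y := by
      ext t
      exact (HasDerivAt.fun_sum fun k hk =>
        (deriv_apply_prodMk (hc1 k hk) y t).mul_const (b k y)).deriv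
    have h2 : deriv (fun t => ∑ k ∈ I, c' k (t, y) * b k y) 0 =
        ∑ k ∈ I, fderiv ℝ (c' k) (0, y) (1, 0) * b k y :=
      (HasDerivAt.fun_sum fun k hk =>
        (deriv_apply_prodMk (hc'1 k hk) y 0).mul_const (b k y)).deriv
    -- The second derivative of the sum is computed in two ways: term by term, and through the given
    -- jet.
    rw [← h2, ← h1, (hj y hy).deriv_deriv]
  · exact fun k hk => (hasDerivAt_setIntegral_mul (hc'1 k hk) hD hDm (hb k hk) 0).1

/-! ### Coordinates in the plane -/

/-- The partial derivative in the `i`-th coordinate direction. -/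
def pd (i : Fin 2) (f : 𝔼 → ℝ) (x : 𝔼) : ℝ := fderiv ℝ f x (EuclideanSpace.single i 1)

lemma eq_add_single (v : 𝔼) :
    v = v 0 • EuclideanSpace.single (0 : Fin 2) (1 : ℝ) +
      v 1 • EuclideanSpace.single (1 : Fin 2) (1 : ℝ) := by
  ext i
  fin_cases i <;> simp

lemma fderiv_apply_eq (f : 𝔼 → ℝ) (x v : 𝔼) :
    fderiv ℝ f x v = v 0 * pd 0 f x + v 1 * pd 1 f x := by
  conv_lhs => rw [eq_add_single v]
  simp [pd]

lemma norm_sq_clm (l : 𝔼 →L[ℝ] ℝ) :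
    ‖l‖ ^ 2 = l (EuclideanSpace.single 0 1) ^ 2 + l (EuclideanSpace.single 1 1) ^ 2 := by
  have h : ∀ i, ((InnerProductSpace.toDual ℝ 𝔼).symm l) i = l (EuclideanSpace.single i 1) := by
    intro i
    have := InnerProductSpace.toDual_symm_apply (x := EuclideanSpace.single i 1) (y := l)
    rw [EuclideanSpace.inner_single_right] at this
    simpa using this
  rw [← (InnerProductSpace.toDual ℝ 𝔼).symm.norm_map l, EuclideanSpace.real_norm_sq_eq,
    Fin.sum_univ_two, h, h]

lemma det_clm (L : 𝔼 →L[ℝ] 𝔼) :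
    L.det = L (EuclideanSpace.single 0 1) 0 * L (EuclideanSpace.single 1 1) 1 -
      L (EuclideanSpace.single 1 1) 0 * L (EuclideanSpace.single 0 1) 1 := by
  rw [ContinuousLinearMap.det, ← LinearMap.det_toMatrix
    (EuclideanSpace.basisFun (Fin 2) ℝ).toBasis, Matrix.det_fin_two]
  simp [LinearMap.toMatrix_apply]

lemma pd_coord {Φ : 𝔼 → 𝔼} {x : 𝔼} (h : DifferentiableAt ℝ Φ x) (i j : Fin 2) :
    pd j (fun y => Φ y i) x = fderiv ℝ Φ x (EuclideanSpace.single j 1) i := by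
  have := ((EuclideanSpace.proj (𝕜 := ℝ) i).hasFDerivAt (x := Φ x)).comp x h.hasFDerivAt
  have h2 : HasFDerivAt (fun y => Φ y i) ((EuclideanSpace.proj (𝕜 := ℝ) i).comp (fderiv ℝ Φ x)) x :=
    this
  rw [pd, h2.fderiv]
  rfl

lemma contDiff_pd {f : 𝔼 → ℝ} (hf : ContDiff ℝ ∞ f) (i : Fin 2) : ContDiff ℝ ∞ (pd i f) :=
  (hf.fderiv_right (m := ∞) (by simp)).clm_apply contDiff_const

lemma contDiff_coord {Φ : 𝔼 → 𝔼} (hΦ : ContDiff ℝ ∞ Φ) (i : Fin 2) :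
    ContDiff ℝ ∞ (fun y => Φ y i) :=
  (EuclideanSpace.proj (𝕜 := ℝ) i).contDiff.comp hΦ

/-! ### The inverse deformation -/

/-- After scaling, `x ↦ x + tΦ(x)` has an inverse depending smoothly on the parameter. The function
`τ` extends `t` from a neighbourhood of `0` to all parameters. -/
lemma exists_inverse_deformation {Φ : 𝔼 → 𝔼} (hΦ : ContDiff ℝ ∞ Φ) (hc : HasCompactSupport Φ) :
    ∃ ε : ℝ, 0 < ε ∧ ∃ (τ : ℝ → ℝ) (S : ℝ × 𝔼 → 𝔼), ContDiff ℝ ∞ τ ∧ (∀ᶠ t in 𝓝 0, τ t = t) ∧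
      ContDiff ℝ ∞ S ∧ (∀ t y, S (t, y) + τ t • ε • Φ (S (t, y)) = y) ∧
      (∀ t x, S (t, x + τ t • ε • Φ x) = x) ∧
      ∀ t x i j, |τ t * (ε * pd j (fun y => Φ y i) x)| ≤ 1 / 4 := by
  obtain ⟨χ⟩ : Nonempty (ContDiffBump (0 : ℝ)) := ⟨default⟩
  -- Keeping t as a coordinate makes the inverse jointly smooth in (t, y) with a single inversion.
  -- The bump in t gives G compact support, hence a global Lipschitz constant.
  set G : ℝ × 𝔼 → ℝ × 𝔼 := fun p => (0, (p.1 * χ p.1) • Φ p.2) with hG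
  have hχ : ContDiff ℝ ∞ (fun t : ℝ => t * χ t) := contDiff_id.mul χ.contDiff
  have hGs : ContDiff ℝ ∞ G := by
    have h := (hχ.comp contDiff_fst).smul (hΦ.comp (contDiff_snd (E := ℝ)))
    exact contDiff_const.prodMk h
  have hGc : HasCompactSupport G := by
    refine HasCompactSupport.intro (χ.hasCompactSupport.isCompact.prod hc.isCompact) ?_
    rintro ⟨t, x⟩ hp
    rw [mem_prod, not_and_or] at hp
    rcases hp with hp | hp
    · simp [hG, image_eq_zero_of_notMem_tsupport hp]
    · simp [hG, image_eq_zero_of_notMem_tsupport hp]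
  obtain ⟨C, hC⟩ := hGs.lipschitzWith_of_hasCompactSupport hGc (by simp)
  -- With this scale εG is 1/4-Lipschitz, so id + εG is a global homeomorphism; the same 1/4 bounds
  -- the entries of the derivative.
  set ε : ℝ := 1 / (4 * (C + 1)) with hε
  have hC0 : (0 : ℝ) ≤ C := C.2
  have hε0 : 0 < ε := by positivity
  have hεC : ε * C ≤ 1 / 4 := by
    rw [hε, div_mul_eq_mul_div, one_mul, div_le_div_iff₀ (by positivity) (by norm_num)]
    linarith
  have hGd : ∀ p, ‖fderiv ℝ G p‖ ≤ C := fun p => norm_fderiv_le_of_lipschitz ℝ hC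
  set Ψ : ℝ × 𝔼 → ℝ × 𝔼 := fun p => p + ε • G p with hΨ
  have hΨs : ContDiff ℝ ∞ Ψ := contDiff_id.add (hGs.const_smul ε)
  have hA : ApproximatesLinearOn Ψ
      ((ContinuousLinearEquiv.refl ℝ (ℝ × 𝔼) : (ℝ × 𝔼) ≃L[ℝ] (ℝ × 𝔼)) : (ℝ × 𝔼) →L[ℝ] (ℝ × 𝔼))
      univ (1 / 4) := by
    intro p _ q _
    have h1 : Ψ p - Ψ q - (p - q) = ε • (G p - G q) := by
      simp only [hΨ, smul_sub]; abel
    have h2 := hC.dist_le_mul p q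
    rw [dist_eq_norm, dist_eq_norm] at h2
    simp only [ContinuousLinearEquiv.coe_refl, ContinuousLinearMap.id_apply]
    rw [h1, norm_smul, Real.norm_of_nonneg hε0.le]
    calc ε * ‖G p - G q‖ ≤ ε * (C * ‖p - q‖) := by gcongr
      _ = ε * C * ‖p - q‖ := by ring
      _ ≤ 1 / 4 * ‖p - q‖ := by gcongr
      _ = _ := by norm_num
  have hlt : (1 / 4 : NNReal) < ‖((ContinuousLinearEquiv.refl ℝ (ℝ × 𝔼)).symm :
      (ℝ × 𝔼) →L[ℝ] (ℝ × 𝔼))‖₊⁻¹ := by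
    have : ‖((ContinuousLinearEquiv.refl ℝ (ℝ × 𝔼)).symm :
      (ℝ × 𝔼) →L[ℝ] (ℝ × 𝔼))‖₊ = 1 := by
      rw [ContinuousLinearEquiv.refl_symm, ContinuousLinearEquiv.coe_refl]
      exact ContinuousLinearMap.nnnorm_id
    rw [this, inv_one]
    rw [← NNReal.coe_lt_coe]
    norm_num
  let Hm : (ℝ × 𝔼) ≃ₜ (ℝ × 𝔼) := ApproximatesLinearOn.toHomeomorph Ψ hA (Or.inr hlt)
  have hHm : (Hm : ℝ × 𝔼 → ℝ × 𝔼) = Ψ := rfl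
  have hsmall : ∀ p, ‖-(ε • fderiv ℝ G p)‖ < 1 := by
    intro p
    rw [norm_neg, norm_smul, Real.norm_of_nonneg hε0.le]
    have : ε * ‖fderiv ℝ G p‖ ≤ ε * C := by gcongr; exact hGd p
    linarith
  -- The derivative 1 + εDG is invertible by the Neumann series, so the inverse homeomorphism is
  -- smooth.
  have hsymm : ContDiff ℝ ∞ Hm.symm := by
    refine Hm.contDiff_symm (f₀' := fun p =>
      ContinuousLinearEquiv.unitsEquiv ℝ (ℝ × 𝔼) (Units.oneSub _ (hsmall p))) (fun p => ?_) hΨs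
    have h1 : HasFDerivAt Ψ (ContinuousLinearMap.id ℝ (ℝ × 𝔼) + ε • fderiv ℝ G p) p :=
      (hasFDerivAt_id p).add ((hGs.differentiable (by simp) p).hasFDerivAt.const_smul ε)
    rw [hHm]
    convert! h1 using 1
    refine ContinuousLinearMap.ext fun v => ?_
    simp [ContinuousLinearEquiv.unitsEquiv_apply]
  refine ⟨ε, hε0, fun t => t * χ t, fun p => (Hm.symm p).2, hχ, ?_, contDiff_snd.comp hsymm,
    ?_, ?_, ?_⟩
  · filter_upwards [χ.eventuallyEq_one] with t ht
    simp [ht]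
  · intro t y
    have h1 : Ψ (Hm.symm (t, y)) = (t, y) := Hm.apply_symm_apply (t, y)
    have h2 := congrArg Prod.fst h1
    have h3 := congrArg Prod.snd h1
    simp only [hΨ, hG, Prod.fst_add, Prod.smul_fst, smul_zero, add_zero] at h2
    simp only [hΨ, hG, Prod.snd_add, Prod.smul_snd, h2] at h3
    rw [smul_comm]
    exact h3
  · intro t x
    have h1 : Hm.symm (Ψ (t, x)) = (t, x) := Hm.symm_apply_apply (t, x)
    have h2 : Ψ (t, x) = (t, x + (t * χ t) • ε • Φ x) := by
      simp only [hΨ, hG]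
      rw [smul_comm]
      ext <;> simp
    rw [h2] at h1
    simp only [h1]
  · intro t x i j
    have h1 : HasFDerivAt (fun y : 𝔼 => (t * χ t) * Φ y i)
        ((t * χ t) • fderiv ℝ (fun y => Φ y i) x) x :=
      (((contDiff_coord hΦ i).differentiable (by simp)) x).hasFDerivAt.const_mul _
    have h2 : LipschitzWith C (fun y : 𝔼 => (t * χ t) * Φ y i) := by
      refine LipschitzWith.of_dist_le_mul fun y z => ?_
      have h3 := hC.dist_le_mul (t, y) (t, z)
      have h4 : dist (t, y) (t, z) = dist y z := by simp [Prod.dist_eq]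
      have h5 : dist ((t * χ t) • Φ y) ((t * χ t) • Φ z) ≤ dist (G (t, y)) (G (t, z)) :=
        le_max_right _ _
      rw [h4] at h3
      refine le_trans ?_ (h5.trans h3)
      have := PiLp.norm_apply_le ((t * χ t) • Φ y - (t * χ t) • Φ z) i
      simpa [dist_eq_norm] using this
    have h6 := norm_fderiv_le_of_lipschitz ℝ h2 (x₀ := x)
    rw [h1.fderiv] at h6
    have h7 := ((t * χ t) • fderiv ℝ (fun y => Φ y i) x).le_opNorm (EuclideanSpace.single j 1)
    have h8 : ‖(EuclideanSpace.single j (1 : ℝ) : 𝔼)‖ = 1 := by simp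
    rw [h8, mul_one] at h7
    have h9 : |t * χ t * pd j (fun y => Φ y i) x| ≤ C := h7.trans h6
    have h10 : t * χ t * (ε * pd j (fun y => Φ y i) x) =
        ε * (t * χ t * pd j (fun y => Φ y i) x) := by ring
    rw [h10, abs_mul, abs_of_pos hε0]
    calc ε * |t * χ t * pd j (fun y => Φ y i) x| ≤ ε * C := by gcongr
      _ ≤ 1 / 4 := hεC

/-! ### The energy of a deformed function and its second derivative -/

/-- The energy density, in the undeformed coordinates, of the function with gradient `(u₀, u₁)`
deformed by a map with derivative `1 + m`. -/
def deformedDensity (m : Fin 2 → Fin 2 → ℝ) (u : Fin 2 → ℝ) : ℝ :=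
  (((1 + m 0 0) * u 0 + m 1 0 * u 1) ^ 2 + (m 0 1 * u 0 + (1 + m 1 1) * u 1) ^ 2 + 1) *
    ((1 + m 0 0) * (1 + m 1 1) - m 0 1 * m 1 0)⁻¹

/-- Half of the second derivative at `t = 0` of `deformedDensity (t B + t² C + …) u`. -/
def secondVariationDensity (B C : Fin 2 → Fin 2 → ℝ) (u : Fin 2 → ℝ) : ℝ :=
  (B 0 0 * u 0 + B 1 0 * u 1) ^ 2 + (B 0 1 * u 0 + B 1 1 * u 1) ^ 2 +
    2 * (C 0 0 * u 0 * u 0 + C 1 0 * u 1 * u 0 + C 0 1 * u 0 * u 1 + C 1 1 * u 1 * u 1) -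
    2 * (B 0 0 + B 1 1) * (B 0 0 * u 0 * u 0 + B 1 0 * u 1 * u 0 + B 0 1 * u 0 * u 1 +
      B 1 1 * u 1 * u 1) +
    (u 0 ^ 2 + u 1 ^ 2 + 1) * ((B 0 0 + B 1 1) ^ 2 - (B 0 0 * B 1 1 - B 0 1 * B 1 0) -
      (C 0 0 + C 1 1))

lemma hasTwoJet_deformedDensity {m : Fin 2 → Fin 2 → ℝ → ℝ} {B C : Fin 2 → Fin 2 → ℝ}
    (hm : ∀ i j, HasTwoJet (m i j) 0 (B i j) (2 * C i j)) (u : Fin 2 → ℝ) :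
    ∃ b, HasTwoJet (fun t => deformedDensity (fun i j => m i j t) u) (u 0 ^ 2 + u 1 ^ 2 + 1) b
      (2 * secondVariationDensity B C u) := by
  have h1 := (HasTwoJet.const 1).add (hm 0 0)
  have h2 := (HasTwoJet.const 1).add (hm 1 1)
  have v0 := (h1.mul (HasTwoJet.const (u 0))).add ((hm 1 0).mul (HasTwoJet.const (u 1)))
  have v1 := ((hm 0 1).mul (HasTwoJet.const (u 0))).add (h2.mul (HasTwoJet.const (u 1)))
  have N := ((v0.mul v0).add (v1.mul v1)).add (HasTwoJet.const 1)
  have D := ((h1.mul h2).add ((HasTwoJet.const (-1)).mul ((hm 0 1).mul (hm 1 0)))).inv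
    (by norm_num)
  have Q := N.mul D
  refine ⟨_, Q.congr ?_ ?_ ?_⟩
  · ext t
    rw [deformedDensity, sub_eq_add_neg, neg_one_mul, pow_two, pow_two]
  · norm_num; ring
  · simp only [secondVariationDensity]
    norm_num
    ring

lemma norm_gradient (f : 𝔼 → ℝ) (x : 𝔼) : ‖∇ f x‖ = ‖fderiv ℝ f x‖ :=
  (InnerProductSpace.toDual ℝ 𝔼).symm.norm_map _

/-- Change of variables y = x + tΦ(x). The map is injective and is the identity off the ball, so it
carries the ball onto itself. -/
lemma energy_deformation {U : 𝔼 → ℝ} (hU : Continuous U) (h0 : ∀ x, 0 ≤ U x)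
    (hd : ∀ x ∈ posPhase U, DifferentiableAt ℝ U x) {Φ : 𝔼 → 𝔼} (hΦ : ContDiff ℝ ∞ Φ) {R : ℝ}
    (hR : tsupport Φ ⊆ ball 0 R) {t : ℝ} {S : 𝔼 → 𝔼} (hS : ∀ y, S y + t • Φ (S y) = y)
    (hS' : ∀ x, S (x + t • Φ x) = x)
    (hsmall : ∀ x i j, |t * pd j (fun y => Φ y i) x| ≤ 1 / 4) :
    energy (fun x => U (x + t • Φ x)) (ball 0 R) = ∫ y in ball 0 R ∩ posPhase U,
      deformedDensity (fun i j => t * pd j (fun y => Φ y i) (S y)) (fun i => pd i U y) := by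
  have hopen : IsOpen (posPhase U) := isOpen_lt continuous_const hU
  set T : 𝔼 → 𝔼 := fun x => x + t • Φ x with hT
  have hTd : ∀ x, HasFDerivAt T (ContinuousLinearMap.id ℝ 𝔼 + t • fderiv ℝ Φ x) x := fun x =>
    (hasFDerivAt_id x).add ((hΦ.differentiable (by simp) x).hasFDerivAt.const_smul t)
  have hTinj : Function.Injective T := Function.LeftInverse.injective (g := S) hS'
  have hTout : ∀ x ∉ ball (0 : 𝔼) R, T x = x := fun x hx => by
    simp [hT, image_eq_zero_of_notMem_tsupport fun h => hx (hR h)]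
  have himg : T '' ball 0 R = ball 0 R := by
    ext y
    constructor
    · rintro ⟨x, hx, rfl⟩
      by_contra hy
      have h1 := hTout _ hy
      exact hy (by rwa [hTinj h1])
    · intro hy
      refine ⟨S y, ?_, hS y⟩
      by_contra hx
      have h1 := hTout _ hx
      have h2 : T (S y) = y := hS y
      rw [h2] at h1
      exact hx (h1 ▸ hy)
  have he : ∀ x i j, (ContinuousLinearMap.id ℝ 𝔼 + t • fderiv ℝ Φ x)
      (EuclideanSpace.single j 1) i =
      (if i = j then 1 else 0) + t * pd j (fun y => Φ y i) x := by
    intro x i j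
    rw [pd_coord (hΦ.differentiable (by simp) x)]
    simp
  rw [← setIntegral_indicator hopen.measurableSet, ← himg,
    integral_image_eq_integral_abs_det_fderiv_smul _ measurableSet_ball
      (fun x _ => (hTd x).hasFDerivWithinAt) hTinj.injOn, himg, energy]
  refine setIntegral_congr_fun measurableSet_ball fun x _ => ?_
  simp only [norm_gradient]
  have hdet : (ContinuousLinearMap.id ℝ 𝔼 + t • fderiv ℝ Φ x).det =
      (1 + t * pd 0 (fun y => Φ y 0) x) * (1 + t * pd 1 (fun y => Φ y 1) x) -
      (t * pd 1 (fun y => Φ y 0) x) * (t * pd 0 (fun y => Φ y 1) x) := by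
    rw [det_clm, he, he, he, he]
    simp
  -- With entries of size at most 1/4 the determinant is at least (3/4)² - (1/4)² = 1/2.
  have hdetpos : 0 < (ContinuousLinearMap.id ℝ 𝔼 + t • fderiv ℝ Φ x).det := by
    rw [hdet]
    have a1 := abs_le.1 (hsmall x 0 0)
    have a2 := abs_le.1 (hsmall x 1 1)
    have a3 := abs_le.1 (hsmall x 0 1)
    have a4 := abs_le.1 (hsmall x 1 0)
    nlinarith
  by_cases hx : T x ∈ posPhase U
  · have hx' : x ∈ posPhase (fun x => U (x + t • Φ x)) := hx
    rw [indicator_of_mem hx, indicator_of_mem hx', abs_of_pos hdetpos, smul_eq_mul]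
    simp only [deformedDensity]
    have h1 : HasFDerivAt (fun x => U (x + t • Φ x)) ((fderiv ℝ U (T x)).comp
      (ContinuousLinearMap.id ℝ 𝔼 + t • fderiv ℝ Φ x)) x :=
      (hd _ hx).hasFDerivAt.comp x (hTd x)
    rw [h1.fderiv, norm_sq_clm, ContinuousLinearMap.comp_apply, ContinuousLinearMap.comp_apply,
      fderiv_apply_eq, fderiv_apply_eq, he, he, he, he, hS' x, hdet]
    rw [hdet] at hdetpos
    have aux : ∀ D N : ℝ, D ≠ 0 → D * (N * D⁻¹) = N := fun D N h => by field_simp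
    rw [aux _ _ hdetpos.ne']
    simp
  · have hx' : x ∉ posPhase (fun x => U (x + t • Φ x)) := hx
    rw [indicator_of_notMem hx, indicator_of_notMem hx', smul_zero, add_zero]
    have h1 : U (T x) = 0 := le_antisymm (not_lt.1 hx) (h0 _)
    -- A zero of a nonnegative function is a minimum, and there `fderiv` vanishes even where the
    -- function is not differentiable, thanks to its default value. Points landing on the free
    -- boundary thus need no separate treatment.
    have h2 : IsLocalMin (fun x => U (x + t • Φ x)) x :=
      Eventually.of_forall fun y => by
        have : U (x + t • Φ x) = 0 := h1
        simp only [this]; exact h0 _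
    rw [h2.fderiv_eq_zero, norm_zero, zero_pow two_ne_zero]

/-- Differentiating S + τΦ(S) = y at t = 0 gives velocity -Φ(y) for S. Since τ vanishes at 0 with
slope one, the second derivative is twice the first derivative of β along S; the acceleration of S
does not enter. -/
lemma hasTwoJet_mul_comp_flow {τ : ℝ → ℝ} (hτ0 : ∀ᶠ t in 𝓝 0, τ t = t)
    {Φ : 𝔼 → 𝔼} (hΦ : ContDiff ℝ ∞ Φ) {S : ℝ × 𝔼 → 𝔼} (hS : ContDiff ℝ ∞ S)
    (hS1 : ∀ t y, S (t, y) + τ t • Φ (S (t, y)) = y) {β : 𝔼 → ℝ} (hβ : ContDiff ℝ ∞ β) (y : 𝔼) :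
    HasTwoJet (fun t => τ t * β (S (t, y))) 0 (β y)
      (2 * -(Φ y 0 * pd 0 β y + Φ y 1 * pd 1 β y)) := by
  have hτ00 : τ 0 = 0 := hτ0.self_of_nhds
  have hS0 : S (0, y) = y := by simpa [hτ00] using hS1 0 y
  have hτj : HasTwoJet τ 0 1 0 := by
    refine ⟨fun _ => 1, ?_, hτ00, rfl, hasDerivAt_const 0 1⟩
    have := hτ0.eventually_nhds
    filter_upwards [this] with t ht
    exact (hasDerivAt_id t).congr_of_eventuallyEq ht
  have hSt : ContDiff ℝ ∞ (fun t => S (t, y)) := hS.comp (by fun_prop)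
  obtain ⟨V, hV⟩ : ∃ V, HasDerivAt (fun t => S (t, y)) V 0 :=
    ⟨_, (hSt.differentiable (by simp) 0).hasDerivAt⟩
  have hVeq : V = -Φ y := by
    have h1 : HasDerivAt (fun t => Φ (S (t, y))) (fderiv ℝ Φ (S (0, y)) V) 0 :=
      ((hΦ.differentiable (by simp) _).hasFDerivAt).comp_hasDerivAt (0 : ℝ) hV
    have h2 : HasDerivAt τ 1 0 := (hasDerivAt_id (0 : ℝ)).congr_of_eventuallyEq hτ0
    have h3 := hV.add (h2.smul h1)
    have h4 : HasDerivAt (fun t => S (t, y) + τ t • Φ (S (t, y))) 0 0 := by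
      simp only [hS1]
      exact hasDerivAt_const 0 y
    have h5 := h3.unique h4
    simp only [hτ00, hS0, zero_smul, one_smul, zero_add] at h5
    exact eq_neg_of_add_eq_zero_left h5
  have hβS : ContDiff ℝ 2 (fun t => β (S (t, y))) := (hβ.comp hSt).of_le (WithTop.coe_le_coe.2 le_top)
  have h6 : HasDerivAt (fun t => β (S (t, y))) (fderiv ℝ β (S (0, y)) V) 0 :=
    ((hβ.differentiable (by simp) _).hasFDerivAt).comp_hasDerivAt (0 : ℝ) hV
  have h7 := hτj.mul (HasTwoJet.of_contDiff hβS)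
  rw [h6.deriv, hS0, hVeq, fderiv_apply_eq] at h7
  convert h7 using 1
  · ring
  · ring
  · simp; ring

/-- After the change of variables U enters only through bounded products of its derivatives on a
fixed set, so differentiating in t requires no control of second derivatives of U. -/
lemma second_variation_of_flow {U : 𝔼 → ℝ} (hU : Continuous U) (h0 : ∀ x, 0 ≤ U x)
    (hd : ∀ x ∈ posPhase U, DifferentiableAt ℝ U x) {M : ℝ}
    (hM : ∀ x ∈ posPhase U, ∀ i, |pd i U x| ≤ M) (hs : IsStable U)
    {Φ : 𝔼 → 𝔼} (hΦ : ContDiff ℝ ∞ Φ) (hcs : HasCompactSupport Φ) {R : ℝ}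
    (hR : tsupport Φ ⊆ ball 0 R) {τ : ℝ → ℝ} {S : ℝ × 𝔼 → 𝔼} (hτ : ContDiff ℝ ∞ τ)
    (hτ0 : ∀ᶠ t in 𝓝 0, τ t = t) (hS : ContDiff ℝ ∞ S)
    (hS1 : ∀ t y, S (t, y) + τ t • Φ (S (t, y)) = y) (hS2 : ∀ t x, S (t, x + τ t • Φ x) = x)
    (hsmall : ∀ t x i j, |τ t * pd j (fun y => Φ y i) x| ≤ 1 / 4) :
    0 ≤ ∫ y in ball 0 R ∩ posPhase U, secondVariationDensity (fun i j => pd j (fun z => Φ z i) y)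
      (fun i j => -(Φ y 0 * pd 0 (pd j (fun z => Φ z i)) y +
        Φ y 1 * pd 1 (pd j (fun z => Φ z i)) y)) (fun i => pd i U y) := by
  have hopen : IsOpen (posPhase U) := isOpen_lt continuous_const hU
  have hDm : MeasurableSet (ball 0 R ∩ posPhase U) := measurableSet_ball.inter hopen.measurableSet
  have hDR : ball 0 R ∩ posPhase U ⊆ closedBall (0 : 𝔼) R :=
    inter_subset_left.trans ball_subset_closedBall
  set m : Fin 2 → Fin 2 → ℝ × 𝔼 → ℝ := fun i j p => τ p.1 * pd j (fun y => Φ y i) (S p) with hm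
  have hms : ∀ i j, ContDiff ℝ ∞ (m i j) := fun i j =>
    (hτ.comp contDiff_fst).mul ((contDiff_pd (contDiff_coord hΦ i) j).comp hS)
  set D : ℝ × 𝔼 → ℝ := fun p => (1 + m 0 0 p) * (1 + m 1 1 p) - m 0 1 p * m 1 0 p with hDdef
  have hDpos : ∀ p, 0 < D p := fun p => by
    have a1 := abs_le.1 (hsmall p.1 (S p) 0 0)
    have a2 := abs_le.1 (hsmall p.1 (S p) 1 1)
    have a3 := abs_le.1 (hsmall p.1 (S p) 0 1)
    have a4 := abs_le.1 (hsmall p.1 (S p) 1 0)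
    simp only [hDdef, hm]
    nlinarith
  have hDs : ContDiff ℝ ∞ (fun p => (D p)⁻¹) :=
    (((contDiff_const.add (hms 0 0)).mul (contDiff_const.add (hms 1 1))).sub
      ((hms 0 1).mul (hms 1 0))).inv fun p => (hDpos p).ne'
  -- The density is expanded in the monomials u₀², u₀u₁, u₁², 1 of the gradient, which separates the
  -- smooth dependence on t from the measurable dependence on U.
  set c : Fin 4 → ℝ × 𝔼 → ℝ := ![
    fun p => ((1 + m 0 0 p) ^ 2 + m 0 1 p ^ 2) * (D p)⁻¹,
    fun p => (2 * ((1 + m 0 0 p) * m 1 0 p + m 0 1 p * (1 + m 1 1 p))) * (D p)⁻¹,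
    fun p => (m 1 0 p ^ 2 + (1 + m 1 1 p) ^ 2) * (D p)⁻¹,
    fun p => (D p)⁻¹] with hc
  set b : Fin 4 → 𝔼 → ℝ := ![fun y => pd 0 U y * pd 0 U y, fun y => pd 0 U y * pd 1 U y,
    fun y => pd 1 U y * pd 1 U y, fun _ => 1] with hb
  have hsum : ∀ p : ℝ × 𝔼, ∑ k, c k p * b k p.2 =
      deformedDensity (fun i j => m i j p) (fun i => pd i U p.2) := by
    intro p
    simp only [Fin.sum_univ_four, hc, hb, deformedDensity]
    simp [hDdef]
    ring
  have hcs' : ∀ k ∈ Finset.univ, ContDiff ℝ 2 (c k) := by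
    intro k _
    have h1 := contDiff_const (c := (1 : ℝ)) (𝕜 := ℝ) (E := ℝ × 𝔼) (n := ∞)
    refine ContDiff.of_le (n := ∞) ?_ (WithTop.coe_le_coe.2 le_top)
    fin_cases k
    · exact (((h1.add (hms 0 0)).pow 2).add ((hms 0 1).pow 2)).mul hDs
    · exact (contDiff_const.mul (((h1.add (hms 0 0)).mul (hms 1 0)).add
        ((hms 0 1).mul (h1.add (hms 1 1))))).mul hDs
    · exact (((hms 1 0).pow 2).add ((h1.add (hms 1 1)).pow 2)).mul hDs
    · exact hDs
  have hmeas : ∀ i, Measurable (pd i U) := fun i => measurable_fderiv_apply_const ℝ U _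
  have hfin : volume (ball 0 R ∩ posPhase U : Set 𝔼) ≠ ⊤ :=
    ((measure_mono inter_subset_left).trans_lt measure_ball_lt_top).ne
  have hbi2 : ∀ i j, IntegrableOn (fun y => pd i U y * pd j U y) (ball 0 R ∩ posPhase U) := by
    intro i j
    refine Measure.integrableOn_of_bounded (M := M * M) hfin
      ((hmeas i).mul (hmeas j)).aestronglyMeasurable ?_
    filter_upwards [ae_restrict_mem hDm] with y hy
    rw [norm_mul]
    have := hM y hy.2 i
    exact mul_le_mul this (hM y hy.2 j) (norm_nonneg _) ((abs_nonneg _).trans this)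
  have hbi : ∀ k ∈ Finset.univ, IntegrableOn (b k) (ball 0 R ∩ posPhase U) := by
    intro k _
    fin_cases k
    · exact hbi2 0 0
    · exact hbi2 0 1
    · exact hbi2 1 1
    · exact integrableOn_const hfin
  have hjets : ∀ y : 𝔼, ∃ j₁, HasTwoJet (fun t => ∑ k, c k (t, y) * b k y)
      (pd 0 U y ^ 2 + pd 1 U y ^ 2 + 1) j₁
      (2 * secondVariationDensity (fun i j => pd j (fun z => Φ z i) y)
      (fun i j => -(Φ y 0 * pd 0 (pd j (fun z => Φ z i)) y +
        Φ y 1 * pd 1 (pd j (fun z => Φ z i)) y)) (fun i => pd i U y)) := by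
    intro y
    have h1 := hasTwoJet_deformedDensity (m := fun i j t => m i j (t, y)) (fun i j =>
      hasTwoJet_mul_comp_flow hτ0 hΦ hS hS1 (contDiff_pd (contDiff_coord hΦ i) j) y)
      (fun i => pd i U y)
    obtain ⟨j₁, hj₁⟩ := h1
    refine ⟨j₁, ?_⟩
    have h2 : (fun t => ∑ k, c k (t, y) * b k y) =
        fun t => deformedDensity (fun i j => m i j (t, y)) fun i => pd i U y :=
      funext fun t => hsum (t, y)
    rw [h2]
    exact hj₁
  choose j₁ hj₁ using hjets
  have key := iteratedDeriv_two_setIntegral Finset.univ hcs' hDR hDm hbi (fun y _ => hj₁ y)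
  have hev : (fun t : ℝ => energy (fun x => U (x + t • Φ x)) (ball 0 R)) =ᶠ[𝓝 0]
      fun t => ∫ y in ball 0 R ∩ posPhase U, ∑ k, c k (t, y) * b k y := by
    filter_upwards [hτ0] with t ht
    rw [energy_deformation hU h0 hd hΦ hR (S := fun y => S (t, y))
      (fun y => by simpa [ht] using hS1 t y) (fun x => by simpa [ht] using hS2 t x)
      (fun x i j => by simpa [ht] using hsmall t x i j)]
    congr 1
    ext y
    rw [hsum (t, y)]
    simp only [hm, ht]
  have h1 := hs Φ hΦ hcs R hR
  rw [hev.iteratedDeriv_eq, key, integral_const_mul] at h1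
  linarith

/-! ### Integration by parts in the positive phase -/

lemma integral_pd_eq_zero {f : 𝔼 → ℝ} (hf : ContDiff ℝ 1 f) (hc : HasCompactSupport f)
    (i : Fin 2) : ∫ x, pd i f x = 0 := by
  have h := integral_mul_fderiv_eq_neg_fderiv_mul_of_integrable (μ := (volume : Measure 𝔼))
    (f := fun _ : 𝔼 => (1 : ℝ)) (g := f) (v := EuclideanSpace.single i 1)
    (by simp) (by
      simp only [one_mul]
      exact ((hf.continuous_fderiv one_ne_zero).clm_apply continuous_const).integrable_of_hasCompactSupport
        (hc.fderiv_apply ℝ _))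
    (by simpa using hf.continuous.integrable_of_hasCompactSupport hc)
    (fun x _ => differentiableAt_const _) (fun x _ => hf.differentiable one_ne_zero x)
  simpa [pd] using h

lemma pd_mul {f g : 𝔼 → ℝ} {x : 𝔼} (hf : DifferentiableAt ℝ f x) (hg : DifferentiableAt ℝ g x)
    (i : Fin 2) : pd i (fun y => f y * g y) x = f x * pd i g x + g x * pd i f x := by
  simp [pd, fderiv_fun_mul hf hg]

lemma pd_add {f g : 𝔼 → ℝ} {x : 𝔼} (hf : DifferentiableAt ℝ f x) (hg : DifferentiableAt ℝ g x)
    (i : Fin 2) : pd i (fun y => f y + g y) x = pd i f x + pd i g x := by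
  simp [pd, fderiv_fun_add hf hg]

lemma pd_sub {f g : 𝔼 → ℝ} {x : 𝔼} (hf : DifferentiableAt ℝ f x) (hg : DifferentiableAt ℝ g x)
    (i : Fin 2) : pd i (fun y => f y - g y) x = pd i f x - pd i g x := by
  simp [pd, fderiv_fun_sub hf hg]

lemma pd_const_mul {f : 𝔼 → ℝ} {x : 𝔼} (c : ℝ) (hf : DifferentiableAt ℝ f x)
    (i : Fin 2) : pd i (fun y => c * f y) x = c * pd i f x := by
  simp [pd, fderiv_const_mul hf c]

lemma pd_const (c : ℝ) (x : 𝔼) (i : Fin 2) : pd i (fun _ => c) x = 0 := by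
  simp [pd]

lemma pd_comp {f : 𝔼 → ℝ} {θ : ℝ → ℝ} {x : 𝔼} (hθ : DifferentiableAt ℝ θ (f x))
    (hf : DifferentiableAt ℝ f x) (i : Fin 2) :
    pd i (fun y => θ (f y)) x = deriv θ (f x) * pd i f x := by
  have := hθ.hasDerivAt.comp_hasFDerivAt x hf.hasFDerivAt
  have h2 : HasFDerivAt (fun y => θ (f y)) (deriv θ (f x) • fderiv ℝ f x) x := this
  simp [pd, h2.fderiv]

lemma pd_congr {f g : 𝔼 → ℝ} {x : 𝔼} (h : f =ᶠ[𝓝 x] g) (i : Fin 2) : pd i f x = pd i g x := by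
  rw [pd, pd, h.fderiv_eq]

lemma contDiffOn_pd {f : 𝔼 → ℝ} {s : Set 𝔼} (hs : IsOpen s) (hf : ContDiffOn ℝ ∞ f s)
    (i : Fin 2) : ContDiffOn ℝ ∞ (pd i f) s :=
  (hf.fderiv_of_isOpen hs (m := ∞) (by simp)).clm_apply contDiffOn_const

lemma continuousOn_pd {f : 𝔼 → ℝ} {s : Set 𝔼} (hs : IsOpen s) (hf : ContDiffOn ℝ 1 f s)
    (i : Fin 2) : ContinuousOn (pd i f) s :=
  (hf.continuousOn_fderiv_of_isOpen hs le_rfl).clm_apply continuousOn_const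

lemma pd_eq_zero_of_notMem_closedBall {f : 𝔼 → ℝ} {s : Set 𝔼} (hs : IsOpen s) {r : ℝ}
    (hf : ∀ x ∈ s, x ∉ closedBall 0 r → f x = 0) (i : Fin 2) :
    ∀ x ∈ s, x ∉ closedBall 0 r → pd i f x = 0 := by
  intro x hx hxr
  have : f =ᶠ[𝓝 x] fun _ => 0 := by
    filter_upwards [hs.mem_nhds hx, isClosed_closedBall.isOpen_compl.mem_nhds hxr] with y hy hy'
    exact hf y hy hy'
  rw [pd_congr this, pd_const]

/-- A smooth function equal to `0` on `(-∞, ε]` and to `1` on `[2ε, ∞)`. -/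
def phaseCutoff (ε r : ℝ) : ℝ := Real.smoothTransition (r / ε - 1)

section phaseCutoff
variable {ε : ℝ}

lemma contDiff_phaseCutoff (ε : ℝ) : ContDiff ℝ ∞ (phaseCutoff ε) :=
  Real.smoothTransition.contDiff.comp ((contDiff_id.div_const ε).sub contDiff_const)

lemma phaseCutoff_eq_zero (hε : 0 < ε) {r : ℝ} (hr : r ≤ ε) : phaseCutoff ε r = 0 :=
  Real.smoothTransition.zero_of_nonpos (by
    have := (div_le_one hε).2 hr
    linarith)

lemma phaseCutoff_eq_one (hε : 0 < ε) {r : ℝ} (hr : 2 * ε ≤ r) : phaseCutoff ε r = 1 :=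
  Real.smoothTransition.one_of_one_le (by
    have := (le_div_iff₀ hε).2 hr
    linarith)

lemma phaseCutoff_nonneg (ε r : ℝ) : 0 ≤ phaseCutoff ε r := Real.smoothTransition.nonneg _

lemma phaseCutoff_le_one (ε r : ℝ) : phaseCutoff ε r ≤ 1 := Real.smoothTransition.le_one _

lemma deriv_phaseCutoff_nonneg (hε : 0 < ε) (r : ℝ) : 0 ≤ deriv (phaseCutoff ε) r := by
  refine Monotone.deriv_nonneg fun a b hab => Real.smoothTransition.monotone ?_
  gcongr

lemma deriv_phaseCutoff_of_lt (hε : 0 < ε) {r : ℝ} (hr : r < ε) :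
    deriv (phaseCutoff ε) r = 0 := by
  have : phaseCutoff ε =ᶠ[𝓝 r] fun _ => 0 := by
    filter_upwards [Iio_mem_nhds hr] with t ht using phaseCutoff_eq_zero hε (le_of_lt ht)
  rw [this.deriv_eq, deriv_const]

lemma deriv_phaseCutoff_of_gt (hε : 0 < ε) {r : ℝ} (hr : 2 * ε < r) :
    deriv (phaseCutoff ε) r = 0 := by
  have : phaseCutoff ε =ᶠ[𝓝 r] fun _ => 1 := by
    filter_upwards [Ioi_mem_nhds hr] with t ht using phaseCutoff_eq_one hε (le_of_lt ht)
  rw [this.deriv_eq, deriv_const]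

end phaseCutoff

lemma isOpen_posPhase {U : 𝔼 → ℝ} (hU : Continuous U) : IsOpen (posPhase U) :=
  isOpen_lt continuous_const hU

/-- The factor θ(U) vanishes in a neighbourhood of every point outside the positive phase, so h may
be arbitrary there and unbounded near the free boundary. -/
lemma integrable_cutoff_mul {U : 𝔼 → ℝ} (hU : Continuous U) {ε : ℝ} (hε : 0 < ε) {θ : ℝ → ℝ}
    (hθ : Continuous θ) (hθ0 : ∀ r < ε, θ r = 0) {h : 𝔼 → ℝ} (hh : ContinuousOn h (posPhase U))
    {r : ℝ} (hsupp : ∀ x ∈ posPhase U, x ∉ closedBall 0 r → h x = 0) :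
    Integrable (fun x => θ (U x) * h x) := by
  refine Continuous.integrable_of_hasCompactSupport ?_ ?_
  · rw [continuous_iff_continuousAt]
    intro x
    by_cases hx : x ∈ posPhase U
    · exact (hθ.comp hU).continuousAt.mul (hh.continuousAt ((isOpen_posPhase hU).mem_nhds hx))
    · have h1 : (fun x => θ (U x) * h x) =ᶠ[𝓝 x] fun _ => 0 := by
        have : ∀ᶠ y in 𝓝 x, U y < ε :=
          hU.continuousAt.eventually_lt continuousAt_const (lt_of_le_of_lt (not_lt.1 hx) hε)
        filter_upwards [this] with y hy
        rw [hθ0 _ hy, zero_mul]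
      exact h1.continuousAt
  · refine HasCompactSupport.intro (isCompact_closedBall (0 : 𝔼) r) fun x hx => ?_
    by_cases hx' : x ∈ posPhase U
    · rw [hsupp x hx' hx, mul_zero]
    · rw [hθ0 _ (lt_of_le_of_lt (not_lt.1 hx') hε), zero_mul]

/-- Integration by parts against the cutoff `phaseCutoff ε (U x)`. -/
lemma integral_phaseCutoff_mul_div {U : 𝔼 → ℝ} (hU : Continuous U)
    (hUs : ContDiffOn ℝ 1 U (posPhase U)) {V : Fin 2 → 𝔼 → ℝ}
    (hV : ∀ i, ContDiffOn ℝ 1 (V i) (posPhase U)) {r : ℝ}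
    (hsupp : ∀ i, ∀ x ∈ posPhase U, x ∉ closedBall 0 r → V i x = 0) {ε : ℝ} (hε : 0 < ε) :
    ∫ x in posPhase U, phaseCutoff ε (U x) * (pd 0 (V 0) x + pd 1 (V 1) x) =
      -∫ x in posPhase U, deriv (phaseCutoff ε) (U x) * (pd 0 U x * V 0 x + pd 1 U x * V 1 x) := by
  have hO := isOpen_posPhase hU
  set η := phaseCutoff ε with hη
  have hηs : ContDiff ℝ ∞ η := contDiff_phaseCutoff ε
  have hηc : Continuous (deriv η) := hηs.continuous_deriv (by simp)
  set F : Fin 2 → 𝔼 → ℝ := fun i x => η (U x) * V i x with hF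
  -- The cut-off field vanishes near every point outside the positive phase. It is therefore C¹ on
  -- the whole plane, and its partial derivatives integrate to zero.
  have hloc : ∀ x ∉ posPhase U, ∀ i, F i =ᶠ[𝓝 x] fun _ => 0 := by
    intro x hx i
    have : ∀ᶠ y in 𝓝 x, U y < ε :=
      hU.continuousAt.eventually_lt continuousAt_const (lt_of_le_of_lt (not_lt.1 hx) hε)
    filter_upwards [this] with y hy
    simp only [hF, hη, phaseCutoff_eq_zero hε hy.le, zero_mul]
  have hFs : ∀ i, ContDiff ℝ 1 (F i) := by
    intro i
    rw [contDiff_iff_contDiffAt]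
    intro x
    by_cases hx : x ∈ posPhase U
    · exact (((hηs.of_le (by simp)).contDiffAt).comp x (hUs.contDiffAt (hO.mem_nhds hx))).mul
        ((hV i).contDiffAt (hO.mem_nhds hx))
    · exact contDiffAt_const.congr_of_eventuallyEq (hloc x hx i)
  have hFc : ∀ i, HasCompactSupport (F i) := by
    intro i
    refine HasCompactSupport.intro (isCompact_closedBall (0 : 𝔼) r) fun x hx => ?_
    by_cases hx' : x ∈ posPhase U
    · simp only [hF, hsupp i x hx' hx, mul_zero]
    · exact (hloc x hx' i).self_of_nhds
  have hpd : ∀ i, ∀ x ∈ posPhase U, pd i (F i) x =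
      η (U x) * pd i (V i) x + deriv η (U x) * (pd i U x * V i x) := by
    intro i x hx
    have d1 : DifferentiableAt ℝ U x :=
      (hUs.contDiffAt (hO.mem_nhds hx)).differentiableAt one_ne_zero
    have d2 : DifferentiableAt ℝ (V i) x :=
      ((hV i).contDiffAt (hO.mem_nhds hx)).differentiableAt one_ne_zero
    have d3 : DifferentiableAt ℝ η (U x) := hηs.differentiable (by simp) _
    rw [hF, pd_mul (f := fun y => η (U y)) (d3.comp x d1) d2, pd_comp d3 d1]
    ring
  have hint1 : ∀ i, Integrable fun x => η (U x) * pd i (V i) x := fun i =>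
    integrable_cutoff_mul hU hε hηs.continuous (fun r hr => phaseCutoff_eq_zero hε hr.le)
      (continuousOn_pd hO (hV i) i) (pd_eq_zero_of_notMem_closedBall hO (hsupp i) i)
  have hint2 : ∀ i, Integrable fun x => deriv η (U x) * (pd i U x * V i x) := fun i =>
    integrable_cutoff_mul hU hε hηc (fun r hr => deriv_phaseCutoff_of_lt hε hr)
      ((continuousOn_pd hO hUs i).mul (hV i).continuousOn)
      (fun x hx hx' => by rw [hsupp i x hx hx', mul_zero])
  have hzero : ∀ i, ∫ x in posPhase U, (η (U x) * pd i (V i) x +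
      deriv η (U x) * (pd i U x * V i x)) = 0 := by
    intro i
    calc _ = ∫ x in posPhase U, pd i (F i) x :=
          setIntegral_congr_fun hO.measurableSet fun x hx => (hpd i x hx).symm
      _ = ∫ x, pd i (F i) x := setIntegral_eq_integral_of_forall_compl_eq_zero fun x hx => by
          rw [pd_congr (hloc x hx i), pd_const]
      _ = 0 := integral_pd_eq_zero (hFs i) (hFc i) i
  have hz : ∀ i, (∫ x in posPhase U, η (U x) * pd i (V i) x) =
      -∫ x in posPhase U, deriv η (U x) * (pd i U x * V i x) := by
    intro i
    have := hzero i
    rw [integral_add (hint1 i).integrableOn (hint2 i).integrableOn] at this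
    linarith
  simp only [mul_add]
  rw [integral_add (hint1 0).integrableOn (hint1 1).integrableOn,
    integral_add (hint2 0).integrableOn (hint2 1).integrableOn, hz, hz]
  ring

/-- The quantitative consequences of being a classical solution in the plane that are used in the
analysis of the second variation. -/
structure IsRegular (U : 𝔼 → ℝ) : Prop where
  cont : Continuous U
  nonneg : ∀ x, 0 ≤ U x
  smooth : ContDiffOn ℝ ∞ U (posPhase U)
  harm : ∀ x ∈ posPhase U, pd 0 (pd 0 U) x + pd 1 (pd 1 U) x = 0
  bound : ∀ x ∈ posPhase U, ∀ i, |pd i U x| ≤ 4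
  boundary : ∀ r δ : ℝ, 0 < δ → ∃ ε > 0, ∀ x ∈ posPhase U, x ∈ closedBall (0 : 𝔼) r → U x < ε →
    |pd 0 U x ^ 2 + pd 1 U x ^ 2 - 1| ≤ δ
  lip : ∀ (r : ℝ) (i : Fin 2), ∃ C, LipschitzOnWith C (pd i U) (posPhase U ∩ closedBall 0 r)

/-! ### The divergence theorem up to the free boundary. -/

namespace IsRegular

variable {U : 𝔼 → ℝ} (hU : IsRegular U)
include hU

lemma isOpen : IsOpen (posPhase U) := isOpen_posPhase hU.cont

lemma smooth_one : ContDiffOn ℝ 1 U (posPhase U) := hU.smooth.of_le (by simp)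

lemma smooth_pd (i : Fin 2) : ContDiffOn ℝ ∞ (pd i U) (posPhase U) :=
  contDiffOn_pd hU.isOpen hU.smooth i

lemma hess (r : ℝ) : ∃ C, ∀ x ∈ posPhase U, x ∈ closedBall (0 : 𝔼) r →
    ∀ i j, |pd j (pd i U) x| ≤ C := by
  choose C hC using hU.lip (r + 1)
  refine ⟨C 0 + C 1, fun x hx hxr i j => ?_⟩
  have h1 : posPhase U ∩ closedBall 0 (r + 1) ∈ 𝓝 x := by
    refine inter_mem (hU.isOpen.mem_nhds hx) (mem_of_superset (ball_mem_nhds x one_pos) ?_)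
    intro y hy
    rw [mem_closedBall, dist_zero_right] at *
    rw [mem_ball, dist_eq_norm] at hy
    have := norm_add_le x (y - x)
    rw [add_sub_cancel] at this
    linarith
  have h2 := norm_fderiv_le_of_lipschitzOn ℝ h1 (hC i)
  have h3 := (fderiv ℝ (pd i U) x).le_opNorm (EuclideanSpace.single j 1)
  have h4 : ‖(EuclideanSpace.single j (1 : ℝ) : 𝔼)‖ = 1 := by simp
  rw [h4, mul_one] at h3
  have h5 : (C i : ℝ) ≤ C 0 + C 1 := by
    fin_cases i <;> simp
  exact h3.trans (h2.trans h5)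

/-- The layer densities (phaseCutoff ε)'(U)|∇U|² play the role of surface measure on the free
boundary, and their mass on a ball is bounded independently of ε. To see this, test with χ∇U for a
bump χ: by harmonicity its divergence is ∇χ·∇U, which is bounded with compact support. -/
lemma integral_deriv_phaseCutoff_le (r : ℝ) : ∃ A, ∀ ε > 0,
    Integrable (fun x => deriv (phaseCutoff ε) (U x) *
      ((closedBall (0 : 𝔼) r).indicator 1 x * (pd 0 U x ^ 2 + pd 1 U x ^ 2))) ∧
    ∫ x in posPhase U, deriv (phaseCutoff ε) (U x) *
      ((closedBall (0 : 𝔼) r).indicator 1 x * (pd 0 U x ^ 2 + pd 1 U x ^ 2)) ≤ A := by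
  have hO := hU.isOpen
  let χ : ContDiffBump (0 : 𝔼) := ⟨|r| + 1, |r| + 2, by positivity, by linarith⟩
  have hχs : ContDiff ℝ ∞ (χ : 𝔼 → ℝ) := χ.contDiff
  have hχ0 : ∀ x ∉ closedBall (0 : 𝔼) (|r| + 2), χ x = 0 := fun x hx =>
    χ.zero_of_le_dist (le_of_lt (not_le.1 hx))
  set V : Fin 2 → 𝔼 → ℝ := fun i x => χ x * pd i U x with hV
  have hVs : ∀ i, ContDiffOn ℝ 1 (V i) (posPhase U) := fun i =>
    ((hχs.contDiffOn).mul (hU.smooth_pd i)).of_le (by simp)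
  have hVsupp : ∀ i, ∀ x ∈ posPhase U, x ∉ closedBall 0 (|r| + 2) → V i x = 0 :=
    fun i x _ hx => by simp only [hV, hχ0 x hx, zero_mul]
  have hdiv : ∀ x ∈ posPhase U, pd 0 (V 0) x + pd 1 (V 1) x =
      pd 0 χ x * pd 0 U x + pd 1 χ x * pd 1 U x := by
    intro x hx
    have d1 : DifferentiableAt ℝ χ x := hχs.differentiable (by simp) x
    have d2 : ∀ i, DifferentiableAt ℝ (pd i U) x := fun i =>
      ((hU.smooth_pd i).contDiffAt (hO.mem_nhds hx)).differentiableAt (by simp)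
    rw [hV, pd_mul d1 (d2 0), pd_mul d1 (d2 1)]
    linear_combination χ x * hU.harm x hx
  have hχc : ∀ i, Continuous (pd i χ) := fun i => (contDiff_pd hχs i).continuous
  have hχcs : ∀ i, HasCompactSupport (pd i χ) := fun i => χ.hasCompactSupport.fderiv_apply ℝ _
  have hb : Integrable fun x => 4 * |pd 0 χ x| + 4 * |pd 1 χ x| :=
    (((hχc 0).integrable_of_hasCompactSupport (hχcs 0)).abs.const_mul 4).add
      (((hχc 1).integrable_of_hasCompactSupport (hχcs 1)).abs.const_mul 4)
  refine ⟨∫ x in posPhase U, (4 * |pd 0 χ x| + 4 * |pd 1 χ x|), fun ε hε => ?_⟩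
  have hint : Integrable (fun x => deriv (phaseCutoff ε) (U x) *
      (χ x * (pd 0 U x ^ 2 + pd 1 U x ^ 2))) := by
    refine integrable_cutoff_mul (r := |r| + 2) hU.cont hε
      ((contDiff_phaseCutoff ε).continuous_deriv (by simp))
      (fun t ht => deriv_phaseCutoff_of_lt hε ht) ?_ ?_
    · exact hχs.continuous.continuousOn.mul (((hU.smooth_pd 0).continuousOn.pow 2).add
        ((hU.smooth_pd 1).continuousOn.pow 2))
    · intro x _ hx
      rw [hχ0 x hx, zero_mul]
  have hle : ∀ x, (closedBall (0 : 𝔼) r).indicator (1 : 𝔼 → ℝ) x ≤ χ x := by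
    intro x
    by_cases hx : x ∈ closedBall (0 : 𝔼) r
    · rw [indicator_of_mem hx, χ.one_of_mem_closedBall]
      · rfl
      · exact closedBall_subset_closedBall (by show r ≤ |r| + 1; linarith [le_abs_self r]) hx
    · rw [indicator_of_notMem hx]
      exact χ.nonneg
  have hind : ∀ x, (0 : ℝ) ≤ (closedBall (0 : 𝔼) r).indicator (1 : 𝔼 → ℝ) x := fun x =>
    indicator_nonneg (fun _ _ => zero_le_one) x
  have hint' : Integrable (fun x => deriv (phaseCutoff ε) (U x) *
      ((closedBall (0 : 𝔼) r).indicator 1 x * (pd 0 U x ^ 2 + pd 1 U x ^ 2))) := by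
    have hm : ∀ i, Measurable (pd i U) := fun i => measurable_fderiv_apply_const ℝ U _
    refine hint.mono' ?_ (Eventually.of_forall fun x => ?_)
    · refine Measurable.aestronglyMeasurable ?_
      refine (((contDiff_phaseCutoff ε).continuous_deriv (by simp)).measurable.comp
        hU.cont.measurable).mul (Measurable.mul ?_ (((hm 0).pow_const 2).add ((hm 1).pow_const 2)))
      exact measurable_const.indicator measurableSet_closedBall
    · have h1 := deriv_phaseCutoff_nonneg hε (U x)
      rw [Real.norm_of_nonneg (mul_nonneg h1 (mul_nonneg (hind x) (by positivity)))]
      gcongr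
      exact hle x
  refine ⟨hint', ?_⟩
  calc _ ≤ ∫ x in posPhase U, deriv (phaseCutoff ε) (U x) *
        (χ x * (pd 0 U x ^ 2 + pd 1 U x ^ 2)) := by
        refine integral_mono hint'.integrableOn hint.integrableOn fun x => ?_
        have h1 := deriv_phaseCutoff_nonneg hε (U x)
        simp only
        gcongr
        exact hle x
    _ = ∫ x in posPhase U, deriv (phaseCutoff ε) (U x) *
        (pd 0 U x * V 0 x + pd 1 U x * V 1 x) := by
        congr 1; ext x; simp only [hV]; ring
    _ = -∫ x in posPhase U, phaseCutoff ε (U x) * (pd 0 (V 0) x + pd 1 (V 1) x) := by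
        rw [integral_phaseCutoff_mul_div hU.cont hU.smooth_one hVs hVsupp hε, neg_neg]
    _ ≤ _ := by
        refine (neg_le_abs _).trans ?_
        rw [← Real.norm_eq_abs]
        refine norm_integral_le_of_norm_le hb.integrableOn ?_
        filter_upwards [ae_restrict_mem hO.measurableSet] with x hx
        rw [hdiv x hx, norm_mul, Real.norm_of_nonneg (phaseCutoff_nonneg _ _)]
        have h1 := hU.bound x hx 0
        have h2 := hU.bound x hx 1
        calc phaseCutoff ε (U x) * ‖pd 0 χ x * pd 0 U x + pd 1 χ x * pd 1 U x‖
            ≤ 1 * ‖pd 0 χ x * pd 0 U x + pd 1 χ x * pd 1 U x‖ := by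
              gcongr; exact phaseCutoff_le_one _ _
          _ ≤ |pd 0 χ x * pd 0 U x| + |pd 1 χ x * pd 1 U x| := by
              rw [one_mul]; exact abs_add_le _ _
          _ = |pd 0 χ x| * |pd 0 U x| + |pd 1 χ x| * |pd 1 U x| := by rw [abs_mul, abs_mul]
          _ ≤ |pd 0 χ x| * 4 + |pd 1 χ x| * 4 := by gcongr
          _ = _ := by ring

/-- The divergence theorem in the positive phase, for fields whose flux through the free boundary
vanishes. -/
lemma integral_div_eq_zero {V : Fin 2 → 𝔼 → ℝ} (hV : ∀ i, ContDiffOn ℝ 1 (V i) (posPhase U))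
    {r : ℝ} (hsupp : ∀ i, ∀ x ∈ posPhase U, x ∉ closedBall 0 r → V i x = 0) {C : ℝ}
    (hC : ∀ x ∈ posPhase U, |pd 0 (V 0) x + pd 1 (V 1) x| ≤ C)
    (hflux : ∀ δ > 0, ∃ ε > 0, ∀ x ∈ posPhase U, x ∈ closedBall (0 : 𝔼) r → U x < ε →
      |pd 0 U x * V 0 x + pd 1 U x * V 1 x| ≤ δ) :
    ∫ x in posPhase U, (pd 0 (V 0) x + pd 1 (V 1) x) = 0 := by
  have hO := hU.isOpen
  obtain ⟨A, hA⟩ := hU.integral_deriv_phaseCutoff_le r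
  have hdivsupp : ∀ x ∈ posPhase U, x ∉ closedBall (0 : 𝔼) r → pd 0 (V 0) x + pd 1 (V 1) x = 0 :=
    fun x hx hxr => by
      rw [pd_eq_zero_of_notMem_closedBall hO (hsupp 0) 0 x hx hxr,
        pd_eq_zero_of_notMem_closedBall hO (hsupp 1) 1 x hx hxr, add_zero]
  have hlim : Tendsto (fun ε : ℝ => ∫ x in posPhase U,
      phaseCutoff ε (U x) * (pd 0 (V 0) x + pd 1 (V 1) x)) (𝓝[>] 0)
      (𝓝 (∫ x in posPhase U, (pd 0 (V 0) x + pd 1 (V 1) x))) := by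
    refine tendsto_integral_filter_of_dominated_convergence
      ((closedBall (0 : 𝔼) r).indicator fun _ => C) ?_ ?_ ?_ ?_
    · filter_upwards [self_mem_nhdsWithin] with ε hε
      exact (integrable_cutoff_mul (r := r) hU.cont hε (contDiff_phaseCutoff ε).continuous
        (fun t ht => phaseCutoff_eq_zero hε ht.le)
        ((continuousOn_pd hO (hV 0) 0).add (continuousOn_pd hO (hV 1) 1))
        hdivsupp).aestronglyMeasurable.restrict
    · filter_upwards [self_mem_nhdsWithin] with ε hε
      filter_upwards [ae_restrict_mem hO.measurableSet] with x hx
      by_cases hxr : x ∈ closedBall (0 : 𝔼) r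
      · rw [indicator_of_mem hxr, norm_mul, Real.norm_of_nonneg (phaseCutoff_nonneg _ _)]
        calc phaseCutoff ε (U x) * ‖pd 0 (V 0) x + pd 1 (V 1) x‖ ≤ 1 * C :=
              mul_le_mul (phaseCutoff_le_one _ _) (hC x hx) (norm_nonneg _) zero_le_one
          _ = C := one_mul C
      · rw [indicator_of_notMem hxr, hdivsupp x hx hxr, mul_zero, norm_zero]
    · refine Integrable.integrableOn ?_
      rw [integrable_indicator_iff measurableSet_closedBall]
      exact integrableOn_const measure_closedBall_lt_top.ne
    · filter_upwards [ae_restrict_mem hO.measurableSet] with x hx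
      refine tendsto_const_nhds.congr' ?_
      have h0 : 0 < U x / 2 := half_pos hx
      filter_upwards [Ioo_mem_nhdsGT h0] with ε hε
      rw [phaseCutoff_eq_one hε.1 (by linarith [hε.2]), one_mul]
  -- In the layer where the derivative of the cutoff lives, |∇U|² ≥ 1/2. A flux density of size at
  -- most δ is thus at most 2δ|∇U|², and the uniform layer bound applies.
  have hsmall : ∀ δ > 0, ∀ᶠ ε in 𝓝[>] (0 : ℝ), |∫ x in posPhase U,
      phaseCutoff ε (U x) * (pd 0 (V 0) x + pd 1 (V 1) x)| ≤ 2 * δ * A := by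
    intro δ hδ
    obtain ⟨ε₁, hε₁, h1⟩ := hflux δ hδ
    obtain ⟨ε₂, hε₂, h2⟩ := hU.boundary r (1 / 2) (by norm_num)
    -- The layer reaches up to U = 2ε, so ε must be less than half of both thresholds.
    have hm : 0 < min ε₁ ε₂ / 4 := by positivity
    filter_upwards [Ioo_mem_nhdsGT hm] with ε hε
    have hε0 : 0 < ε := hε.1
    have hεm := hε.2
    have m1 := min_le_left ε₁ ε₂
    have m2 := min_le_right ε₁ ε₂
    rw [integral_phaseCutoff_mul_div hU.cont hU.smooth_one hV hsupp hε0, abs_neg]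
    calc _ ≤ ∫ x in posPhase U, 2 * δ * (deriv (phaseCutoff ε) (U x) *
          ((closedBall (0 : 𝔼) r).indicator 1 x * (pd 0 U x ^ 2 + pd 1 U x ^ 2))) := by
          rw [← Real.norm_eq_abs]
          refine norm_integral_le_of_norm_le ((hA ε hε0).1.integrableOn.const_mul _) ?_
          filter_upwards [ae_restrict_mem hO.measurableSet] with x hx
          have hd := deriv_phaseCutoff_nonneg hε0 (U x)
          rw [norm_mul, Real.norm_of_nonneg hd]
          by_cases hxr : x ∈ closedBall (0 : 𝔼) r
          · rcases lt_or_ge (2 * ε) (U x) with hlt | hge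
            · rw [deriv_phaseCutoff_of_gt hε0 hlt]; simp
            · rw [indicator_of_mem hxr]
              have a1 := h1 x hx hxr (by linarith)
              have a2 := (abs_le.1 (h2 x hx hxr (by linarith))).1
              have a3 : ‖pd 0 U x * V 0 x + pd 1 U x * V 1 x‖ ≤
                  2 * δ * (pd 0 U x ^ 2 + pd 1 U x ^ 2) := by
                refine a1.trans ?_
                nlinarith
              calc deriv (phaseCutoff ε) (U x) * ‖pd 0 U x * V 0 x + pd 1 U x * V 1 x‖
                  ≤ deriv (phaseCutoff ε) (U x) * (2 * δ * (pd 0 U x ^ 2 + pd 1 U x ^ 2)) := by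
                    gcongr
                _ = _ := by simp only [Pi.one_apply]; ring
          · rw [hsupp 0 x hx hxr, hsupp 1 x hx hxr, indicator_of_notMem hxr]; simp
      _ = 2 * δ * ∫ x in posPhase U, (deriv (phaseCutoff ε) (U x) *
          ((closedBall (0 : 𝔼) r).indicator 1 x * (pd 0 U x ^ 2 + pd 1 U x ^ 2))) :=
          integral_const_mul _ _
      _ ≤ 2 * δ * A := by
          gcongr
          exact (hA ε hε0).2
  have hfin : ∀ δ > 0, |∫ x in posPhase U, (pd 0 (V 0) x + pd 1 (V 1) x)| ≤ 2 * δ * A :=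
    fun δ hδ => le_of_tendsto hlim.abs (hsmall δ hδ)
  have hA' : 0 ≤ A := by
    have := (abs_nonneg _).trans (hfin 1 one_pos)
    linarith
  refine abs_eq_zero.1 (le_antisymm (le_of_forall_pos_le_add fun ε hε => ?_) (abs_nonneg _))
  refine (hfin (ε / (2 * (A + 1))) (by positivity)).trans ?_
  rw [zero_add]
  have : 2 * (ε / (2 * (A + 1))) * A = ε * (A / (A + 1)) := by field_simp
  rw [this]
  have h3 : A / (A + 1) ≤ 1 := (div_le_one (by linarith)).2 (by linarith)
  nlinarith

end IsRegular

/-! ### Bounded functions -/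

/-- `f` is bounded on `s`. -/
def BddOn (f : 𝔼 → ℝ) (s : Set 𝔼) : Prop := ∃ C, 0 ≤ C ∧ ∀ x ∈ s, |f x| ≤ C

namespace BddOn

variable {f g : 𝔼 → ℝ} {s : Set 𝔼}

lemma of_le {C : ℝ} (h : ∀ x ∈ s, |f x| ≤ C) : BddOn f s :=
  ⟨|C|, abs_nonneg C, fun x hx => (h x hx).trans (le_abs_self C)⟩

lemma const (c : ℝ) : BddOn (fun _ => c) s := of_le fun _ _ => le_rfl

lemma add (hf : BddOn f s) (hg : BddOn g s) : BddOn (fun x => f x + g x) s := by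
  obtain ⟨A, _, hA⟩ := hf
  obtain ⟨B, _, hB⟩ := hg
  exact of_le fun x hx => (abs_add_le _ _).trans (add_le_add (hA x hx) (hB x hx))

lemma mul (hf : BddOn f s) (hg : BddOn g s) : BddOn (fun x => f x * g x) s := by
  obtain ⟨A, hA0, hA⟩ := hf
  obtain ⟨B, hB0, hB⟩ := hg
  refine of_le (C := A * B) fun x hx => ?_
  rw [abs_mul]
  exact mul_le_mul (hA x hx) (hB x hx) (abs_nonneg _) hA0

lemma neg (hf : BddOn f s) : BddOn (fun x => -f x) s := by
  obtain ⟨A, hA0, hA⟩ := hf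
  exact ⟨A, hA0, fun x hx => by rw [abs_neg]; exact hA x hx⟩

lemma sub (hf : BddOn f s) (hg : BddOn g s) : BddOn (fun x => f x - g x) s := by
  simpa only [sub_eq_add_neg] using hf.add hg.neg

lemma pow (hf : BddOn f s) (n : ℕ) : BddOn (fun x => f x ^ n) s := by
  obtain ⟨A, hA0, hA⟩ := hf
  refine ⟨A ^ n, by positivity, fun x hx => ?_⟩
  rw [abs_pow]
  exact pow_le_pow_left₀ (abs_nonneg _) (hA x hx) n

lemma mono {t : Set 𝔼} (hf : BddOn f t) (h : s ⊆ t) : BddOn f s :=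
  let ⟨A, h0, hA⟩ := hf
  ⟨A, h0, fun x hx => hA x (h hx)⟩

lemma congr (hf : BddOn f s) (h : ∀ x ∈ s, g x = f x) : BddOn g s :=
  let ⟨A, h0, hA⟩ := hf
  ⟨A, h0, fun x hx => by rw [h x hx]; exact hA x hx⟩

lemma of_continuous_of_subset_closedBall (hf : Continuous f) {r : ℝ} (hs : s ⊆ closedBall 0 r) :
    BddOn f s := by
  obtain ⟨C, hC⟩ := (isCompact_closedBall (0 : 𝔼) r).exists_bound_of_continuousOn hf.continuousOn
  exact of_le fun x hx => hC x (hs hx)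

end BddOn

lemma integrableOn_of_bddOn {f : 𝔼 → ℝ} {s : Set 𝔼} (hs : IsOpen s) (hf : ContinuousOn f s)
    {r : ℝ} (hb : BddOn f (s ∩ closedBall 0 r)) (h0 : ∀ x ∈ s, x ∉ closedBall 0 r → f x = 0) :
    IntegrableOn f s := by
  obtain ⟨C, hC0, hC⟩ := hb
  have h1 : IntegrableOn ((closedBall (0 : 𝔼) r).indicator fun _ => C) s := by
    refine Integrable.integrableOn ?_
    rw [integrable_indicator_iff measurableSet_closedBall]
    exact integrableOn_const measure_closedBall_lt_top.ne
  refine Integrable.mono' h1 (hf.aestronglyMeasurable hs.measurableSet) ?_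
  filter_upwards [ae_restrict_mem hs.measurableSet] with x hx
  by_cases hxr : x ∈ closedBall (0 : 𝔼) r
  · rw [indicator_of_mem hxr]; exact hC x ⟨hx, hxr⟩
  · rw [indicator_of_notMem hxr, h0 x hx hxr, norm_zero]

lemma pd_pd_comm {f : 𝔼 → ℝ} {x : 𝔼} (hf : ContDiffAt ℝ 2 f x) (i j : Fin 2) :
    pd i (pd j f) x = pd j (pd i f) x := by
  have hd : DifferentiableAt ℝ (fderiv ℝ f) x :=
    (hf.fderiv_right (m := 1) (by norm_num)).differentiableAt one_ne_zero
  have key : ∀ i j, pd i (pd j f) x =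
      fderiv ℝ (fderiv ℝ f) x (EuclideanSpace.single i 1) (EuclideanSpace.single j 1) := by
    intro i j
    have h1 : HasFDerivAt (pd j f)
        ((ContinuousLinearMap.apply ℝ ℝ (EuclideanSpace.single j (1 : ℝ))).comp
          (fderiv ℝ (fderiv ℝ f) x)) x :=
      (ContinuousLinearMap.apply ℝ ℝ (EuclideanSpace.single j (1 : ℝ))).hasFDerivAt.comp x
        hd.hasFDerivAt
    rw [pd, h1.fderiv]
    rfl
  rw [key, key]
  exact hf.isSymmSndFDerivAt (by simp) _ _

/-- The integrand of the stability inequality for the vector field `P`: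
`|DPᵀ∇U|² + det DP (1 - |∇U|²)`. -/
def stabilityDensity (U : 𝔼 → ℝ) (P : Fin 2 → 𝔼 → ℝ) (x : 𝔼) : ℝ :=
  (pd 0 (P 0) x * pd 0 U x + pd 0 (P 1) x * pd 1 U x) ^ 2 +
    (pd 1 (P 0) x * pd 0 U x + pd 1 (P 1) x * pd 1 U x) ^ 2 +
    (pd 0 (P 0) x * pd 1 (P 1) x - pd 1 (P 0) x * pd 0 (P 1) x) *
      (1 - (pd 0 U x ^ 2 + pd 1 U x ^ 2))

/-! ### First and second variation, and the stability inequality for smooth fields. -/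

namespace IsRegular

variable {U : 𝔼 → ℝ} (hU : IsRegular U)
include hU

lemma bddOn_pd (i : Fin 2) : BddOn (pd i U) (posPhase U) :=
  BddOn.of_le fun x hx => hU.bound x hx i

lemma contDiffAt {x : 𝔼} (hx : x ∈ posPhase U) : ContDiffAt ℝ ∞ U x :=
  hU.smooth.contDiffAt (hU.isOpen.mem_nhds hx)

lemma contDiffAt_pd {x : 𝔼} (hx : x ∈ posPhase U) (i : Fin 2) : ContDiffAt ℝ ∞ (pd i U) x :=
  (hU.smooth_pd i).contDiffAt (hU.isOpen.mem_nhds hx)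

lemma differentiableAt_pd {x : 𝔼} (hx : x ∈ posPhase U) (i : Fin 2) :
    DifferentiableAt ℝ (pd i U) x := (hU.contDiffAt_pd hx i).differentiableAt (by simp)

lemma mixed {x : 𝔼} (hx : x ∈ posPhase U) : pd 1 (pd 0 U) x = pd 0 (pd 1 U) x :=
  pd_pd_comm ((hU.contDiffAt hx).of_le (WithTop.coe_le_coe.2 le_top)) 1 0

/-- The field whose divergence is the integrand of the first variation of the energy in the
direction `X`. -/
lemma div_firstVariationField {X : Fin 2 → 𝔼 → ℝ} {x : 𝔼} (hx : x ∈ posPhase U)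
    (hX : ∀ i, DifferentiableAt ℝ (X i) x) :
    pd 0 (fun y => (pd 0 U y * pd 0 U y + pd 1 U y * pd 1 U y + 1) * X 0 y -
        2 * ((X 0 y * pd 0 U y + X 1 y * pd 1 U y) * pd 0 U y)) x +
      pd 1 (fun y => (pd 0 U y * pd 0 U y + pd 1 U y * pd 1 U y + 1) * X 1 y -
        2 * ((X 0 y * pd 0 U y + X 1 y * pd 1 U y) * pd 1 U y)) x =
    (pd 0 U x * pd 0 U x + pd 1 U x * pd 1 U x + 1) * (pd 0 (X 0) x + pd 1 (X 1) x) -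
      2 * (pd 0 (X 0) x * pd 0 U x * pd 0 U x + pd 0 (X 1) x * pd 1 U x * pd 0 U x +
        pd 1 (X 0) x * pd 0 U x * pd 1 U x + pd 1 (X 1) x * pd 1 U x * pd 1 U x) := by
  have d := hU.differentiableAt_pd hx
  have hs : DifferentiableAt ℝ (fun y => pd 0 U y * pd 0 U y + pd 1 U y * pd 1 U y) x :=
    ((d 0).fun_mul (d 0)).fun_add ((d 1).fun_mul (d 1))
  have hs1 : DifferentiableAt ℝ (fun y => pd 0 U y * pd 0 U y + pd 1 U y * pd 1 U y + 1) x :=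
    hs.fun_add (differentiableAt_const _)
  have hXu : DifferentiableAt ℝ (fun y => X 0 y * pd 0 U y + X 1 y * pd 1 U y) x :=
    ((hX 0).fun_mul (d 0)).fun_add ((hX 1).fun_mul (d 1))
  have e1 : ∀ i, pd i (fun y => pd 0 U y * pd 0 U y + pd 1 U y * pd 1 U y + 1) x =
      2 * (pd 0 U x * pd i (pd 0 U) x + pd 1 U x * pd i (pd 1 U) x) := by
    intro i
    rw [pd_add hs (differentiableAt_const _), pd_add ((d 0).fun_mul (d 0)) ((d 1).fun_mul (d 1)),
      pd_mul (d 0) (d 0), pd_mul (d 1) (d 1), pd_const]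
    ring
  have e2 : ∀ i, pd i (fun y => X 0 y * pd 0 U y + X 1 y * pd 1 U y) x =
      X 0 x * pd i (pd 0 U) x + pd 0 U x * pd i (X 0) x +
        (X 1 x * pd i (pd 1 U) x + pd 1 U x * pd i (X 1) x) := by
    intro i
    rw [pd_add ((hX 0).fun_mul (d 0)) ((hX 1).fun_mul (d 1)), pd_mul (hX 0) (d 0),
      pd_mul (hX 1) (d 1)]
  have e3 : ∀ i, pd i (fun y => (pd 0 U y * pd 0 U y + pd 1 U y * pd 1 U y + 1) * X i y -
        2 * ((X 0 y * pd 0 U y + X 1 y * pd 1 U y) * pd i U y)) x = _ := fun i => by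
    rw [pd_sub (hs1.fun_mul (hX i)) ((hXu.fun_mul (d i)).const_mul 2), pd_mul hs1 (hX i),
      pd_const_mul 2 (hXu.fun_mul (d i)), pd_mul hXu (d i), e1, e2]
  rw [e3, e3, hU.mixed hx]
  linear_combination (-2 * (X 0 x * pd 0 U x + X 1 x * pd 1 U x)) * hU.harm x hx

/-- Criticality of U: the flux density of the field is (1 - |∇U|²)(X·∇U), which tends to zero at the
free boundary by the gradient condition. -/
lemma integral_firstVariation_eq_zero {X : Fin 2 → 𝔼 → ℝ} (hX : ∀ i, ContDiff ℝ ∞ (X i)) {r : ℝ}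
    (hsupp : ∀ i, ∀ x ∉ closedBall (0 : 𝔼) r, X i x = 0) :
    IntegrableOn (fun x =>
      (pd 0 U x * pd 0 U x + pd 1 U x * pd 1 U x + 1) * (pd 0 (X 0) x + pd 1 (X 1) x) -
      2 * (pd 0 (X 0) x * pd 0 U x * pd 0 U x + pd 0 (X 1) x * pd 1 U x * pd 0 U x +
        pd 1 (X 0) x * pd 0 U x * pd 1 U x + pd 1 (X 1) x * pd 1 U x * pd 1 U x)) (posPhase U) ∧
    ∫ x in posPhase U,
      ((pd 0 U x * pd 0 U x + pd 1 U x * pd 1 U x + 1) * (pd 0 (X 0) x + pd 1 (X 1) x) -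
      2 * (pd 0 (X 0) x * pd 0 U x * pd 0 U x + pd 0 (X 1) x * pd 1 U x * pd 0 U x +
        pd 1 (X 0) x * pd 0 U x * pd 1 U x + pd 1 (X 1) x * pd 1 U x * pd 1 U x)) = 0 := by
  have hO := hU.isOpen
  have hXd : ∀ i x, DifferentiableAt ℝ (X i) x := fun i => (hX i).differentiable (by simp)
  have hXb : ∀ i j, BddOn (pd j (X i)) (closedBall 0 r) := fun i j =>
    BddOn.of_continuous_of_subset_closedBall (contDiff_pd (hX i) j).continuous subset_rfl
  have hXb0 : ∀ i, BddOn (X i) (closedBall 0 r) := fun i =>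
    BddOn.of_continuous_of_subset_closedBall (hX i).continuous subset_rfl
  have hXz : ∀ i j, ∀ x ∉ closedBall (0 : 𝔼) r, pd j (X i) x = 0 := fun i j x hx =>
    pd_eq_zero_of_notMem_closedBall isOpen_univ (fun y _ hy => hsupp i y hy) j x (mem_univ _) hx
  have hbd : BddOn (fun x =>
      (pd 0 U x * pd 0 U x + pd 1 U x * pd 1 U x + 1) * (pd 0 (X 0) x + pd 1 (X 1) x) -
      2 * (pd 0 (X 0) x * pd 0 U x * pd 0 U x + pd 0 (X 1) x * pd 1 U x * pd 0 U x +
        pd 1 (X 0) x * pd 0 U x * pd 1 U x + pd 1 (X 1) x * pd 1 U x * pd 1 U x))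
      (posPhase U ∩ closedBall 0 r) := by
    have u := fun i => (hU.bddOn_pd i).mono (inter_subset_left (t := closedBall (0 : 𝔼) r))
    have x := fun i j => (hXb i j).mono (inter_subset_right (s := posPhase U))
    exact (((((u 0).mul (u 0)).add ((u 1).mul (u 1))).add (BddOn.const 1)).mul
      ((x 0 0).add (x 1 1))).sub ((BddOn.const 2).mul ((((((x 0 0).mul (u 0)).mul (u 0)).add
        (((x 1 0).mul (u 1)).mul (u 0))).add (((x 0 1).mul (u 0)).mul (u 1))).add
        (((x 1 1).mul (u 1)).mul (u 1))))
  have hz : ∀ x ∈ posPhase U, x ∉ closedBall (0 : 𝔼) r →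
      (pd 0 U x * pd 0 U x + pd 1 U x * pd 1 U x + 1) * (pd 0 (X 0) x + pd 1 (X 1) x) -
      2 * (pd 0 (X 0) x * pd 0 U x * pd 0 U x + pd 0 (X 1) x * pd 1 U x * pd 0 U x +
        pd 1 (X 0) x * pd 0 U x * pd 1 U x + pd 1 (X 1) x * pd 1 U x * pd 1 U x) = 0 := by
    intro x _ hx
    rw [hXz _ _ x hx, hXz _ _ x hx, hXz _ _ x hx, hXz _ _ x hx]
    ring
  refine ⟨integrableOn_of_bddOn hO ?_ hbd hz, ?_⟩
  · have u := fun i => (hU.smooth_pd i).continuousOn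
    have x := fun i j => (contDiff_pd (hX i) j).continuous.continuousOn (s := posPhase U)
    fun_prop
  set V : Fin 2 → 𝔼 → ℝ := fun i y => (pd 0 U y * pd 0 U y + pd 1 U y * pd 1 U y + 1) * X i y -
    2 * ((X 0 y * pd 0 U y + X 1 y * pd 1 U y) * pd i U y) with hV
  have hdiv : ∀ x ∈ posPhase U, pd 0 (V 0) x + pd 1 (V 1) x = _ := fun x hx =>
    hU.div_firstVariationField hx (fun i => hXd i x)
  rw [← setIntegral_congr_fun hO.measurableSet hdiv]
  obtain ⟨C, hC0, hC⟩ := hbd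
  refine hU.integral_div_eq_zero (r := r) (C := C) (fun i => ?_) (fun i x _ hx => ?_)
    (fun x hx => ?_) (fun δ hδ => ?_)
  · have u := hU.smooth_pd
    have x := fun i => (hX i).contDiffOn (s := posPhase U)
    exact ((((((u 0).mul (u 0)).add ((u 1).mul (u 1))).add contDiffOn_const).mul (x i)).sub
      (contDiffOn_const.mul ((((x 0).mul (u 0)).add ((x 1).mul (u 1))).mul (u i)))).of_le (by simp)
  · simp only [hV, hsupp _ x hx]; ring
  · rw [hdiv x hx]
    by_cases hxr : x ∈ closedBall (0 : 𝔼) r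
    · exact hC x ⟨hx, hxr⟩
    · rw [hz x hx hxr, abs_zero]; exact hC0
  · obtain ⟨A, hA0, hA⟩ := (((hXb0 0).mono (inter_subset_right (s := posPhase U))).mul
      ((hU.bddOn_pd 0).mono inter_subset_left)).add
      (((hXb0 1).mono (inter_subset_right (s := posPhase U))).mul
      ((hU.bddOn_pd 1).mono inter_subset_left))
    obtain ⟨ε, hε, h⟩ := hU.boundary r (δ / (A + 1)) (by positivity)
    refine ⟨ε, hε, fun x hx hxr hUx => ?_⟩
    have h1 := h x hx hxr hUx
    have h2 := hA x ⟨hx, hxr⟩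
    have h3 : pd 0 U x * V 0 x + pd 1 U x * V 1 x =
        -((pd 0 U x ^ 2 + pd 1 U x ^ 2 - 1) * (X 0 x * pd 0 U x + X 1 x * pd 1 U x)) := by
      simp only [hV]; ring
    rw [h3, abs_neg, abs_mul]
    calc _ ≤ δ / (A + 1) * A := by gcongr
      _ ≤ δ := by
        rw [div_mul_eq_mul_div, div_le_iff₀ (by positivity)]
        nlinarith

end IsRegular

/-- All second derivatives of Q are gathered in the first variation along (Q·∇)Q, which integrates
to zero. The remaining density involves first derivatives of Q only, which is what later allows
Lipschitz fields. -/
lemma secondVariationDensity_eq (U : 𝔼 → ℝ) {Q : Fin 2 → 𝔼 → ℝ}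
    (hQ : ∀ i, ContDiff ℝ ∞ (Q i)) (x : 𝔼) :
    secondVariationDensity (fun i j => pd j (Q i) x)
      (fun i j => -(Q 0 x * pd 0 (pd j (Q i)) x + Q 1 x * pd 1 (pd j (Q i)) x))
      (fun i => pd i U x) =
    stabilityDensity U Q x +
      ((pd 0 U x * pd 0 U x + pd 1 U x * pd 1 U x + 1) *
        (pd 0 (fun y => Q 0 y * pd 0 (Q 0) y + Q 1 y * pd 1 (Q 0) y) x +
          pd 1 (fun y => Q 0 y * pd 0 (Q 1) y + Q 1 y * pd 1 (Q 1) y) x) -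
      2 * (pd 0 (fun y => Q 0 y * pd 0 (Q 0) y + Q 1 y * pd 1 (Q 0) y) x * pd 0 U x * pd 0 U x +
        pd 0 (fun y => Q 0 y * pd 0 (Q 1) y + Q 1 y * pd 1 (Q 1) y) x * pd 1 U x * pd 0 U x +
        pd 1 (fun y => Q 0 y * pd 0 (Q 0) y + Q 1 y * pd 1 (Q 0) y) x * pd 0 U x * pd 1 U x +
        pd 1 (fun y => Q 0 y * pd 0 (Q 1) y + Q 1 y * pd 1 (Q 1) y) x * pd 1 U x * pd 1 U x)) := by
  have d0 : ∀ i, DifferentiableAt ℝ (Q i) x := fun i => (hQ i).differentiable (by simp) x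
  have d1 : ∀ i j, DifferentiableAt ℝ (pd j (Q i)) x := fun i j =>
    (contDiff_pd (hQ i) j).differentiable (by simp) x
  have hX : ∀ i j, pd j (fun y => Q 0 y * pd 0 (Q i) y + Q 1 y * pd 1 (Q i) y) x =
      Q 0 x * pd j (pd 0 (Q i)) x + pd 0 (Q i) x * pd j (Q 0) x +
        (Q 1 x * pd j (pd 1 (Q i)) x + pd 1 (Q i) x * pd j (Q 1) x) := by
    intro i j
    rw [pd_add ((d0 0).fun_mul (d1 i 0)) ((d0 1).fun_mul (d1 i 1)), pd_mul (d0 0) (d1 i 0),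
      pd_mul (d0 1) (d1 i 1)]
  have hsym : ∀ i, pd 1 (pd 0 (Q i)) x = pd 0 (pd 1 (Q i)) x := fun i =>
    pd_pd_comm ((hQ i).contDiffAt.of_le (WithTop.coe_le_coe.2 le_top)) 1 0
  simp only [hX, hsym, secondVariationDensity, stabilityDensity]
  ring

namespace IsRegular

variable {U : 𝔼 → ℝ} (hU : IsRegular U)
include hU

lemma integrableOn_stabilityDensity {P : Fin 2 → 𝔼 → ℝ}
    (hP : ∀ i, ContDiffOn ℝ 1 (P i) (posPhase U)) {r : ℝ}
    (hb : ∀ i j, BddOn (pd j (P i)) (posPhase U ∩ closedBall 0 r))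
    (hsupp : ∀ i, ∀ x ∈ posPhase U, x ∉ closedBall 0 r → P i x = 0) :
    IntegrableOn (stabilityDensity U P) (posPhase U) := by
  have hO := hU.isOpen
  refine integrableOn_of_bddOn (r := r) hO ?_ ?_ ?_
  · have u := fun i => (hU.smooth_pd i).continuousOn
    have x := fun i j => continuousOn_pd hO (hP i) j
    unfold stabilityDensity
    fun_prop
  · have u := fun i => (hU.bddOn_pd i).mono (inter_subset_left (t := closedBall (0 : 𝔼) r))
    exact ((((((hb 0 0).mul (u 0)).add ((hb 1 0).mul (u 1))).pow 2).add
      ((((hb 0 1).mul (u 0)).add ((hb 1 1).mul (u 1))).pow 2)).add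
      ((((hb 0 0).mul (hb 1 1)).sub ((hb 0 1).mul (hb 1 0))).mul
        ((BddOn.const 1).sub (((u 0).pow 2).add ((u 1).pow 2)))))
  · intro x hx hxr
    have h := fun i j => pd_eq_zero_of_notMem_closedBall hO (hsupp i) j x hx hxr
    simp [stabilityDensity, h]

/-- The stability inequality for smooth fields. -/
lemma stability_of_contDiff (hs : IsStable U) {P : Fin 2 → 𝔼 → ℝ} (hP : ∀ i, ContDiff ℝ ∞ (P i))
    {r : ℝ} (hsupp : ∀ i, ∀ x ∉ closedBall (0 : 𝔼) r, P i x = 0) :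
    0 ≤ ∫ x in posPhase U, stabilityDensity U P x := by
  have hO := hU.isOpen
  set Φ : 𝔼 → 𝔼 := fun x => WithLp.toLp 2 fun i => P i x with hΦdef
  have hΦ : ContDiff ℝ ∞ Φ := (contDiff_euclidean (n := ∞)).2 hP
  have hΦ0 : ∀ x ∉ closedBall (0 : 𝔼) r, Φ x = 0 := fun x hx => by
    ext i
    exact hsupp i x hx
  have hΦc : HasCompactSupport Φ := HasCompactSupport.intro (isCompact_closedBall _ _) hΦ0
  obtain ⟨ε, hε, τ, S, hτ, hτ0, hS, hS1, hS2, hsmall⟩ := exists_inverse_deformation hΦ hΦc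
  -- Only the scaled field has the inverse deformation. The stability density is quadratic in the
  -- field, so the factor ε² is divided out at the end.
  set Q : Fin 2 → 𝔼 → ℝ := fun i x => ε * P i x with hQ
  have hQs : ∀ i, ContDiff ℝ ∞ (Q i) := fun i => contDiff_const.mul (hP i)
  have hQz : ∀ i, ∀ x ∉ closedBall (0 : 𝔼) r, Q i x = 0 := fun i x hx => by
    simp only [hQ, hsupp i x hx, mul_zero]
  have hpdQ : ∀ i j x, pd j (Q i) x = ε * pd j (P i) x := fun i j x =>
    pd_const_mul ε ((hP i).differentiable (by simp) x) j
  have htsupp : tsupport (fun x => ε • Φ x) ⊆ ball 0 (r + 1) := by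
    refine (closure_minimal ?_ isClosed_closedBall).trans (closedBall_subset_ball (lt_add_one r))
    intro x hx
    by_contra h
    exact hx (by simp only [hΦ0 x h, smul_zero])
  have key := second_variation_of_flow hU.cont hU.nonneg
    (fun x hx => (hU.contDiffAt hx).differentiableAt (by simp)) hU.bound hs
    (Φ := fun x => ε • Φ x) (hΦ.const_smul ε)
    (hΦc.mono' (fun x hx => subset_tsupport _ fun h => hx (by simp only [h, smul_zero])))
    htsupp hτ hτ0 hS hS1 hS2 (fun t x i j => by
      have := hsmall t x i j
      have e : pd j (fun y => (ε • Φ y) i) x = ε * pd j (fun y => Φ y i) x :=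
        pd_const_mul ε ((contDiff_coord hΦ i).differentiable (by simp) x) j
      rwa [e])
  have hX : ∀ i, ContDiff ℝ ∞ (fun y => Q 0 y * pd 0 (Q i) y + Q 1 y * pd 1 (Q i) y) := fun i =>
    ((hQs 0).mul (contDiff_pd (hQs i) 0)).add ((hQs 1).mul (contDiff_pd (hQs i) 1))
  have hX0 : ∀ i, ∀ x ∉ closedBall (0 : 𝔼) r,
      Q 0 x * pd 0 (Q i) x + Q 1 x * pd 1 (Q i) x = 0 := fun i x hx => by
    rw [hQz 0 x hx, hQz 1 x hx]; ring
  have hfv := hU.integral_firstVariation_eq_zero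
    (X := fun i y => Q 0 y * pd 0 (Q i) y + Q 1 y * pd 1 (Q i) y) hX hX0
  have hst : IntegrableOn (stabilityDensity U Q) (posPhase U) :=
    hU.integrableOn_stabilityDensity (r := r) (fun i => ((hQs i).contDiffOn).of_le (by simp))
      (fun i j => BddOn.of_continuous_of_subset_closedBall (contDiff_pd (hQs i) j).continuous
        inter_subset_right) (fun i x _ hx => hQz i x hx)
  have hpdQz : ∀ i j, ∀ x ∉ closedBall (0 : 𝔼) r, pd j (Q i) x = 0 := fun i j x hx =>
    pd_eq_zero_of_notMem_closedBall isOpen_univ (fun y _ hy => hQz i y hy) j x (mem_univ _) hx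
  have e1 : ∫ y in ball 0 (r + 1) ∩ posPhase U, secondVariationDensity (fun i j => pd j (Q i) y)
      (fun i j => -(Q 0 y * pd 0 (pd j (Q i)) y + Q 1 y * pd 1 (pd j (Q i)) y))
      (fun i => pd i U y) = ∫ y in posPhase U, secondVariationDensity (fun i j => pd j (Q i) y)
      (fun i j => -(Q 0 y * pd 0 (pd j (Q i)) y + Q 1 y * pd 1 (pd j (Q i)) y))
      (fun i => pd i U y) := by
    symm
    refine setIntegral_eq_of_subset_of_forall_sdiff_eq_zero hO.measurableSet inter_subset_right ?_
    intro x hx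
    have hxr : x ∉ closedBall (0 : 𝔼) r := fun h =>
      hx.2 ⟨closedBall_subset_ball (lt_add_one r) h, hx.1⟩
    simp [secondVariationDensity, hpdQz _ _ x hxr, hQz _ x hxr]
  have e2 : 0 ≤ ∫ y in posPhase U, stabilityDensity U Q y := by
    have h1 : 0 ≤ ∫ y in ball 0 (r + 1) ∩ posPhase U,
      secondVariationDensity (fun i j => pd j (Q i) y)
      (fun i j => -(Q 0 y * pd 0 (pd j (Q i)) y + Q 1 y * pd 1 (pd j (Q i)) y))
      (fun i => pd i U y) := key
    rw [e1] at h1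
    simp only [secondVariationDensity_eq U hQs] at h1
    rw [integral_add hst hfv.1, hfv.2, add_zero] at h1
    exact h1
  have e3 : ∀ x, stabilityDensity U Q x = ε ^ 2 * stabilityDensity U P x := fun x => by
    simp only [stabilityDensity, hpdQ]; ring
  simp only [e3, integral_const_mul] at e2
  exact nonneg_of_mul_nonneg_right e2 (by positivity)

end IsRegular

/-! ### Mollification of Lipschitz functions -/

/-- A Lipschitz function has a smooth approximation which is Lipschitz with the same constant, and
whose derivative at a point is close to any approximate derivative of the function there. -/
lemma exists_mollification {G : 𝔼 → ℝ} {C : NNReal} (hG : LipschitzWith C G) {δ : ℝ} (hδ : 0 < δ) :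
    ∃ M : 𝔼 → ℝ, ContDiff ℝ ∞ M ∧ (∀ x, |M x - G x| ≤ C * δ) ∧ (∀ x, ‖fderiv ℝ M x‖ ≤ C) ∧
      ∀ (x : 𝔼) (l : 𝔼 →L[ℝ] ℝ) (κ : NNReal),
        (∀ a ∈ ball x (2 * δ), ∀ b ∈ ball x (2 * δ), |G a - G b - l (a - b)| ≤ κ * ‖a - b‖) →
          ‖fderiv ℝ M x - l‖ ≤ κ := by
  let φ : ContDiffBump (0 : 𝔼) := ⟨δ / 2, δ, half_pos hδ, half_lt_self hδ⟩
  set ρ : 𝔼 → ℝ := φ.normed volume with hρ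
  have hρc : Continuous ρ := φ.continuous_normed
  have hρs : HasCompactSupport ρ := φ.hasCompactSupport_normed
  have hρ0 : ∀ x, 0 ≤ ρ x := fun x => φ.nonneg_normed x
  have hρi : Integrable ρ := hρc.integrable_of_hasCompactSupport hρs
  have hρ1 : ∫ x, ρ x = 1 := φ.integral_normed
  have hρz : ∀ t ∉ ball (0 : 𝔼) δ, ρ t = 0 := fun t ht => by
    have := φ.support_normed_eq (μ := (volume : Measure 𝔼))
    by_contra h
    exact ht (this ▸ (show t ∈ Function.support (φ.normed volume) from h))
  have hint : ∀ {h : 𝔼 → ℝ}, Continuous h → Integrable fun t => ρ t * h t := fun hh =>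
    (hρc.mul hh).integrable_of_hasCompactSupport hρs.mul_right
  have hest : ∀ {h : 𝔼 → ℝ} {κ : ℝ}, (∀ t ∈ ball (0 : 𝔼) δ, |h t| ≤ κ) →
      |∫ t, ρ t * h t| ≤ κ := by
    intro h κ hh
    calc |∫ t, ρ t * h t| ≤ ∫ t, ρ t * κ := by
          rw [← Real.norm_eq_abs]
          refine norm_integral_le_of_norm_le (hρi.mul_const κ) (Eventually.of_forall fun t => ?_)
          rw [norm_mul, Real.norm_of_nonneg (hρ0 t)]
          by_cases ht : t ∈ ball (0 : 𝔼) δ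
          · exact mul_le_mul_of_nonneg_left (hh t ht) (hρ0 t)
          · rw [hρz t ht]; simp
      _ = κ := by rw [integral_mul_const, hρ1, one_mul]
  have hGc := hG.continuous
  set M : 𝔼 → ℝ := fun x => ∫ t, ρ t * G (x - t) with hM
  have hMs : ContDiff ℝ ∞ M := by
    have := hρs.contDiff_convolution_left (𝕜 := ℝ) (n := (⊤ : ℕ∞)) (ContinuousLinearMap.lsmul ℝ ℝ)
      (φ.contDiff_normed (μ := (volume : Measure 𝔼))) (hGc.locallyIntegrable (μ := volume))
    exact this
  have hGi : ∀ x, Integrable fun t => ρ t * G (x - t) := fun x =>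
    hint (hGc.comp (continuous_const.sub continuous_id))
  -- As the kernel has mass one, constants pass inside the average; all estimates reduce to bounds
  -- on the integrand over the support of the kernel.
  have hdiff : ∀ (a b : 𝔼) (c : ℝ), M a - M b - c = ∫ t, ρ t * (G (a - t) - G (b - t) - c) := by
    intro a b c
    have e : ∀ t, ρ t * (G (a - t) - G (b - t) - c) =
        ρ t * G (a - t) - ρ t * G (b - t) - ρ t * c := fun t => by ring
    simp only [e]
    have hi : Integrable fun t => ρ t * G (a - t) - ρ t * G (b - t) := (hGi a).sub (hGi b)
    rw [integral_sub hi (hρi.mul_const c), integral_sub (hGi a) (hGi b),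
      integral_mul_const, hρ1, one_mul]
  have hGd : ∀ a b, |G a - G b| ≤ C * ‖a - b‖ := fun a b => by
    have := hG.dist_le_mul a b
    rwa [dist_eq_norm, dist_eq_norm, Real.norm_eq_abs] at this
  have hMl : LipschitzWith C M := by
    refine LipschitzWith.of_dist_le_mul fun a b => ?_
    rw [dist_eq_norm, dist_eq_norm, Real.norm_eq_abs]
    have := hdiff a b 0
    rw [sub_zero] at this
    rw [this]
    refine hest fun t _ => ?_
    rw [sub_zero]
    simpa using hGd (a - t) (b - t)
  refine ⟨M, hMs, fun x => ?_, fun x => norm_fderiv_le_of_lipschitz ℝ hMl, fun x l κ h => ?_⟩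
  · have e : M x - G x = ∫ t, ρ t * (G (x - t) - G x) := by
      simp only [mul_sub]
      rw [integral_sub (hGi x) (hρi.mul_const _), integral_mul_const, hρ1, one_mul]
    rw [e]
    refine hest fun t ht => (hGd _ _).trans ?_
    have : ‖x - t - x‖ ≤ δ := by
      rw [sub_right_comm, sub_self, zero_sub, norm_neg]
      exact (mem_ball_zero_iff.1 ht).le
    gcongr
  -- On the ball of radius 2δ the function G - l is κ-Lipschitz. Averaging over shifts shorter than
  -- δ preserves this on the ball of radius δ.
  · have h1 : LipschitzOnWith κ (fun y => M y - l y) (ball x δ) := by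
      refine LipschitzOnWith.of_dist_le_mul fun a ha b hb => ?_
      rw [dist_eq_norm, dist_eq_norm, Real.norm_eq_abs]
      have e : M a - l a - (M b - l b) = M a - M b - l (a - b) := by rw [map_sub]; ring
      rw [e, hdiff]
      refine hest fun t ht => ?_
      have hmem : ∀ c ∈ ball x δ, c - t ∈ ball x (2 * δ) := by
        intro c hc
        rw [mem_ball, dist_eq_norm] at hc ⊢
        rw [mem_ball_zero_iff] at ht
        calc ‖c - t - x‖ = ‖(c - x) - t‖ := by congr 1; abel
          _ ≤ ‖c - x‖ + ‖t‖ := norm_sub_le _ _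
          _ < 2 * δ := by linarith
      simpa using h (a - t) (hmem a ha) (b - t) (hmem b hb)
    have h2 := norm_fderiv_le_of_lipschitzOn ℝ (ball_mem_nhds x hδ) h1
    have h3 : HasFDerivAt (fun y => M y - l y) (fderiv ℝ M x - l) x :=
      (hMs.differentiable (by simp) x).hasFDerivAt.sub l.hasFDerivAt
    rwa [h3.fderiv] at h2

lemma abs_pd_le (f : 𝔼 → ℝ) (x : 𝔼) (j : Fin 2) : |pd j f x| ≤ ‖fderiv ℝ f x‖ := by
  have h := (fderiv ℝ f x).le_opNorm (EuclideanSpace.single j 1)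
  have h2 : ‖(EuclideanSpace.single j (1 : ℝ) : 𝔼)‖ = 1 := by simp
  rwa [h2, mul_one] at h

lemma abs_pd_sub_le {f : 𝔼 → ℝ} {x : 𝔼} (l : 𝔼 →L[ℝ] ℝ) (j : Fin 2) :
    |pd j f x - l (EuclideanSpace.single j 1)| ≤ ‖fderiv ℝ f x - l‖ := by
  have h := (fderiv ℝ f x - l).le_opNorm (EuclideanSpace.single j 1)
  have h2 : ‖(EuclideanSpace.single j (1 : ℝ) : 𝔼)‖ = 1 := by simp
  rwa [h2, mul_one] at h

/-! ### Extension of the stability inequality to Lipschitz fields. -/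

namespace IsRegular

variable {U : 𝔼 → ℝ} (hU : IsRegular U)
include hU

/-- The stability inequality for fields which are only Lipschitz up to the free boundary. -/
lemma stability_of_lipschitz (hs : IsStable U) {P : Fin 2 → 𝔼 → ℝ}
    (hP : ∀ i, ContDiffOn ℝ 1 (P i) (posPhase U)) {r : ℝ} (hr : 0 < r)
    (hlip : ∀ i, ∃ C, LipschitzOnWith C (P i) (posPhase U ∩ closedBall 0 (r + 2)))
    (hsupp : ∀ i, ∀ x ∈ posPhase U, x ∉ closedBall 0 r → P i x = 0) :
    0 ≤ ∫ x in posPhase U, stabilityDensity U P x := by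
  have hO := hU.isOpen
  choose C hC using hlip
  -- Extend the components to Lipschitz functions on the plane and mollify them. The radii leave
  -- room: P lives in radius r, the cutoff reaches r + 1, and G agrees with P on Ω out to r + 2.
  choose G hG hGP using fun i => (hC i).extend_real
  set δ : ℕ → ℝ := fun k => 1 / ((k : ℝ) + 1) with hδ
  have hδ0 : ∀ k, 0 < δ k := fun k => by positivity
  have hδ1 : ∀ k, δ k ≤ 1 := fun k => by
    rw [hδ]; simp only
    rw [div_le_one (by positivity)]
    linarith [Nat.cast_nonneg (α := ℝ) k]
  have hδl : Tendsto δ atTop (𝓝 0) := tendsto_one_div_add_atTop_nhds_zero_nat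
  choose M hMs hMG hMd hMl using fun i k => exists_mollification (hG i) (hδ0 k)
  let χ : ContDiffBump (0 : 𝔼) := ⟨r, r + 1, hr, lt_add_one r⟩
  have hχs : ContDiff ℝ ∞ (χ : 𝔼 → ℝ) := χ.contDiff
  have hχ0 : ∀ x ∉ closedBall (0 : 𝔼) (r + 1), χ x = 0 := fun x hx =>
    χ.zero_of_le_dist (le_of_lt (not_le.1 hx))
  have hχ1 : ∀ x ∈ closedBall (0 : 𝔼) r, χ x = 1 := fun x hx => χ.one_of_mem_closedBall hx
  have hχ1' : ∀ x ∈ closedBall (0 : 𝔼) r, ∀ j, pd j χ x = 0 := fun x hx j => by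
    have : IsLocalMax χ x := Eventually.of_forall fun y => by
      rw [hχ1 x hx]; exact χ.le_one
    rw [pd, this.fderiv_eq_zero]; rfl
  have hχd : ∀ x, DifferentiableAt ℝ χ x := hχs.differentiable (by simp)
  have hMdiff : ∀ i k x, DifferentiableAt ℝ (M i k) x := fun i k =>
    (hMs i k).differentiable (by simp)
  set Pk : ℕ → Fin 2 → 𝔼 → ℝ := fun k i x => χ x * M i k x with hPk
  have hPks : ∀ k i, ContDiff ℝ ∞ (Pk k i) := fun k i => hχs.mul (hMs i k)
  have hPkz : ∀ k i, ∀ x ∉ closedBall (0 : 𝔼) (r + 1), Pk k i x = 0 := fun k i x hx => by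
    simp only [hPk, hχ0 x hx, zero_mul]
  have hpdz : ∀ k i j, ∀ x ∉ closedBall (0 : 𝔼) (r + 1), pd j (Pk k i) x = 0 := fun k i j x hx =>
    pd_eq_zero_of_notMem_closedBall isOpen_univ (fun y _ hy => hPkz k i y hy) j x (mem_univ _) hx
  have hpdk : ∀ k i j x, pd j (Pk k i) x = χ x * pd j (M i k) x + M i k x * pd j χ x :=
    fun k i j x => pd_mul (hχd x) (hMdiff i k x) j
  have hstab : ∀ k, 0 ≤ ∫ x in posPhase U, stabilityDensity U (Pk k) x := fun k =>
    hU.stability_of_contDiff hs (hPks k) (hPkz k)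
  -- uniform bounds
  obtain ⟨A, hA0, hA⟩ : ∃ A, 0 ≤ A ∧ ∀ k i j, ∀ x, |pd j (Pk k i) x| ≤ A := by
    have hb : ∀ i, BddOn (G i) (closedBall 0 (r + 1)) := fun i =>
      BddOn.of_continuous_of_subset_closedBall (hG i).continuous subset_rfl
    choose B hB0 hB using hb
    have hb' : ∀ j, BddOn (pd j χ) (closedBall 0 (r + 1)) := fun j =>
      BddOn.of_continuous_of_subset_closedBall (contDiff_pd hχs j).continuous subset_rfl
    choose D hD0 hD using hb'
    have hnn : ∀ i j, 0 ≤ (C i : ℝ) + (B i + C i) * D j := fun i j => by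
      have := hB0 i; have := hD0 j; positivity
    refine ⟨∑ i, ∑ j, ((C i : ℝ) + (B i + C i) * D j), Finset.sum_nonneg fun i _ =>
      Finset.sum_nonneg fun j _ => hnn i j, fun k i j x => ?_⟩
    refine le_trans ?_ (Finset.single_le_sum (f := fun i => ∑ j, ((C i : ℝ) + (B i + C i) * D j))
      (fun i _ => Finset.sum_nonneg fun j _ => hnn i j) (Finset.mem_univ i))
    refine le_trans ?_ (Finset.single_le_sum (f := fun j => ((C i : ℝ) + (B i + C i) * D j))
      (fun j _ => hnn i j) (Finset.mem_univ j))
    by_cases hx : x ∈ closedBall (0 : 𝔼) (r + 1)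
    · rw [hpdk]
      have h1 : |pd j (M i k) x| ≤ C i := (abs_pd_le _ _ _).trans (hMd i k x)
      have h2 : |M i k x| ≤ B i + C i := by
        have := abs_sub_abs_le_abs_sub (M i k x) (G i x)
        have h3 := hMG i k x
        have h4 := hB i x hx
        have h5 : (C i : ℝ) * δ k ≤ C i * 1 := by gcongr; exact hδ1 k
        linarith
      calc _ ≤ |χ x * pd j (M i k) x| + |M i k x * pd j χ x| := abs_add_le _ _
        _ = χ x * |pd j (M i k) x| + |M i k x| * |pd j χ x| := by
          rw [abs_mul, abs_mul, abs_of_nonneg χ.nonneg]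
        _ ≤ 1 * C i + (B i + C i) * D j := by
          have := χ.le_one (x := x)
          have := hB0 i
          gcongr
          exact hD j x hx
        _ = _ := by rw [one_mul]
    · rw [hpdz k i j x hx, abs_zero]; exact hnn i j
  -- pointwise convergence
  have hconv : ∀ x ∈ posPhase U, ∀ i j, Tendsto (fun k => pd j (Pk k i) x) atTop
      (𝓝 (pd j (P i) x)) := by
    intro x hx i j
    by_cases hxr : x ∈ closedBall (0 : 𝔼) (r + 1)
    · have hnhds : posPhase U ∩ closedBall 0 (r + 2) ∈ 𝓝 x := by
        refine inter_mem (hO.mem_nhds hx) (mem_of_superset (ball_mem_nhds x one_pos) ?_)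
        intro y hy
        rw [mem_closedBall, dist_zero_right] at *
        rw [mem_ball, dist_eq_norm] at hy
        have := norm_add_le x (y - x)
        rw [add_sub_cancel] at this
        linarith
      have hev : P i =ᶠ[𝓝 x] G i := mem_of_superset hnhds (hGP i)
      -- Inside Ω the extension is C¹, hence strictly differentiable. That is the two-point estimate
      -- that makes the derivatives of the mollifications converge.
      have hGx : ContDiffAt ℝ 1 (G i) x :=
        ((hP i).contDiffAt (hO.mem_nhds hx)).congr_of_eventuallyEq hev.symm
      have hstrict := hGx.hasStrictFDerivAt one_ne_zero
      have hMG' : Tendsto (fun k => M i k x) atTop (𝓝 (P i x)) := by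
        rw [hev.self_of_nhds]
        rw [tendsto_iff_dist_tendsto_zero]
        refine squeeze_zero (fun _ => dist_nonneg) (fun k => ?_)
          (by simpa using hδl.const_mul (C i : ℝ))
        rw [Real.dist_eq]
        exact hMG i k x
      have hMp : Tendsto (fun k => pd j (M i k) x) atTop (𝓝 (pd j (P i) x)) := by
        rw [pd_congr hev, Metric.tendsto_atTop]
        intro ε hε
        have hε2 : (0 : ℝ) < ε / 2 := half_pos hε
        have h1 := hstrict.isLittleO.def hε2
        obtain ⟨η, hη, h2⟩ := Metric.eventually_nhds_iff_ball.1 h1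
        obtain ⟨N, hN⟩ := (hδl.eventually (gt_mem_nhds (half_pos hη))).exists_forall_of_atTop
        refine ⟨N, fun k hk => ?_⟩
        have h3 := hMl i k x (fderiv ℝ (G i) x) ⟨ε / 2, hε2.le⟩ (fun a ha b hb => by
          have hlt := hN k hk
          have hab : (a, b) ∈ ball (x, x) η := by
            rw [mem_ball, Prod.dist_eq, max_lt_iff]
            rw [mem_ball] at ha hb
            exact ⟨by simp only; linarith, by simp only; linarith⟩
          exact h2 (a, b) hab)
        rw [Real.dist_eq]
        refine lt_of_le_of_lt ((abs_pd_sub_le _ j).trans h3) ?_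
        exact half_lt_self hε
      have hlim := (hMp.const_mul (χ x)).add (hMG'.mul_const (pd j χ x))
      simp only [hpdk]
      convert hlim using 2
      by_cases hxr' : x ∈ closedBall (0 : 𝔼) r
      · rw [hχ1 x hxr', hχ1' x hxr']; ring
      · rw [hsupp i x hx hxr', pd_eq_zero_of_notMem_closedBall hO (hsupp i) j x hx hxr']; ring
    · have hxr' : x ∉ closedBall (0 : 𝔼) r := fun h =>
        hxr (closedBall_subset_closedBall (lt_add_one r).le h)
      simp only [hpdz _ _ _ x hxr, pd_eq_zero_of_notMem_closedBall hO (hsupp i) j x hx hxr']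
      exact tendsto_const_nhds
  have hlim : Tendsto (fun k => ∫ x in posPhase U, stabilityDensity U (Pk k) x) atTop
      (𝓝 (∫ x in posPhase U, stabilityDensity U P x)) := by
    refine tendsto_integral_of_dominated_convergence ((closedBall (0 : 𝔼) (r + 1)).indicator
      fun _ => (A * 4 + A * 4) ^ 2 + (A * 4 + A * 4) ^ 2 + (A * A + A * A) * 33)
      (fun k => ?_) ?_ (fun k => ?_) ?_
    · refine (hU.integrableOn_stabilityDensity (r := r + 1)
        (fun i => (hPks k i).contDiffOn.of_le (by simp)) (fun i j => ?_)
        (fun i x _ hx => hPkz k i x hx)).aestronglyMeasurable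
      exact BddOn.of_le fun x _ => hA k i j x
    · refine Integrable.integrableOn ?_
      rw [integrable_indicator_iff measurableSet_closedBall]
      exact integrableOn_const measure_closedBall_lt_top.ne
    · filter_upwards [ae_restrict_mem hO.measurableSet] with x hx
      by_cases hxr : x ∈ closedBall (0 : 𝔼) (r + 1)
      · rw [indicator_of_mem hxr, Real.norm_eq_abs, stabilityDensity]
        have u0 := hU.bound x hx 0
        have u1 := hU.bound x hx 1
        have m : ∀ {a b c d : ℝ}, |a| ≤ A → |c| ≤ A → |b| ≤ d → |c * b| ≤ A * d :=
          fun _ hc hb => by rw [abs_mul]; exact mul_le_mul hc hb (abs_nonneg _) hA0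
        have q : ∀ {a b c : ℝ}, |a| ≤ A * 4 → |b| ≤ A * 4 → |(a + b) ^ 2| ≤ (A * 4 + A * 4) ^ 2 :=
          fun {a b c} h1 h2 => by
            rw [abs_pow]
            exact pow_le_pow_left₀ (abs_nonneg _) ((abs_add_le _ _).trans (add_le_add h1 h2)) 2
        -- Both partial derivatives are at most 4 in size, so |∇U|² ≤ 32.
        have s1 : |1 - (pd 0 U x ^ 2 + pd 1 U x ^ 2)| ≤ 33 := by
          have := abs_le.1 u0
          have := abs_le.1 u1
          rw [abs_le]
          constructor <;> nlinarith
        refine (abs_add_le _ _).trans (add_le_add ((abs_add_le _ _).trans (add_le_add ?_ ?_)) ?_)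
        · exact q (c := 0) (m (hA k 0 0 x) (hA k 0 0 x) u0) (m (hA k 0 0 x) (hA k 1 0 x) u1)
        · exact q (c := 0) (m (hA k 0 0 x) (hA k 0 1 x) u0) (m (hA k 0 0 x) (hA k 1 1 x) u1)
        · rw [abs_mul]
          refine mul_le_mul ?_ s1 (abs_nonneg _) (by positivity)
          refine (abs_sub _ _).trans (add_le_add ?_ ?_)
          · exact m (hA k 0 0 x) (hA k 0 0 x) (hA k 1 1 x)
          · exact m (hA k 0 0 x) (hA k 0 1 x) (hA k 1 0 x)
      · rw [indicator_of_notMem hxr]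
        simp [stabilityDensity, hpdz _ _ _ x hxr]
    · filter_upwards [ae_restrict_mem hO.measurableSet] with x hx
      have h := hconv x hx
      unfold stabilityDensity
      exact (((((h 0 0).mul_const _).add ((h 1 0).mul_const _)).pow 2).add
        ((((h 0 1).mul_const _).add ((h 1 1).mul_const _)).pow 2)).add
        ((((h 0 0).mul (h 1 1)).sub ((h 0 1).mul (h 1 0))).mul_const _)
  exact ge_of_tendsto' hlim hstab

end IsRegular

/-! ### The stability inequality for `φ ∇U` -/

/-- The squared norm of the gradient. -/
def gradSq (U : 𝔼 → ℝ) (x : 𝔼) : ℝ := pd 0 U x * pd 0 U x + pd 1 U x * pd 1 U x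

/-- `f` is bounded and Lipschitz on `s`. -/
def BddLipOn (f : 𝔼 → ℝ) (s : Set 𝔼) : Prop := BddOn f s ∧ ∃ C, LipschitzOnWith C f s

namespace BddLipOn

variable {f g : 𝔼 → ℝ} {s : Set 𝔼}

lemma const (c : ℝ) : BddLipOn (fun _ => c) s :=
  ⟨BddOn.const c, 0, (LipschitzWith.const c).lipschitzOnWith⟩

lemma add (hf : BddLipOn f s) (hg : BddLipOn g s) : BddLipOn (fun x => f x + g x) s := by
  obtain ⟨hf1, A, hA⟩ := hf
  obtain ⟨hg1, B, hB⟩ := hg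
  exact ⟨hf1.add hg1, A + B, hA.add hB⟩

lemma sub (hf : BddLipOn f s) (hg : BddLipOn g s) : BddLipOn (fun x => f x - g x) s := by
  obtain ⟨hf1, A, hA⟩ := hf
  obtain ⟨hg1, B, hB⟩ := hg
  exact ⟨hf1.sub hg1, A + B, hA.sub hB⟩

lemma mul (hf : BddLipOn f s) (hg : BddLipOn g s) : BddLipOn (fun x => f x * g x) s := by
  obtain ⟨hf1, A, hA⟩ := hf
  obtain ⟨hg1, B, hB⟩ := hg
  refine ⟨hf1.mul hg1, ?_⟩
  obtain ⟨C, hC0, hC⟩ := hf1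
  obtain ⟨D, hD0, hD⟩ := hg1
  refine ⟨Real.toNNReal (C * B + D * A), LipschitzOnWith.of_dist_le_mul fun x hx y hy => ?_⟩
  have h1 := hA.dist_le_mul x hx y hy
  have h2 := hB.dist_le_mul x hx y hy
  rw [Real.dist_eq] at h1 h2 ⊢
  have e : f x * g x - f y * g y = f x * (g x - g y) + g y * (f x - f y) := by ring
  rw [e]
  calc _ ≤ |f x * (g x - g y)| + |g y * (f x - f y)| := abs_add_le _ _
    _ = |f x| * |g x - g y| + |g y| * |f x - f y| := by rw [abs_mul, abs_mul]
    _ ≤ C * (B * dist x y) + D * (A * dist x y) := by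
      gcongr
      · exact hC x hx
      · exact hD y hy
    _ = _ := by rw [Real.coe_toNNReal _ (by positivity)]; ring

end BddLipOn

/-- Here x = ∇ψ and y = ψ∇s, so ∇φ = (1 - s/128)x - y/128 for φ = ψ(1 - s/128). With φ = ψ there
would be no negative term; the correction produces -s(1 - s/64)|y|²/128, at most -s|y|²/256 when s ≤
32. Half of this absorbs the cross term, of coefficient sθ, by completing the square. -/
lemma quadratic_bound {s x₀ x₁ y₀ y₁ : ℝ} (h0 : 0 ≤ s) (h1 : s ≤ 32) :
    s ^ 2 * (((1 - s / 128) * x₀ - y₀ / 128) ^ 2 + ((1 - s / 128) * x₁ - y₁ / 128) ^ 2) +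
      s * (1 - s / 128) *
        (((1 - s / 128) * x₀ - y₀ / 128) * y₀ + ((1 - s / 128) * x₁ - y₁ / 128) * y₁) ≤
    5120 * (x₀ ^ 2 + x₁ ^ 2) - s * (y₀ ^ 2 + y₁ ^ 2) / 512 := by
  set K := 1 - s / 128 with hK
  set θ := K * (1 - 3 * s / 128) with hθ
  have hK0 : 3 / 4 ≤ K := by rw [hK]; linarith
  have hK1 : K ≤ 1 := by rw [hK]; linarith
  have hθ0 : 0 ≤ θ := by rw [hθ]; apply mul_nonneg <;> linarith
  have hθ1 : θ ≤ 1 := by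
    rw [hθ]
    calc K * (1 - 3 * s / 128) ≤ 1 * 1 := by gcongr <;> linarith
      _ = 1 := one_mul 1
  have hθ2 : θ ^ 2 ≤ 1 := pow_le_one₀ hθ0 hθ1
  have hK2 : K ^ 2 ≤ 1 := pow_le_one₀ (by linarith) hK1
  have e : 5120 * (x₀ ^ 2 + x₁ ^ 2) - s * (y₀ ^ 2 + y₁ ^ 2) / 512 -
      (s ^ 2 * ((K * x₀ - y₀ / 128) ^ 2 + (K * x₁ - y₁ / 128) ^ 2) +
        s * K * ((K * x₀ - y₀ / 128) * y₀ + (K * x₁ - y₁ / 128) * y₁)) =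
      (5120 - s ^ 2 * K ^ 2 - 128 * s * θ ^ 2) * (x₀ ^ 2 + x₁ ^ 2) +
        s * (1 / 2 - 2 * s / 128) / 128 * (y₀ ^ 2 + y₁ ^ 2) +
        s / 512 * ((y₀ - 256 * θ * x₀) ^ 2 + (y₁ - 256 * θ * x₁) ^ 2) := by
    rw [hθ, hK]; ring
  -- 5120 = 32² + 128 · 32, by s ≤ 32 and K², θ² ≤ 1.
  have p1 : 0 ≤ 5120 - s ^ 2 * K ^ 2 - 128 * s * θ ^ 2 := by
    have a1 : s ^ 2 * K ^ 2 ≤ 32 ^ 2 * 1 := by gcongr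
    have a2 : s * θ ^ 2 ≤ 32 * 1 := by gcongr
    linarith
  have p2 : 0 ≤ s * (1 / 2 - 2 * s / 128) / 128 :=
    div_nonneg (mul_nonneg h0 (by linarith)) (by norm_num)
  have : 0 ≤ (5120 - s ^ 2 * K ^ 2 - 128 * s * θ ^ 2) * (x₀ ^ 2 + x₁ ^ 2) +
        s * (1 / 2 - 2 * s / 128) / 128 * (y₀ ^ 2 + y₁ ^ 2) +
        s / 512 * ((y₀ - 256 * θ * x₀) ^ 2 + (y₁ - 256 * θ * x₁) ^ 2) := by positivity
  linarith

namespace IsRegular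

variable {U : 𝔼 → ℝ} (hU : IsRegular U)
include hU

lemma laplacian_pd {x : 𝔼} (hx : x ∈ posPhase U) (i : Fin 2) :
    pd 0 (pd 0 (pd i U)) x + pd 1 (pd 1 (pd i U)) x = 0 := by
  have h2 : (2 : WithTop ℕ∞) ≤ ∞ := WithTop.coe_le_coe.2 le_top
  have key : ∀ j, pd j (pd j (pd i U)) x = pd i (pd j (pd j U)) x := by
    intro j
    have h1 : pd j (pd i U) =ᶠ[𝓝 x] pd i (pd j U) := by
      filter_upwards [hU.isOpen.mem_nhds hx] with y hy
      exact pd_pd_comm ((hU.contDiffAt hy).of_le h2) j i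
    rw [pd_congr h1, pd_pd_comm ((hU.contDiffAt_pd hx j).of_le h2) j i]
  have hd : ∀ j, DifferentiableAt ℝ (pd j (pd j U)) x := fun j =>
    ((contDiffOn_pd hU.isOpen (hU.smooth_pd j) j).contDiffAt
      (hU.isOpen.mem_nhds hx)).differentiableAt (by simp)
  rw [key, key, ← pd_add (hd 0) (hd 1)]
  have h0 : (fun y => pd 0 (pd 0 U) y + pd 1 (pd 1 U) y) =ᶠ[𝓝 x] fun _ => 0 := by
    filter_upwards [hU.isOpen.mem_nhds hx] with y hy using hU.harm y hy
  rw [pd_congr h0, pd_const]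

lemma contDiffOn_gradSq : ContDiffOn ℝ ∞ (gradSq U) (posPhase U) :=
  ((hU.smooth_pd 0).mul (hU.smooth_pd 0)).add ((hU.smooth_pd 1).mul (hU.smooth_pd 1))

lemma pd_gradSq {x : 𝔼} (hx : x ∈ posPhase U) (j : Fin 2) :
    pd j (gradSq U) x = 2 * (pd 0 U x * pd j (pd 0 U) x + pd 1 U x * pd j (pd 1 U) x) := by
  have d := hU.differentiableAt_pd hx
  unfold gradSq
  rw [pd_add ((d 0).fun_mul (d 0)) ((d 1).fun_mul (d 1)), pd_mul (d 0) (d 0), pd_mul (d 1) (d 1)]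
  ring

lemma pd_pd_gradSq {x : 𝔼} (hx : x ∈ posPhase U) (j : Fin 2) :
    pd j (pd j (gradSq U)) x = 2 * (pd j (pd 0 U) x ^ 2 + pd 0 U x * pd j (pd j (pd 0 U)) x +
      (pd j (pd 1 U) x ^ 2 + pd 1 U x * pd j (pd j (pd 1 U)) x)) := by
  have d := hU.differentiableAt_pd hx
  have dd : ∀ i, DifferentiableAt ℝ (pd j (pd i U)) x := fun i =>
    ((contDiffOn_pd hU.isOpen (hU.smooth_pd i) j).contDiffAt
      (hU.isOpen.mem_nhds hx)).differentiableAt (by simp)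
  have h1 : pd j (gradSq U) =ᶠ[𝓝 x]
      fun x => 2 * (pd 0 U x * pd j (pd 0 U) x + pd 1 U x * pd j (pd 1 U) x) := by
    filter_upwards [hU.isOpen.mem_nhds hx] with y hy using hU.pd_gradSq hy j
  rw [pd_congr h1, pd_const_mul 2 (((d 0).fun_mul (dd 0)).fun_add ((d 1).fun_mul (dd 1))),
    pd_add ((d 0).fun_mul (dd 0)) ((d 1).fun_mul (dd 1)), pd_mul (d 0) (dd 0), pd_mul (d 1) (dd 1)]
  ring

/-- Bochner's formula Δ|∇U|² = 2|D²U|² for harmonic U; in the plane the Hessian is symmetric and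
trace free, so two entries determine its norm. -/
lemma laplacian_gradSq {x : 𝔼} (hx : x ∈ posPhase U) :
    pd 0 (pd 0 (gradSq U)) x + pd 1 (pd 1 (gradSq U)) x =
      4 * (pd 0 (pd 0 U) x ^ 2 + pd 0 (pd 1 U) x ^ 2) := by
  rw [hU.pd_pd_gradSq hx, hU.pd_pd_gradSq hx, hU.mixed hx,
    show pd 1 (pd 1 U) x = -pd 0 (pd 0 U) x by linarith [hU.harm x hx]]
  linear_combination 2 * pd 0 U x * hU.laplacian_pd hx 0 + 2 * pd 1 U x * hU.laplacian_pd hx 1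

lemma gradSq_le {x : 𝔼} (hx : x ∈ posPhase U) : gradSq U x ≤ 32 := by
  have h0 := abs_le.1 (hU.bound x hx 0)
  have h1 := abs_le.1 (hU.bound x hx 1)
  unfold gradSq
  nlinarith

omit hU in
lemma gradSq_nonneg (x : 𝔼) : 0 ≤ gradSq U x :=
  add_nonneg (mul_self_nonneg _) (mul_self_nonneg _)

/-- Let h be the sum of squares of the first row of D²U. For a trace-free symmetric 2×2 matrix,
|D²U∇U|² = hs and det D²U = -h, while |∇s|² = 4hs and Δs = 4h. The φ² terms are then h(2s - 1) from
the stability density and h(1 - 2s) from the divergence, and they cancel. -/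
lemma stabilityDensity_mul_gradient {φ : 𝔼 → ℝ} {x : 𝔼} (hx : x ∈ posPhase U)
    (hφ : DifferentiableAt ℝ φ x) :
    gradSq U x ^ 2 * (pd 0 φ x ^ 2 + pd 1 φ x ^ 2) +
      gradSq U x * φ x * (pd 0 φ x * pd 0 (gradSq U) x + pd 1 φ x * pd 1 (gradSq U) x) =
    stabilityDensity U (fun i y => φ y * pd i U y) x + 1 / 4 *
      (pd 0 (fun y => φ y * φ y * ((1 - gradSq U y) * pd 0 (gradSq U) y)) x +
        pd 1 (fun y => φ y * φ y * ((1 - gradSq U y) * pd 1 (gradSq U) y)) x) := by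
  have d := hU.differentiableAt_pd hx
  have hs : DifferentiableAt ℝ (gradSq U) x :=
    (hU.contDiffOn_gradSq.contDiffAt (hU.isOpen.mem_nhds hx)).differentiableAt (by simp)
  have hs1 : DifferentiableAt ℝ (fun y => 1 - gradSq U y) x :=
    (differentiableAt_const _).fun_sub hs
  have hsd : ∀ j, DifferentiableAt ℝ (pd j (gradSq U)) x := fun j =>
    ((contDiffOn_pd hU.isOpen hU.contDiffOn_gradSq j).contDiffAt
      (hU.isOpen.mem_nhds hx)).differentiableAt (by simp)
  have e1 : ∀ j, pd j (fun y => φ y * φ y * ((1 - gradSq U y) * pd j (gradSq U) y)) x =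
      φ x * φ x * ((1 - gradSq U x) * pd j (pd j (gradSq U)) x -
        pd j (gradSq U) x * pd j (gradSq U) x) +
      (1 - gradSq U x) * pd j (gradSq U) x * (2 * φ x * pd j φ x) := by
    intro j
    rw [pd_mul (hφ.fun_mul hφ) (hs1.fun_mul (hsd j)), pd_mul hs1 (hsd j), pd_mul hφ hφ,
      pd_sub (differentiableAt_const _) hs, pd_const]
    ring
  have e2 : ∀ i j, pd j (fun y => φ y * pd i U y) x =
      φ x * pd j (pd i U) x + pd i U x * pd j φ x := fun i j => pd_mul hφ (d i) j
  simp only [stabilityDensity, e1, e2]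
  have hL := hU.laplacian_gradSq hx
  have h11 : pd 1 (pd 1 U) x = -pd 0 (pd 0 U) x := by linarith [hU.harm x hx]
  have g0 := hU.pd_gradSq hx 0
  have g1 := hU.pd_gradSq hx 1
  rw [hU.mixed hx, h11] at g1
  rw [hU.mixed hx, h11]
  have e3 : φ x * φ x * ((1 - gradSq U x) * pd 0 (pd 0 (gradSq U)) x -
        pd 0 (gradSq U) x * pd 0 (gradSq U) x) +
      (1 - gradSq U x) * pd 0 (gradSq U) x * (2 * φ x * pd 0 φ x) +
      (φ x * φ x * ((1 - gradSq U x) * pd 1 (pd 1 (gradSq U)) x -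
        pd 1 (gradSq U) x * pd 1 (gradSq U) x) +
      (1 - gradSq U x) * pd 1 (gradSq U) x * (2 * φ x * pd 1 φ x)) =
      φ x * φ x * ((1 - gradSq U x) * (4 * (pd 0 (pd 0 U) x ^ 2 + pd 0 (pd 1 U) x ^ 2)) -
        (pd 0 (gradSq U) x ^ 2 + pd 1 (gradSq U) x ^ 2)) +
      (1 - gradSq U x) * (2 * φ x) * (pd 0 (gradSq U) x * pd 0 φ x +
        pd 1 (gradSq U) x * pd 1 φ x) := by
    linear_combination φ x * φ x * (1 - gradSq U x) * hL
  rw [e3, g0, g1]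
  unfold gradSq
  ring

/-- The stability inequality tested with `ψ (1 - |∇U|² / 128) ∇U`. -/
lemma integral_gradSq_le (hs : IsStable U) {ψ : 𝔼 → ℝ} (hψ : ContDiff ℝ ∞ ψ) {r : ℝ} (hr : 0 < r)
    (hsupp : ∀ x ∉ closedBall (0 : 𝔼) r, ψ x = 0) :
    IntegrableOn (fun x => gradSq U x * ψ x ^ 2 * (pd 0 (gradSq U) x ^ 2 + pd 1 (gradSq U) x ^ 2))
      (posPhase U) ∧
    ∫ x in posPhase U, gradSq U x * ψ x ^ 2 * (pd 0 (gradSq U) x ^ 2 + pd 1 (gradSq U) x ^ 2) ≤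
      512 * 5120 * ∫ x, (pd 0 ψ x ^ 2 + pd 1 ψ x ^ 2) := by
  have hO := hU.isOpen
  set Ω := posPhase U with hΩ
  set s := gradSq U with hsdef
  -- 128 is four times the bound 32 on s, which keeps the correcting factor between 3/4 and 1.
  set φ : 𝔼 → ℝ := fun y => ψ y * (1 - 1 / 128 * s y) with hφ
  have hss : ContDiffOn ℝ ∞ s Ω := hU.contDiffOn_gradSq
  have hsj : ∀ j, ContDiffOn ℝ ∞ (pd j s) Ω := contDiffOn_pd hO hss
  have hφs : ContDiffOn ℝ ∞ φ Ω :=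
    hψ.contDiffOn.mul (contDiffOn_const.sub (contDiffOn_const.mul hss))
  have hsd : ∀ x ∈ Ω, DifferentiableAt ℝ s x := fun x hx =>
    (hss.contDiffAt (hO.mem_nhds hx)).differentiableAt (by simp)
  have hφd : ∀ x ∈ Ω, DifferentiableAt ℝ φ x := fun x hx =>
    (hφs.contDiffAt (hO.mem_nhds hx)).differentiableAt (by simp)
  have hψd : ∀ x, DifferentiableAt ℝ ψ x := hψ.differentiable (by simp)
  have hφz : ∀ x, x ∉ closedBall (0 : 𝔼) r → φ x = 0 := fun x hx => by
    simp only [hφ, hsupp x hx, zero_mul]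
  have hφj : ∀ x ∈ Ω, ∀ j, pd j φ x = (1 - s x / 128) * pd j ψ x - ψ x * pd j s x / 128 := by
    intro x hx j
    have h1 : DifferentiableAt ℝ (fun y => 1 / 128 * s y) x := (hsd x hx).const_mul _
    rw [hφ, pd_mul (hψd x) ((differentiableAt_const _).fun_sub h1),
      pd_sub (differentiableAt_const _) h1, pd_const, pd_const_mul _ (hsd x hx)]
    ring
  set P : Fin 2 → 𝔼 → ℝ := fun i y => φ y * pd i U y with hP
  have hPs : ∀ i, ContDiffOn ℝ 1 (P i) Ω := fun i => (hφs.mul (hU.smooth_pd i)).of_le (by simp)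
  have hPz : ∀ i, ∀ x ∈ Ω, x ∉ closedBall (0 : 𝔼) r → P i x = 0 := fun i x _ hx => by
    simp only [hP, hφz x hx, zero_mul]
  have hψc : HasCompactSupport ψ := HasCompactSupport.intro (isCompact_closedBall _ _) hsupp
  -- boundedness
  have bu : ∀ t i, BddOn (pd i U) (Ω ∩ closedBall 0 t) := fun t i =>
    (hU.bddOn_pd i).mono inter_subset_left
  have bψ : ∀ t, BddOn ψ (Ω ∩ closedBall 0 t) := fun t =>
    BddOn.of_continuous_of_subset_closedBall hψ.continuous inter_subset_right
  have bψj : ∀ j, BddOn (pd j ψ) (Ω ∩ closedBall 0 r) := fun j =>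
    BddOn.of_continuous_of_subset_closedBall (contDiff_pd hψ j).continuous inter_subset_right
  have bh : ∀ i j, BddOn (pd j (pd i U)) (Ω ∩ closedBall 0 r) := fun i j => by
    obtain ⟨C, hC⟩ := hU.hess r
    exact BddOn.of_le fun x hx => hC x hx.1 hx.2 i j
  have bs : BddOn s (Ω ∩ closedBall 0 r) :=
    ((bu r 0).mul (bu r 0)).add ((bu r 1).mul (bu r 1))
  have bsj : ∀ j, BddOn (pd j s) (Ω ∩ closedBall 0 r) := fun j =>
    ((BddOn.const 2).mul (((bu r 0).mul (bh 0 j)).add ((bu r 1).mul (bh 1 j)))).congr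
      fun x hx => hU.pd_gradSq hx.1 j
  have bφ : BddOn φ (Ω ∩ closedBall 0 r) :=
    (bψ r).mul ((BddOn.const 1).sub ((BddOn.const (1 / 128)).mul bs))
  have bφj : ∀ j, BddOn (pd j φ) (Ω ∩ closedBall 0 r) := fun j =>
    ((((BddOn.const 1).sub (bs.mul (BddOn.const (1 / 128)))).mul (bψj j)).sub
      (((bψ r).mul (bsj j)).mul (BddOn.const (1 / 128)))).congr
      fun x hx => by rw [hφj x hx.1]; ring
  have hlip : ∀ i, ∃ C, LipschitzOnWith C (P i) (Ω ∩ closedBall 0 (r + 2)) := by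
    intro i
    have lu : ∀ i, BddLipOn (pd i U) (Ω ∩ closedBall 0 (r + 2)) := fun i =>
      ⟨bu (r + 2) i, hU.lip (r + 2) i⟩
    have lψ : BddLipOn ψ (Ω ∩ closedBall 0 (r + 2)) := by
      obtain ⟨C, hC⟩ := hψ.lipschitzWith_of_hasCompactSupport hψc (by simp)
      exact ⟨bψ (r + 2), C, hC.lipschitzOnWith⟩
    have ls : BddLipOn s (Ω ∩ closedBall 0 (r + 2)) :=
      ((lu 0).mul (lu 0)).add ((lu 1).mul (lu 1))
    exact ((lψ.mul ((BddLipOn.const 1).sub ((BddLipOn.const (1 / 128)).mul ls))).mul (lu i)).2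
  have key := hU.stability_of_lipschitz hs hPs hr hlip hPz
  have hPint : IntegrableOn (stabilityDensity U P) Ω := by
    refine hU.integrableOn_stabilityDensity hPs (r := r) (fun i j => ?_) hPz
    exact ((bφ.mul (bh i j)).add ((bu r i).mul (bφj j))).congr fun x hx =>
      pd_mul (hφd x hx.1) (hU.differentiableAt_pd hx.1 i) j
  -- the divergence term
  set W : Fin 2 → 𝔼 → ℝ := fun j y => φ y * φ y * ((1 - s y) * pd j s y) with hW
  have hWs : ∀ j, ContDiffOn ℝ 1 (W j) Ω := fun j =>
    ((hφs.mul hφs).mul ((contDiffOn_const.sub hss).mul (hsj j))).of_le (by simp)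
  have hWz : ∀ j, ∀ x ∈ Ω, x ∉ closedBall (0 : 𝔼) r → W j x = 0 := fun j x _ hx => by
    simp only [hW, hφz x hx, zero_mul]
  have hid : ∀ x ∈ Ω, s x ^ 2 * (pd 0 φ x ^ 2 + pd 1 φ x ^ 2) +
      s x * φ x * (pd 0 φ x * pd 0 s x + pd 1 φ x * pd 1 s x) =
      stabilityDensity U P x + 1 / 4 * (pd 0 (W 0) x + pd 1 (W 1) x) := fun x hx =>
    hU.stabilityDensity_mul_gradient hx (hφd x hx)
  have bP : BddOn (stabilityDensity U P) (Ω ∩ closedBall 0 r) := by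
    have hb : ∀ i j, BddOn (pd j (P i)) (Ω ∩ closedBall 0 r) := fun i j =>
      ((bφ.mul (bh i j)).add ((bu r i).mul (bφj j))).congr fun x hx =>
        pd_mul (hφd x hx.1) (hU.differentiableAt_pd hx.1 i) j
    have u := bu r
    exact ((((((hb 0 0).mul (u 0)).add ((hb 1 0).mul (u 1))).pow 2).add
      ((((hb 0 1).mul (u 0)).add ((hb 1 1).mul (u 1))).pow 2)).add
      ((((hb 0 0).mul (hb 1 1)).sub ((hb 0 1).mul (hb 1 0))).mul
        ((BddOn.const 1).sub (((u 0).pow 2).add ((u 1).pow 2)))))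
  -- The divergence of W contains third derivatives of U, for which no bound is available. The
  -- identity expresses it through first and second derivatives, which are bounded.
  have bW : BddOn (fun x => pd 0 (W 0) x + pd 1 (W 1) x) (Ω ∩ closedBall 0 r) :=
    ((BddOn.const 4).mul ((((bs.pow 2).mul (((bφj 0).pow 2).add ((bφj 1).pow 2))).add
      ((bs.mul bφ).mul (((bφj 0).mul (bsj 0)).add ((bφj 1).mul (bsj 1))))).sub bP)).congr
      fun x hx => by linarith [hid x hx.1]
  have hWz' : ∀ x ∈ Ω, x ∉ closedBall (0 : 𝔼) r → pd 0 (W 0) x + pd 1 (W 1) x = 0 :=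
    fun x hx hxr => by
      rw [pd_eq_zero_of_notMem_closedBall hO (hWz 0) 0 x hx hxr,
        pd_eq_zero_of_notMem_closedBall hO (hWz 1) 1 x hx hxr, add_zero]
  have hWint : IntegrableOn (fun x => pd 0 (W 0) x + pd 1 (W 1) x) Ω :=
    integrableOn_of_bddOn hO ((continuousOn_pd hO (hWs 0) 0).add (continuousOn_pd hO (hWs 1) 1))
      bW hWz'
  have hdiv : ∫ x in Ω, (pd 0 (W 0) x + pd 1 (W 1) x) = 0 := by
    obtain ⟨C, hC0, hC⟩ := bW
    refine hU.integral_div_eq_zero hWs hWz (C := C) (fun x hx => ?_) (fun δ hδ => ?_)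
    · by_cases hxr : x ∈ closedBall (0 : 𝔼) r
      · exact hC x ⟨hx, hxr⟩
      · rw [hWz' x hx hxr, abs_zero]; exact hC0
    · obtain ⟨A, hA0, hA⟩ := (bφ.mul bφ).mul (((bu r 0).mul (bsj 0)).add ((bu r 1).mul (bsj 1)))
      obtain ⟨ε, hε, h⟩ := hU.boundary r (δ / (A + 1)) (by positivity)
      refine ⟨ε, hε, fun x hx hxr hUx => ?_⟩
      have h1 := h x hx hxr hUx
      have h2 := hA x ⟨hx, hxr⟩
      -- The flux carries the factor 1 - s, which tends to zero at the free boundary.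
      have h3 : pd 0 U x * W 0 x + pd 1 U x * W 1 x = -((pd 0 U x ^ 2 + pd 1 U x ^ 2 - 1) *
          (φ x * φ x * (pd 0 U x * pd 0 s x + pd 1 U x * pd 1 s x))) := by
        simp only [hW, hsdef, gradSq]; ring
      rw [h3, abs_neg, abs_mul]
      calc _ ≤ δ / (A + 1) * A := by gcongr
        _ ≤ δ := by
          rw [div_mul_eq_mul_div, div_le_iff₀ (by positivity)]
          nlinarith
  have hpos : 0 ≤ ∫ x in Ω, (s x ^ 2 * (pd 0 φ x ^ 2 + pd 1 φ x ^ 2) +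
      s x * φ x * (pd 0 φ x * pd 0 s x + pd 1 φ x * pd 1 s x)) := by
    rw [setIntegral_congr_fun hO.measurableSet hid, integral_add hPint (hWint.const_mul _),
      integral_const_mul, hdiv, mul_zero, add_zero]
    exact key
  have hMint : IntegrableOn (fun x => s x ^ 2 * (pd 0 φ x ^ 2 + pd 1 φ x ^ 2) +
      s x * φ x * (pd 0 φ x * pd 0 s x + pd 1 φ x * pd 1 s x)) Ω :=
    (hPint.add (hWint.const_mul (1 / 4))).congr_fun (fun x hx => (hid x hx).symm) hO.measurableSet
  -- pointwise bound
  have hpt : ∀ x ∈ Ω, s x ^ 2 * (pd 0 φ x ^ 2 + pd 1 φ x ^ 2) +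
      s x * φ x * (pd 0 φ x * pd 0 s x + pd 1 φ x * pd 1 s x) ≤
      5120 * (pd 0 ψ x ^ 2 + pd 1 ψ x ^ 2) -
        1 / 512 * (s x * ψ x ^ 2 * (pd 0 s x ^ 2 + pd 1 s x ^ 2)) := by
    intro x hx
    have h := quadratic_bound (x₀ := pd 0 ψ x) (x₁ := pd 1 ψ x) (y₀ := ψ x * pd 0 s x)
      (y₁ := ψ x * pd 1 s x) (gradSq_nonneg (U := U) x) (hU.gradSq_le hx)
    rw [hφj x hx, hφj x hx]
    simp only [hφ]
    convert h using 1 <;> ring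
  have hint : IntegrableOn (fun x => s x * ψ x ^ 2 * (pd 0 s x ^ 2 + pd 1 s x ^ 2)) Ω := by
    refine integrableOn_of_bddOn (r := r) hO ?_ ?_ ?_
    · have h1 := hss.continuousOn
      have h2 := fun j => (hsj j).continuousOn
      have h3 := hψ.continuous.continuousOn (s := Ω)
      fun_prop
    · exact (bs.mul ((bψ r).pow 2)).mul (((bsj 0).pow 2).add ((bsj 1).pow 2))
    · intro x _ hx
      rw [hsupp x hx]; ring
  have hψint : Integrable (fun x => pd 0 ψ x ^ 2 + pd 1 ψ x ^ 2) := by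
    have h1 : ∀ j, ∀ x ∉ closedBall (0 : 𝔼) r, pd j ψ x = 0 := fun j x hx =>
      pd_eq_zero_of_notMem_closedBall isOpen_univ (fun y _ hy => hsupp y hy) j x (mem_univ _) hx
    refine Continuous.integrable_of_hasCompactSupport ?_
      (HasCompactSupport.intro (isCompact_closedBall (0 : 𝔼) r) fun x hx => ?_)
    · exact ((contDiff_pd hψ 0).continuous.pow 2).add ((contDiff_pd hψ 1).continuous.pow 2)
    · rw [h1 0 x hx, h1 1 x hx]; ring
  refine ⟨hint, ?_⟩
  have h1 : ∫ x in Ω, (s x ^ 2 * (pd 0 φ x ^ 2 + pd 1 φ x ^ 2) +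
      s x * φ x * (pd 0 φ x * pd 0 s x + pd 1 φ x * pd 1 s x)) ≤
      ∫ x in Ω, (5120 * (pd 0 ψ x ^ 2 + pd 1 ψ x ^ 2) -
        1 / 512 * (s x * ψ x ^ 2 * (pd 0 s x ^ 2 + pd 1 s x ^ 2))) :=
    setIntegral_mono_on hMint ((hψint.integrableOn.const_mul _).sub (hint.const_mul _))
      hO.measurableSet hpt
  rw [integral_sub (hψint.integrableOn.const_mul _) (hint.const_mul _), integral_const_mul,
    integral_const_mul] at h1
  have h2 : ∫ x in Ω, (pd 0 ψ x ^ 2 + pd 1 ψ x ^ 2) ≤ ∫ x, (pd 0 ψ x ^ 2 + pd 1 ψ x ^ 2) :=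
    setIntegral_le_integral hψint (Eventually.of_forall fun x => by positivity)
  linarith

end IsRegular

/-! ### Capacity of the plane and flatness -/

lemma sq_sum_of_mul_eq_zero {ι : Type*} (s : Finset ι) {a : ι → ℝ}
    (h : ∀ i j, i ≠ j → a i * a j = 0) : (∑ i ∈ s, a i) ^ 2 = ∑ i ∈ s, a i ^ 2 := by
  rw [sq, Finset.sum_mul_sum]
  refine Finset.sum_congr rfl fun i hi => ?_
  rw [Finset.sum_eq_single i (fun j _ hj => h i j hj.symm) (fun hi' => absurd hi hi'), sq]

lemma pd_comp_smul {f : 𝔼 → ℝ} {c : ℝ} {x : 𝔼} (hf : DifferentiableAt ℝ f (c • x)) (i : Fin 2) :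
    pd i (fun y => f (c • y)) x = c * pd i f (c • x) := by
  have h : HasFDerivAt (fun y : 𝔼 => f (c • y))
      ((fderiv ℝ f (c • x)).comp (c • ContinuousLinearMap.id ℝ 𝔼)) x :=
    hf.hasFDerivAt.comp x ((hasFDerivAt_id x).const_smul c)
  rw [pd, h.fderiv]
  simp [pd]

/-- The plane has zero capacity at infinity. -/
lemma exists_cutoff_of_small_energy {R ε : ℝ} (hR : 0 < R) (hε : 0 < ε) :
    ∃ ψ : 𝔼 → ℝ, ∃ r : ℝ, ContDiff ℝ ∞ ψ ∧ 0 < r ∧ (∀ x ∉ closedBall (0 : 𝔼) r, ψ x = 0) ∧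
      (∀ x ∈ closedBall (0 : 𝔼) R, ψ x = 1) ∧ ∫ x, (pd 0 ψ x ^ 2 + pd 1 ψ x ^ 2) ≤ ε := by
  let χ : ContDiffBump (0 : 𝔼) := ⟨1, 2, one_pos, by norm_num⟩
  have hχ : ContDiff ℝ ∞ (χ : 𝔼 → ℝ) := χ.contDiff
  have hχd : Differentiable ℝ (χ : 𝔼 → ℝ) := hχ.differentiable (by simp)
  have hin : ∀ x : 𝔼, ‖x‖ ≤ 1 → χ x = 1 := fun x hx =>
    χ.one_of_mem_closedBall (by simpa using hx)
  have hout : ∀ x : 𝔼, 2 ≤ ‖x‖ → χ x = 0 := fun x hx =>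
    χ.zero_of_le_dist (by simpa using hx)
  have hpin : ∀ i, ∀ x : 𝔼, ‖x‖ ≤ 1 → pd i χ x = 0 := by
    intro i x hx
    have : IsLocalMax (χ : 𝔼 → ℝ) x := Eventually.of_forall fun y => by
      rw [hin x hx]; exact χ.le_one
    rw [pd, this.fderiv_eq_zero]; simp
  have hpout : ∀ i, ∀ x : 𝔼, 2 ≤ ‖x‖ → pd i χ x = 0 := by
    intro i x hx
    have : IsLocalMin (χ : 𝔼 → ℝ) x := Eventually.of_forall fun y => by
      rw [hout x hx]; exact χ.nonneg
    rw [pd, this.fderiv_eq_zero]; simp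
  have hsq : ∀ i, Integrable fun x : 𝔼 => pd i χ x ^ 2 := by
    intro i
    refine ((contDiff_pd hχ i).continuous.pow 2).integrable_of_hasCompactSupport
      (HasCompactSupport.intro (isCompact_closedBall (0 : 𝔼) 2) fun x hx => ?_)
    rw [mem_closedBall, dist_zero_right, not_le] at hx
    rw [Pi.pow_apply, hpout i x hx.le]; ring
  set A : ℝ := ∑ i, ∫ x : 𝔼, pd i χ x ^ 2 with hA
  have hA0 : 0 ≤ A := Finset.sum_nonneg fun i _ => integral_nonneg fun x => sq_nonneg _
  -- The averaged cutoff below will have energy exactly A / k.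
  obtain ⟨k, hk⟩ := exists_nat_gt (A / ε)
  have hk0 : (0 : ℝ) < k := lt_of_le_of_lt (by positivity) hk
  set c : ℕ → ℝ := fun j => (R * 2 ^ j)⁻¹ with hc
  have hc0 : ∀ j, 0 < c j := fun j => by positivity
  have hnorm : ∀ j, ∀ x : 𝔼, ‖c j • x‖ = ‖x‖ / (R * 2 ^ j) := fun j x => by
    rw [norm_smul, Real.norm_of_nonneg (hc0 j).le, hc]; simp only []; rw [div_eq_inv_mul]
  have hpow : ∀ i j : ℕ, i < j → R * 2 ^ i * 2 ≤ R * 2 ^ j := by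
    intro i j hij
    rw [mul_assoc, ← pow_succ]
    gcongr
    · norm_num
    · exact hij
  -- A smooth substitute for the logarithmic cutoff: the average of k dyadic dilates of one bump.
  -- Their gradients live in the annuli R2ʲ ≤ |x| ≤ R2ʲ⁺¹, so cross terms vanish and the energies
  -- add to k · A / k².
  set ψ : 𝔼 → ℝ := fun x => (k : ℝ)⁻¹ * ∑ j ∈ Finset.range k, χ (c j • x) with hψ
  have hpψ : ∀ i x, pd i ψ x =
      (k : ℝ)⁻¹ * ∑ j ∈ Finset.range k, c j * pd i χ (c j • x) := by
    intro i x
    have h1 : ∀ j, HasFDerivAt (fun y : 𝔼 => χ (c j • y))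
        (fderiv ℝ (fun y : 𝔼 => χ (c j • y)) x) x := fun j =>
      (hχd.comp (differentiable_id.const_smul (c j)) x).hasFDerivAt
    have h2 := (HasFDerivAt.fun_sum (u := Finset.range k) fun j _ => h1 j).const_mul (k : ℝ)⁻¹
    rw [pd, h2.fderiv]
    simp only [smul_apply, smul_eq_mul, sum_apply]
    congr 1
    exact Finset.sum_congr rfl fun j _ => pd_comp_smul (hχd _) i
  have hdisj : ∀ i x, ∀ j l : ℕ, j ≠ l →
      (c j * pd i χ (c j • x)) * (c l * pd i χ (c l • x)) = 0 := by
    intro i x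
    have main : ∀ j l : ℕ, j < l →
        (c j * pd i χ (c j • x)) * (c l * pd i χ (c l • x)) = 0 := by
      intro j l hjl
      rcases le_or_gt ‖x‖ (R * 2 ^ l) with h | h
      · rw [hpin i (c l • x) (by rw [hnorm, div_le_one (by positivity)]; exact h)]; ring
      · rw [hpout i (c j • x) (by
          rw [hnorm, le_div_iff₀ (by positivity)]; linarith [hpow j l hjl])]; ring
    intro j l hjl
    rcases lt_or_gt_of_ne hjl with h | h
    · exact main j l h
    · rw [mul_comm]; exact main l j h
  have hterm : ∀ i j, Integrable (fun x : 𝔼 => (c j * pd i χ (c j • x)) ^ 2) ∧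
      ∫ x : 𝔼, (c j * pd i χ (c j • x)) ^ 2 = ∫ x : 𝔼, pd i χ x ^ 2 := by
    intro i j
    constructor
    · simp only [mul_pow]
      exact ((hsq i).comp_smul (hc0 j).ne').const_mul _
    · simp only [mul_pow]
      rw [integral_const_mul, Measure.integral_comp_smul_of_nonneg volume
        (fun x : 𝔼 => pd i χ x ^ 2) (c j) (hR := (hc0 j).le)]
      -- Dimension two is used here: c² from the gradient cancels the Jacobian c⁻², so each dilate
      -- has the same energy.
      have : Module.finrank ℝ 𝔼 = 2 := by simp
      rw [this, smul_eq_mul, ← mul_assoc, mul_inv_cancel₀ (by have := hc0 j; positivity), one_mul]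
  refine ⟨ψ, R * 2 ^ k, ?_, by positivity, ?_, ?_, ?_⟩
  · refine contDiff_const.mul (ContDiff.sum fun j _ => ?_)
    exact hχ.comp (contDiff_const_smul (c j))
  · intro x hx
    rw [mem_closedBall, dist_zero_right, not_le] at hx
    rw [hψ]
    simp only []
    rw [Finset.sum_eq_zero, mul_zero]
    intro j hj
    refine hout _ ?_
    rw [hnorm, le_div_iff₀ (by positivity)]
    linarith [hpow j k (Finset.mem_range.1 hj)]
  · intro x hx
    rw [mem_closedBall, dist_zero_right] at hx
    rw [hψ]
    simp only []
    rw [Finset.sum_congr rfl (g := fun _ => (1 : ℝ))]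
    · simp [hk0.ne']
    intro j _
    refine hin _ ?_
    rw [hnorm, div_le_one (by positivity)]
    have : (1 : ℝ) ≤ 2 ^ j := one_le_pow₀ (by norm_num)
    nlinarith
  · have h1 : ∀ i, Integrable (fun x => pd i ψ x ^ 2) ∧
        ∫ x, pd i ψ x ^ 2 = (k : ℝ)⁻¹ * ∫ x : 𝔼, pd i χ x ^ 2 := by
      intro i
      have e : (fun x => pd i ψ x ^ 2) = fun x => (k : ℝ)⁻¹ ^ 2 *
          ∑ j ∈ Finset.range k, (c j * pd i χ (c j • x)) ^ 2 := by
        funext x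
        rw [hpψ, mul_pow, sq_sum_of_mul_eq_zero _ (hdisj i x)]
      constructor
      · rw [e]
        exact (integrable_finsetSum _ fun j _ => (hterm i j).1).const_mul _
      · rw [e, integral_const_mul, integral_finsetSum _ fun j _ => (hterm i j).1,
          Finset.sum_congr rfl fun j _ => (hterm i j).2]
        rw [Finset.sum_const, Finset.card_range, nsmul_eq_mul]
        field_simp
    rw [integral_add (h1 0).1 (h1 1).1, (h1 0).2, (h1 1).2, ← mul_add, ← Fin.sum_univ_two
      (f := fun i => ∫ x : 𝔼, pd i χ x ^ 2), ← hA]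
    rw [div_lt_iff₀ hε] at hk
    rw [inv_mul_le_iff₀ hk0]
    exact hk.le

namespace IsRegular

variable {U : 𝔼 → ℝ} (hU : IsRegular U)
include hU

/-- Cutoffs equal to one around x have arbitrarily small energy, so the integral of this nonnegative
quantity over a neighbourhood vanishes. Continuity turns almost everywhere into everywhere. -/
lemma gradSq_mul_pd_gradSq_eq_zero (hs : IsStable U) {x : 𝔼} (hx : x ∈ posPhase U) :
    gradSq U x * (pd 0 (gradSq U) x ^ 2 + pd 1 (gradSq U) x ^ 2) = 0 := by
  set w : 𝔼 → ℝ := fun x => gradSq U x * (pd 0 (gradSq U) x ^ 2 + pd 1 (gradSq U) x ^ 2) with hw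
  have hO := hU.isOpen
  have hw0 : ∀ y, 0 ≤ w y := fun y => mul_nonneg (gradSq_nonneg y) (by positivity)
  have hwc : ContinuousOn w (posPhase U) := by
    have h1 := hU.contDiffOn_gradSq.continuousOn
    have h2 := fun j => (contDiffOn_pd hO hU.contDiffOn_gradSq j).continuousOn
    have := h2 0
    have := h2 1
    fun_prop
  set R := ‖x‖ + 1 with hR
  have hR0 : 0 < R := by positivity
  set S := posPhase U ∩ ball 0 R with hS
  have hSo : IsOpen S := hO.inter isOpen_ball
  have hbound : ∀ ε > 0, IntegrableOn w S ∧ ∫ y in S, w y ≤ 512 * 5120 * ε := by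
    intro ε hε
    obtain ⟨ψ, r, h1, h2, h3, h4, h5⟩ := exists_cutoff_of_small_energy hR0 hε
    obtain ⟨i1, i2⟩ := hU.integral_gradSq_le hs h1 h2 h3
    have e : EqOn (fun x => gradSq U x * ψ x ^ 2 *
        (pd 0 (gradSq U) x ^ 2 + pd 1 (gradSq U) x ^ 2)) w S := by
      intro y hy
      simp only [hw]
      rw [h4 y (ball_subset_closedBall hy.2)]; ring
    constructor
    · exact (i1.mono_set inter_subset_left).congr_fun e hSo.measurableSet
    · rw [← setIntegral_congr_fun hSo.measurableSet e]
      have h6 := setIntegral_mono_set i1 (Eventually.of_forall fun y =>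
        mul_nonneg (mul_nonneg (gradSq_nonneg y) (sq_nonneg _)) (by positivity))
        (LE.le.eventuallyLE (inter_subset_left (s := posPhase U) (t := ball 0 R)))
      linarith
  have hint : ∫ y in S, w y = 0 := by
    refine le_antisymm (le_of_forall_pos_le_add fun ε hε => ?_) (integral_nonneg hw0)
    have := (hbound (ε / (512 * 5120)) (by positivity)).2
    rw [mul_div_cancel₀ _ (by norm_num)] at this
    linarith
  have hae := (setIntegral_eq_zero_iff_of_nonneg_ae (Eventually.of_forall hw0)
    (hbound 1 one_pos).1).1 hint
  have heq := Measure.eqOn_open_of_ae_eq hae hSo (hwc.mono inter_subset_left)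
    (continuousOn_const (c := (0 : ℝ)))
  exact heq ⟨hx, by rw [mem_ball, dist_zero_right]; linarith⟩

/-- Stability forces the Hessian to vanish. -/
lemma pd_pd_eq_zero (hs : IsStable U) {x : 𝔼} (hx : x ∈ posPhase U) (i j : Fin 2) :
    pd j (pd i U) x = 0 := by
  have hO := hU.isOpen
  by_contra hne
  have hcont : ContinuousAt (pd j (pd i U)) x :=
    (contDiffOn_pd hO (hU.smooth_pd i) j).continuousOn.continuousAt (hO.mem_nhds hx)
  -- Since |∇s|² = 4hs, with h half of |D²U|², the previous lemma reads s²h = 0. If the Hessian were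
  -- nonzero at x, then ∇U would vanish near x, and the Hessian with it.
  have hev : ∀ᶠ y in 𝓝 x, gradSq U y = 0 := by
    filter_upwards [hcont.eventually_ne hne, hO.mem_nhds hx] with y hy hyΩ
    have h1 := hU.gradSq_mul_pd_gradSq_eq_zero hs hyΩ
    have h11 : pd 1 (pd 1 U) y = -pd 0 (pd 0 U) y := by linarith [hU.harm y hyΩ]
    have h2 : gradSq U y ^ 2 * (pd 0 (pd 0 U) y ^ 2 + pd 0 (pd 1 U) y ^ 2) = 0 := by
      rw [hU.pd_gradSq hyΩ, hU.pd_gradSq hyΩ, hU.mixed hyΩ, h11] at h1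
      rw [← mul_right_inj' (four_ne_zero (α := ℝ)), mul_zero, ← h1]
      unfold gradSq
      ring
    rcases mul_eq_zero.1 h2 with h3 | h3
    · exact pow_eq_zero_iff two_ne_zero |>.1 h3
    · have h4 : pd 0 (pd 0 U) y = 0 := by nlinarith [sq_nonneg (pd 0 (pd 1 U) y)]
      have h5 : pd 0 (pd 1 U) y = 0 := by nlinarith [sq_nonneg (pd 0 (pd 0 U) y)]
      refine absurd ?_ hy
      fin_cases i <;> fin_cases j
      · exact h4
      · exact (hU.mixed hyΩ).trans h5
      · exact h5
      · exact h11.trans (by rw [h4, neg_zero])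
  have hz : pd i U =ᶠ[𝓝 x] fun _ => 0 := by
    filter_upwards [hev] with y hy
    unfold gradSq at hy
    fin_cases i
    · change pd 0 U y = 0
      nlinarith [mul_self_nonneg (pd 0 U y), mul_self_nonneg (pd 1 U y)]
    · change pd 1 U y = 0
      nlinarith [mul_self_nonneg (pd 0 U y), mul_self_nonneg (pd 1 U y)]
  exact hne (by rw [pd_congr hz, pd_const])

end IsRegular

/-! ### Flat solutions -/

/-- The affine function `e₀ x₀ + e₁ x₁ + b` has a gradient of norm one, and `U` agrees with it
where it is positive. -/
def IsPlanePart (U : 𝔼 → ℝ) (e₀ e₁ b : ℝ) : Prop :=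
  e₀ ^ 2 + e₁ ^ 2 = 1 ∧ ∀ x : 𝔼, 0 < e₀ * x 0 + e₁ * x 1 + b → U x = e₀ * x 0 + e₁ * x 1 + b

/-- The rotation taking the unit vector (e₀, e₁) to the second coordinate axis, followed by a
translation along that axis. -/
lemma exists_affineIsometryEquiv {e₀ e₁ : ℝ} (he : e₀ ^ 2 + e₁ ^ 2 = 1) (b : ℝ) :
    ∃ T : 𝔼 ≃ᵃⁱ[ℝ] 𝔼, ∀ x, (T x) 1 = e₀ * x 0 + e₁ * x 1 + b := by
  let M : 𝔼 →ₗ[ℝ] 𝔼 :=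
    { toFun := fun x => !₂[e₁ * x 0 - e₀ * x 1, e₀ * x 0 + e₁ * x 1]
      map_add' := fun x y => by
        ext i; fin_cases i <;> simp <;> ring
      map_smul' := fun c x => by
        ext i; fin_cases i <;> simp <;> ring }
  let I : 𝔼 →ₗᵢ[ℝ] 𝔼 := ⟨M, fun x => by
    rw [EuclideanSpace.norm_eq, EuclideanSpace.norm_eq]
    congr 1
    simp only [Fin.sum_univ_two, Real.norm_eq_abs, sq_abs]
    simp only [M, LinearMap.coe_mk, AddHom.coe_mk, PiLp.toLp_apply, Matrix.cons_val_zero,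
      Matrix.cons_val_one]
    linear_combination (x 0 ^ 2 + x 1 ^ 2) * he⟩
  refine ⟨(I.toLinearIsometryEquiv rfl).toAffineIsometryEquiv.trans
    (AffineIsometryEquiv.constVAdd ℝ 𝔼 (EuclideanSpace.single 1 b)), fun x => ?_⟩
  simp [I, M, add_comm]

namespace IsPlanePart

variable {U : 𝔼 → ℝ} {e₀ e₁ b f₀ f₁ c : ℝ}

lemma hasDirection (h : IsPlanePart U e₀ e₁ b) (x : 𝔼) (t : ℝ) :
    e₀ * (x + t • !₂[e₀, e₁]) 0 + e₁ * (x + t • !₂[e₀, e₁]) 1 + b =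
      e₀ * x 0 + e₁ * x 1 + b + t := by
  simp
  linear_combination t * h.1

lemma tendsto (x : 𝔼) : Tendsto (fun t : ℝ => x + t • (!₂[e₀, e₁] : 𝔼)) (𝓝[>] 0) (𝓝 x) := by
  have h1 : Continuous fun t : ℝ => x + t • (!₂[e₀, e₁] : 𝔼) := by fun_prop
  simpa using (h1.tendsto 0).mono_left nhdsWithin_le_nhds

lemma eq_zero (h : IsPlanePart U e₀ e₁ b) (hU : Continuous U) {x : 𝔼}
    (hx : e₀ * x 0 + e₁ * x 1 + b = 0) : U x = 0 := by
  have h1 : Tendsto (fun t : ℝ => U (x + t • !₂[e₀, e₁])) (𝓝[>] 0) (𝓝 (U x)) :=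
    (hU.tendsto x).comp (tendsto x)
  have h2 : Tendsto (fun t : ℝ => t) (𝓝[>] (0 : ℝ)) (𝓝 0) := nhdsWithin_le_nhds
  refine tendsto_nhds_unique (h1.congr' ?_) h2
  filter_upwards [self_mem_nhdsWithin] with t ht
  have := h.hasDirection x t
  rw [hx, zero_add] at this
  rw [h.2 _ (by rw [this]; exact ht), this]

lemma mem_freeBoundary (h : IsPlanePart U e₀ e₁ b) (hU : Continuous U) {x : 𝔼}
    (hx : e₀ * x 0 + e₁ * x 1 + b = 0) : x ∈ freeBoundary U := by
  rw [freeBoundary, (isOpen_posPhase hU).frontier_eq]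
  refine ⟨mem_closure_of_tendsto (tendsto (e₀ := e₀) (e₁ := e₁) x) ?_, ?_⟩
  · filter_upwards [self_mem_nhdsWithin] with t (ht : 0 < t)
    have := h.hasDirection x t
    rw [hx, zero_add] at this
    change 0 < U _
    rwa [h.2 _ (by rw [this]; exact ht), this]
  · change ¬ 0 < U x
    rw [h.eq_zero hU hx]; exact lt_irrefl _

/-- Different plane parts have opposite normals. -/
lemma opposite (h : IsPlanePart U e₀ e₁ b) (h' : IsPlanePart U f₀ f₁ c) (hU : Continuous U)
    {x : 𝔼} (hx : e₀ * x 0 + e₁ * x 1 + b ≤ 0) (hx' : 0 < f₀ * x 0 + f₁ * x 1 + c) :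
    f₀ = -e₀ ∧ f₁ = -e₁ ∧ b + c ≤ 0 := by
  -- U vanishes on the edge of the first half-plane, so no point of this edge lies in the second
  -- half-plane.
  have key : ∀ y : 𝔼, e₀ * y 0 + e₁ * y 1 + b = 0 → f₀ * y 0 + f₁ * y 1 + c ≤ 0 := by
    intro y hy
    by_contra! hlt
    have := h'.2 y hlt
    rw [h.eq_zero hU hy] at this
    linarith
  have hD : e₀ * f₁ - e₁ * f₀ = 0 := by
    by_contra hD
    -- If the normals were independent, Cramer's rule would give this point, on the first edge and
    -- with value 1 of the second affine function.
    have := key !₂[(-b * f₁ - e₁ * (1 - c)) / (e₀ * f₁ - e₁ * f₀),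
      (e₀ * (1 - c) + b * f₀) / (e₀ * f₁ - e₁ * f₀)] (by
        simp only [Matrix.cons_val_zero, Matrix.cons_val_one]
        field_simp
        ring)
    simp only [Matrix.cons_val_zero, Matrix.cons_val_one] at this
    have e : f₀ * ((-b * f₁ - e₁ * (1 - c)) / (e₀ * f₁ - e₁ * f₀)) +
        f₁ * ((e₀ * (1 - c) + b * f₀) / (e₀ * f₁ - e₁ * f₀)) + c = 1 := by
      rw [mul_div_assoc', mul_div_assoc', ← add_div, div_add' _ _ _ hD, div_eq_one_iff_eq hD]
      ring
    linarith
  set k := e₀ * f₀ + e₁ * f₁ with hk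
  have hf0 : f₀ = k * e₀ := by
    rw [hk]; linear_combination -f₀ * h.1 - e₁ * hD
  have hf1 : f₁ = k * e₁ := by
    rw [hk]; linear_combination -f₁ * h.1 + e₀ * hD
  have hk2 : k ^ 2 = 1 := by
    have := h'.1
    rw [hf0, hf1] at this
    linear_combination this - k ^ 2 * h.1
  -- Project x onto the first edge. With equal normals (k = 1) the second function would be even
  -- larger at the projection than at x, hence positive, which is impossible; so k = -1.
  have hproj := key (x + (-(e₀ * x 0 + e₁ * x 1 + b)) • !₂[e₀, e₁]) (by
    rw [h.hasDirection]; ring)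
  have e : f₀ * (x + (-(e₀ * x 0 + e₁ * x 1 + b)) • !₂[e₀, e₁]) 0 +
      f₁ * (x + (-(e₀ * x 0 + e₁ * x 1 + b)) • !₂[e₀, e₁]) 1 + c =
      f₀ * x 0 + f₁ * x 1 + c - k * (e₀ * x 0 + e₁ * x 1 + b) := by
    simp
    rw [hk]; ring
  rw [e] at hproj
  rcases mul_self_eq_one_iff.1 ((sq k).symm.trans hk2) with h1 | h1
  · rw [h1] at hproj; linarith
  · rw [h1] at hf0 hf1 hproj
    refine ⟨by linarith, by linarith, ?_⟩
    rw [hf0, hf1] at hproj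
    linarith

end IsPlanePart

namespace IsRegular

variable {U : 𝔼 → ℝ} (hU : IsRegular U)
include hU

/-- Continuation over the convex set where the tangent function L at x is positive. Agreement of U
and its gradient with L is open because the Hessian vanishes. It is closed there because at a limit
point U = L > 0, so the point is still in the positive phase. -/
lemma eq_affine_of_flat (hflat : ∀ x ∈ posPhase U, ∀ i j, pd j (pd i U) x = 0) {x : 𝔼}
    (hx : x ∈ posPhase U) {y : 𝔼}
    (hy : 0 < U x + (pd 0 U x * (y 0 - x 0) + pd 1 U x * (y 1 - x 1))) :
    U y = U x + (pd 0 U x * (y 0 - x 0) + pd 1 U x * (y 1 - x 1)) ∧ ∀ i, pd i U y = pd i U x := by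
  set L : 𝔼 → ℝ := fun y => U x + (pd 0 U x * (y 0 - x 0) + pd 1 U x * (y 1 - x 1)) with hL
  have hO := hU.isOpen
  have hLc : Continuous L := by fun_prop
  have hLd : ∀ z, HasFDerivAt L (fderiv ℝ L z) z := fun z =>
    DifferentiableAt.hasFDerivAt (by fun_prop)
  have hLp : ∀ i z, pd i L z = pd i U x := by
    intro i z
    have h0 : HasFDerivAt (fun y : 𝔼 => y 0) (EuclideanSpace.proj (𝕜 := ℝ) (0 : Fin 2)) z :=
      (EuclideanSpace.proj (𝕜 := ℝ) (0 : Fin 2) : 𝔼 →L[ℝ] ℝ).hasFDerivAt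
    have h1 : HasFDerivAt (fun y : 𝔼 => y 1) (EuclideanSpace.proj (𝕜 := ℝ) (1 : Fin 2)) z :=
      (EuclideanSpace.proj (𝕜 := ℝ) (1 : Fin 2) : 𝔼 →L[ℝ] ℝ).hasFDerivAt
    have h2 := (((h0.sub_const (x 0)).const_mul (pd 0 U x)).add
      ((h1.sub_const (x 1)).const_mul (pd 1 U x))).const_add (U x)
    rw [pd, HasFDerivAt.fderiv (f := L) h2]
    fin_cases i <;> simp
  set A : Set 𝔼 := {z | z ∈ posPhase U ∧ U z = L z ∧ ∀ i, pd i U z = pd i U x} with hA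
  have hAo : IsOpen A := by
    rw [Metric.isOpen_iff]
    rintro z ⟨hz, hzL, hzp⟩
    obtain ⟨ε, hε, hball⟩ := Metric.isOpen_iff.1 hO z hz
    have hpre : IsPreconnected (ball z ε) := (convex_ball z ε).isPreconnected
    have hz0 : z ∈ ball z ε := mem_ball_self hε
    have hp : ∀ w ∈ ball z ε, ∀ i, pd i U w = pd i U x := by
      intro w hw i
      rw [← hzp i]
      refine isOpen_ball.is_const_of_fderiv_eq_zero hpre
        (fun v hv => (hU.differentiableAt_pd (hball hv) i).differentiableWithinAt)
        (fun v hv => ?_) hw hz0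
      ext u
      rw [fderiv_apply_eq, hflat v (hball hv), hflat v (hball hv)]
      simp
    refine ⟨ε, hε, fun w hw => ⟨hball hw, ?_, hp w hw⟩⟩
    have hd : ∀ v ∈ ball z ε, HasFDerivAt (fun y => U y - L y) (fderiv ℝ U v - fderiv ℝ L v) v :=
      fun v hv => ((hU.contDiffAt (hball hv)).differentiableAt (by simp)).hasFDerivAt.sub (hLd v)
    have h := isOpen_ball.is_const_of_fderiv_eq_zero (f := fun y => U y - L y) hpre
        (fun v hv => (hd v hv).differentiableAt.differentiableWithinAt)
        (fun v hv => ?_) hw hz0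
    · simp only [hzL, sub_self] at h
      linarith
    · rw [(hd v hv).fderiv]
      ext u
      change fderiv ℝ U v u - fderiv ℝ L v u = 0
      rw [fderiv_apply_eq, fderiv_apply_eq, hLp, hLp, hp v hv, hp v hv, sub_self]
  have hconv : IsPreconnected {z | 0 < L z} := by
    refine Convex.isPreconnected ?_
    intro z hz w hw s t hs ht hst
    simp only [mem_ofPred_eq, hL] at hz hw ⊢
    have e : U x + (pd 0 U x * ((s • z + t • w) 0 - x 0) + pd 1 U x * ((s • z + t • w) 1 - x 1)) =
        s * L z + t * L w := by
      simp only [hL, PiLp.add_apply, PiLp.smul_apply, smul_eq_mul]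
      linear_combination (pd 0 U x * x 0 + pd 1 U x * x 1 - U x) * hst
    rw [e]
    rcases hs.eq_or_lt with h | h
    · have : t = 1 := by linarith
      rw [← h, this, zero_mul, zero_add, one_mul]; exact hw
    · exact add_pos_of_pos_of_nonneg (mul_pos h hz) (mul_nonneg ht hw.le)
  have hLx : L x = U x := by simp [hL]
  have hsub := hconv.subset_of_closure_inter_subset hAo
    ⟨x, by rw [mem_ofPred_eq, hLx]; exact hx, hx, hLx.symm, fun _ => rfl⟩ (by
      rintro z ⟨hz, hzL⟩
      have h1 : U z = L z := by
        have : closure A ⊆ {z | U z = L z} :=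
          closure_minimal (fun w hw => hw.2.1) (isClosed_eq hU.cont hLc)
        exact this hz
      have h2 : z ∈ posPhase U := by
        change 0 < U z
        rw [h1]; exact hzL
      refine ⟨h2, h1, fun i => ?_⟩
      have h3 : ContinuousAt (pd i U) z :=
        (hU.smooth_pd i).continuousOn.continuousAt (hO.mem_nhds h2)
      obtain ⟨u, hu, hut⟩ := mem_closure_iff_seq_limit.1 hz
      have h4 := h3.tendsto.comp hut
      refine tendsto_nhds_unique h4 (tendsto_const_nhds.congr fun n => ?_)
      exact ((hu n).2.2 i).symm)
  exact (hsub hy).2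

/-- The gradient at x is nonzero, since otherwise U would be a positive constant on the plane,
without free boundary. It has length one because it is the same up to the edge of the half-plane,
where the free boundary condition applies. -/
lemma exists_isPlanePart (hflat : ∀ x ∈ posPhase U, ∀ i j, pd j (pd i U) x = 0)
    (hF : (freeBoundary U).Nonempty) {x : 𝔼} (hx : x ∈ posPhase U) :
    ∃ e₀ e₁ b, IsPlanePart U e₀ e₁ b ∧ 0 < e₀ * x 0 + e₁ * x 1 + b := by
  have hx0 : 0 < U x := hx
  set e₀ := pd 0 U x with he0
  set e₁ := pd 1 U x with he1
  set b := U x - (e₀ * x 0 + e₁ * x 1) with hb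
  have main : ∀ y : 𝔼, 0 < e₀ * y 0 + e₁ * y 1 + b →
      U y = e₀ * y 0 + e₁ * y 1 + b ∧ ∀ i, pd i U y = pd i U x := by
    intro y hy
    have e : U x + (pd 0 U x * (y 0 - x 0) + pd 1 U x * (y 1 - x 1)) =
        e₀ * y 0 + e₁ * y 1 + b := by rw [hb, he0, he1]; ring
    have := hU.eq_affine_of_flat hflat hx (y := y) (by rw [e]; exact hy)
    rwa [e] at this
  set m := e₀ ^ 2 + e₁ ^ 2 with hm
  have hm0 : 0 < m := by
    refine lt_of_le_of_ne (by positivity) fun h => ?_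
    have h0 : e₀ = 0 := by nlinarith [sq_nonneg e₁]
    have h1 : e₁ = 0 := by nlinarith [sq_nonneg e₀]
    have huniv : posPhase U = univ := by
      refine eq_univ_of_forall fun y => ?_
      have : 0 < e₀ * y 0 + e₁ * y 1 + b := by rw [hb, h0, h1]; linarith
      change 0 < U y
      rw [(main y this).1]; exact this
    rw [freeBoundary, huniv, frontier_univ] at hF
    exact not_nonempty_empty hF
  refine ⟨e₀, e₁, b, ⟨?_, fun y hy => (main y hy).1⟩, by rw [hb]; linarith⟩
  have hle : |m - 1| ≤ 0 := by
    refine le_of_forall_pos_le_add fun δ hδ => ?_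
    rw [zero_add]
    set r := ‖x‖ + (1 + U x / m) * ‖(!₂[e₀, e₁] : 𝔼)‖ with hr
    obtain ⟨ε, hε, h⟩ := hU.boundary r δ hδ
    set t := min 1 (ε / (2 * m)) with ht
    have ht0 : 0 < t := by positivity
    have ht1 : t ≤ 1 := min_le_left _ _
    have ht2 : t * m < ε := by
      have : t * m ≤ ε / (2 * m) * m := by gcongr; exact min_le_right _ _
      have e : ε / (2 * m) * m = ε / 2 := by field_simp
      linarith
    -- The point on the normal line through x where the affine function equals tm, a positive value
    -- below ε; r was chosen so that y stays in the ball.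
    set y : 𝔼 := x + (t - U x / m) • !₂[e₀, e₁] with hy
    have hyL : e₀ * y 0 + e₁ * y 1 + b = t * m := by
      have e : e₀ * y 0 + e₁ * y 1 + b = U x + (t - U x / m) * m := by
        rw [hy, hb, hm]; simp; ring
      rw [e]; field_simp; ring
    have hypos : 0 < e₀ * y 0 + e₁ * y 1 + b := by rw [hyL]; positivity
    obtain ⟨h1, h2⟩ := main y hypos
    have h3 := h y (by change 0 < U y; rw [h1]; exact hypos) (by
      rw [mem_closedBall, dist_zero_right, hy, hr]
      refine (norm_add_le _ _).trans ?_
      rw [norm_smul]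
      gcongr
      rw [Real.norm_eq_abs]
      have : 0 ≤ U x / m := by positivity
      rw [abs_le]; constructor <;> linarith) (by rw [h1, hyL]; exact ht2)
    rwa [h2, h2] at h3
  have := abs_nonpos_iff.1 hle
  linarith

/-- A flat solution consists of one or of two half-planes. -/
lemma classification_of_flat (hflat : ∀ x ∈ posPhase U, ∀ i j, pd j (pd i U) x = 0)
    (hF : (freeBoundary U).Nonempty) (hb : HasSmoothOneSidedBoundary U) :
    ∃ T : 𝔼 ≃ᵃⁱ[ℝ] 𝔼, (∀ x, U x = onePlane (T x)) ∨
      ∃ a : ℝ, 0 < a ∧ ∀ x, U x = twoPlane a (T x) := by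
  have hzero : ∀ x, x ∉ posPhase U → U x = 0 := fun x hx =>
    le_antisymm (not_lt.1 hx) (hU.nonneg x)
  obtain ⟨x, hx⟩ : (posPhase U).Nonempty := by
    rw [nonempty_iff_ne_empty]
    intro h
    rw [freeBoundary, h, frontier_empty] at hF
    exact not_nonempty_empty hF
  obtain ⟨e₀, e₁, b, he, hxe⟩ := hU.exists_isPlanePart hflat hF hx
  obtain ⟨T, hT⟩ := exists_affineIsometryEquiv he.1 b
  refine ⟨T, ?_⟩
  by_cases hone : ∀ y, e₀ * y 0 + e₁ * y 1 + b ≤ 0 → y ∉ posPhase U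
  · left
    intro y
    rw [onePlane, hT]
    rcases le_or_gt (e₀ * y 0 + e₁ * y 1 + b) 0 with h | h
    · rw [hzero y (hone y h), posPart_eq_zero.2 h]
    · rw [he.2 y h, posPart_eq_self.2 h.le]
  right
  push Not at hone
  obtain ⟨y, hye, hy⟩ := hone
  obtain ⟨f₀, f₁, c, hf, hyf⟩ := hU.exists_isPlanePart hflat hF hy
  obtain ⟨hf0, hf1, hbc⟩ := he.opposite hf hU.cont hye hyf
  -- A third half-plane would have a normal opposite to both e and f = -e, forcing e = 0.
  have hgap : ∀ z, e₀ * z 0 + e₁ * z 1 + b ≤ 0 → f₀ * z 0 + f₁ * z 1 + c ≤ 0 → U z = 0 := by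
    intro z h1 h2
    refine hzero z fun hz => ?_
    obtain ⟨g₀, g₁, d, hg, hzg⟩ := hU.exists_isPlanePart hflat hF hz
    obtain ⟨p0, p1, -⟩ := he.opposite hg hU.cont h1 hzg
    obtain ⟨q0, q1, -⟩ := hf.opposite hg hU.cont h2 hzg
    have := he.1
    have h0 : e₀ = 0 := by linarith
    have h1 : e₁ = 0 := by linarith
    rw [h0, h1] at this
    norm_num at this
  refine ⟨-(b + c), ?_, ?_⟩
  -- With zero gap U is positive on both sides of a common edge. The defining function g of the free
  -- boundary then has a local minimum at an edge point, against ∇g ≠ 0.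
  · refine lt_of_le_of_ne (by linarith) fun h => ?_
    set p : 𝔼 := x + (-(e₀ * x 0 + e₁ * x 1 + b)) • !₂[e₀, e₁] with hp
    have hpe : e₀ * p 0 + e₁ * p 1 + b = 0 := by rw [hp, he.hasDirection]; ring
    have hpF := he.mem_freeBoundary hU.cont hpe
    obtain ⟨V, g, hVo, hpV, hg, hg0, hgV⟩ := hb p hpF
    have hmin : IsLocalMin g p := by
      filter_upwards [hVo.mem_nhds hpV] with z hz
      rw [((hgV p hpV).1.1 hpF)]
      by_cases hzΩ : z ∈ posPhase U
      · exact ((hgV z hz).2.1 hzΩ).le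
      · have hz0 := hzero z hzΩ
        have : e₀ * z 0 + e₁ * z 1 + b = 0 := by
          refine le_antisymm ?_ ?_
          · by_contra! hlt
            have := he.2 z hlt
            linarith
          · by_contra! hlt
            have h5 : f₀ * z 0 + f₁ * z 1 + c = -(e₀ * z 0 + e₁ * z 1 + b) := by
              rw [hf0, hf1]; linarith
            have := hf.2 z (by rw [h5]; linarith)
            linarith
        exact ((hgV z hz).1.1 (he.mem_freeBoundary hU.cont this)).ge
    refine hg0 p hpV ?_
    rw [gradient, hmin.fderiv_eq_zero, map_zero]
  · intro z
    rw [twoPlane, hT]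
    have h5 : f₀ * z 0 + f₁ * z 1 + c = -(e₀ * z 0 + e₁ * z 1 + b + -(b + c)) := by
      rw [hf0, hf1]; ring
    rcases le_or_gt (e₀ * z 0 + e₁ * z 1 + b) 0 with h | h
    · rw [posPart_eq_zero.2 h, zero_add]
      rcases le_or_gt (f₀ * z 0 + f₁ * z 1 + c) 0 with h' | h'
      · rw [hgap z h h', negPart_eq_zero.2 (by linarith)]
      · rw [hf.2 z h', h5, negPart_eq_neg.2 (by linarith)]
    · rw [he.2 z h, posPart_eq_self.2 h.le, negPart_eq_zero.2 (by linarith), add_zero]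

end IsRegular

/-! ### Regularity up to the free boundary -/

lemma mem_closure_posPhase_iff {U : 𝔼 → ℝ} {x : 𝔼} :
    x ∈ closure (posPhase U) ↔ x ∈ posPhase U ∨ x ∈ freeBoundary U := by
  rw [closure_eq_self_union_frontier]; rfl

/-- The closed positive phase satisfies a uniform interior cone condition near each of its
boundary points. -/
lemma exists_interior_cone {U : 𝔼 → ℝ} (hb : HasSmoothOneSidedBoundary U) {p : 𝔼}
    (hp : p ∈ freeBoundary U) :
    ∃ e : 𝔼, ‖e‖ = 1 ∧ ∃ ρ > 0, ∀ x ∈ closure (posPhase U), x ∈ ball p ρ →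
      ∀ z ∈ ball p ρ, ‖z - x‖ ≤ 4 * inner ℝ e (z - x) → z ∈ closure (posPhase U) := by
  obtain ⟨V, g, hVo, hpV, hg, hg0, hgV⟩ := hb p hp
  have hcl : ∀ x ∈ V, (x ∈ closure (posPhase U) ↔ 0 ≤ g x) := by
    intro x hx
    rw [mem_closure_posPhase_iff, (hgV x hx).1, (hgV x hx).2, le_iff_lt_or_eq, eq_comm (a := g x)]
  have hm : 0 < ‖∇ g p‖ := norm_pos_iff.2 (hg0 p hpV)
  have hstrict : HasStrictFDerivAt g (fderiv ℝ g p) p :=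
    (hg.contDiffAt (hVo.mem_nhds hpV)).hasStrictFDerivAt (by simp)
  -- With e = ∇g(p)/|∇g(p)|, strict differentiability gives g(z) - g(x) ≥ |∇g(p)|(e·(z - x) - |z -
  -- x|/4). This is nonnegative in the cone |z - x| ≤ 4 e·(z - x), so g ≥ 0 persists.
  obtain ⟨ρ₁, hρ₁, h₁⟩ := Metric.eventually_nhds_iff_ball.1
    (hstrict.isLittleO.bound (c := ‖∇ g p‖ / 4) (by positivity))
  obtain ⟨ρ₂, hρ₂, h₂⟩ := Metric.isOpen_iff.1 hVo p hpV
  refine ⟨‖∇ g p‖⁻¹ • ∇ g p, ?_, min ρ₁ ρ₂, lt_min hρ₁ hρ₂, fun x hx hxρ z hz hzx => ?_⟩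
  · rw [norm_smul, norm_inv, norm_norm, inv_mul_cancel₀ hm.ne']
  · have hxV := h₂ (ball_subset_ball (min_le_right _ _) hxρ)
    have hzV := h₂ (ball_subset_ball (min_le_right _ _) hz)
    have h3 := h₁ (z, x) (by
      rw [← ball_prod_same]
      exact ⟨ball_subset_ball (min_le_left _ _) hz, ball_subset_ball (min_le_left _ _) hxρ⟩)
    simp only [] at h3
    have h4 : fderiv ℝ g p (z - x) = ‖∇ g p‖ * inner ℝ (‖∇ g p‖⁻¹ • ∇ g p) (z - x) := by
      rw [real_inner_smul_left, ← mul_assoc, mul_inv_cancel₀ hm.ne', one_mul,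
        inner_gradient_left]
    rw [hcl z hzV]
    have h5 := (hcl x hxV).1 hx
    rw [Real.norm_eq_abs, abs_le, h4] at h3
    nlinarith [h3.1, mul_le_mul_of_nonneg_left hzx hm.le]

/-- At a boundary point the closed phase contains a truncated convex cone with nonempty interior.
This makes `fderivWithin` on the closure well behaved, so smoothness of U passes to its gradient. -/
lemma uniqueDiffOn_closure_posPhase {U : 𝔼 → ℝ} (hU : Continuous U)
    (hb : HasSmoothOneSidedBoundary U) : UniqueDiffOn ℝ (closure (posPhase U)) := by
  intro p hp
  rcases mem_closure_posPhase_iff.1 hp with h | h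
  · exact ((isOpen_posPhase hU).uniqueDiffWithinAt h).mono subset_closure
  · obtain ⟨e, he, ρ, hρ, hcone⟩ := exists_interior_cone hb h
    set K : Set 𝔼 := {z | ‖z - p‖ ≤ 4 * inner ℝ e (z - p)} ∩ ball p ρ with hK
    have hKs : K ⊆ closure (posPhase U) := fun z hz =>
      hcone p hp (mem_ball_self hρ) z hz.2 hz.1
    have hconv : Convex ℝ K := by
      refine Convex.inter ?_ (convex_ball p ρ)
      intro z hz w hw s t hs ht hst
      simp only [mem_ofPred_eq] at hz hw ⊢
      have e1 : s • z + t • w - p = s • (z - p) + t • (w - p) := by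
        rw [smul_sub, smul_sub, sub_add_sub_comm, ← add_smul, hst, one_smul]
      rw [e1, inner_add_right, real_inner_smul_right, real_inner_smul_right]
      refine (norm_add_le _ _).trans ?_
      rw [norm_smul, norm_smul, Real.norm_of_nonneg hs, Real.norm_of_nonneg ht]
      nlinarith [mul_le_mul_of_nonneg_left hz hs, mul_le_mul_of_nonneg_left hw ht]
    have hint : (interior K).Nonempty := by
      refine ⟨p + (ρ / 2) • e, mem_interior.2
        ⟨{z | ‖z - p‖ < 4 * inner ℝ e (z - p)} ∩ ball p ρ, ?_, ?_, ?_, ?_⟩⟩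
      · exact inter_subset_inter_left _ fun z hz => le_of_lt (α := ℝ) hz
      · exact (isOpen_lt (by fun_prop) (by fun_prop)).inter isOpen_ball
      · simp only [mem_ofPred_eq, add_sub_cancel_left]
        rw [norm_smul, he, real_inner_smul_right, real_inner_self_eq_norm_sq, he,
          Real.norm_of_nonneg (by positivity)]
        linarith
      · rw [mem_ball, dist_eq_norm, add_sub_cancel_left, norm_smul, he,
          Real.norm_of_nonneg (by positivity)]
        linarith
    refine (uniqueDiffWithinAt_convex hconv hint (subset_closure ?_)).mono hKs
    exact ⟨by simp, mem_ball_self hρ⟩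

lemma norm_sub_le_of_segment {s : Set 𝔼} {h : 𝔼 → ℝ} {C : ℝ} {x y : 𝔼}
    (hd : DifferentiableOn ℝ h s) (hC : ∀ z ∈ segment ℝ x y, ‖fderivWithin ℝ h s z‖ ≤ C)
    (hs : segment ℝ x y ⊆ s) : ‖h y - h x‖ ≤ C * ‖y - x‖ :=
  (convex_segment x y).norm_image_sub_le_of_norm_hasFDerivWithin_le
    (fun z hz => (hd z (hs hz)).hasFDerivWithinAt.mono hs) hC (left_mem_segment ℝ x y)
    (right_mem_segment ℝ x y)

/-- A function that is `C¹` up to the free boundary is locally Lipschitz up to the free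
boundary. -/
lemma locallyLipschitzOn_closure_posPhase {U h : 𝔼 → ℝ} (hU : Continuous U)
    (hb : HasSmoothOneSidedBoundary U) (hh : ContDiffOn ℝ 1 h (closure (posPhase U))) :
    LocallyLipschitzOn (closure (posPhase U)) h := by
  intro p hp
  rcases mem_closure_posPhase_iff.1 hp with hpΩ | hpF
  · have h1 : ContDiffAt ℝ 1 h p := hh.contDiffAt
      (mem_of_superset ((isOpen_posPhase hU).mem_nhds hpΩ) subset_closure)
    obtain ⟨K, t, ht, hK⟩ := h1.exists_lipschitzOnWith
    exact ⟨K, t, mem_nhdsWithin_of_mem_nhds ht, hK⟩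
  set S := closure (posPhase U) with hS
  obtain ⟨e, he, ρ₁, hρ₁, hcone⟩ := exists_interior_cone hb hpF
  have hu := uniqueDiffOn_closure_posPhase hU hb
  have hN : ContinuousWithinAt (fun z => ‖fderivWithin ℝ h S z‖) S p :=
    ((hh.continuousOn_fderivWithin hu le_rfl) p hp).norm
  set C := ‖fderivWithin ℝ h S p‖ + 1 with hC
  have hC0 : 0 ≤ C := by positivity
  obtain ⟨ρ₂, hρ₂, hb2⟩ := Metric.mem_nhdsWithin_iff.1
    (hN.eventually_lt (continuousWithinAt_const (b := C)) (by rw [hC]; linarith))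
  set ρ := min ρ₁ ρ₂ with hρ
  have hρ0 : 0 < ρ := lt_min hρ₁ hρ₂
  have hder : ∀ z ∈ S, z ∈ ball p ρ → ‖fderivWithin ℝ h S z‖ ≤ C := fun z hz hzρ =>
    le_of_lt (α := ℝ) (hb2 ⟨ball_subset_ball (min_le_right _ _) hzρ, hz⟩)
  have hcone' : ∀ x ∈ S, x ∈ ball p ρ → ∀ z ∈ ball p ρ, ‖z - x‖ ≤ 4 * inner ℝ e (z - x) →
      z ∈ S := fun x hx hxρ z hz =>
    hcone x hx (ball_subset_ball (min_le_left _ _) hxρ) z (ball_subset_ball (min_le_left _ _) hz)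
  have hd : DifferentiableOn ℝ h S := hh.differentiableOn one_ne_zero
  have hseg : ∀ x y, segment ℝ x y ⊆ S → x ∈ ball p ρ → y ∈ ball p ρ →
      ‖h y - h x‖ ≤ C * ‖y - x‖ := fun x y hxy hx hy =>
    norm_sub_le_of_segment hd (fun z hz =>
      hder z (hxy hz) ((convex_ball p ρ).segment_subset hx hy hz)) hxy
  -- Join x to y inside the closed phase: move 2d along e, then across by d, then 2d back, of total
  -- length 5d. In the ball of radius ρ/5 one has d ≤ 2ρ/5, so the path stays in the ball of radius
  -- ρ.
  refine ⟨Real.toNNReal (5 * C), ball p (ρ / 5) ∩ S,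
    inter_mem (mem_nhdsWithin_of_mem_nhds (ball_mem_nhds p (by positivity)))
      self_mem_nhdsWithin, LipschitzOnWith.of_dist_le_mul ?_⟩
  rintro x ⟨hxb, hx⟩ y ⟨hyb, hy⟩
  rw [Real.coe_toNNReal _ (by positivity), Real.dist_eq, ← Real.norm_eq_abs]
  set d := ‖y - x‖ with hd'
  have hdd : dist x y = d := by rw [dist_comm, dist_eq_norm]
  have hd0 : 0 ≤ d := norm_nonneg _
  rw [mem_ball, dist_eq_norm] at hxb hyb
  have hd5 : d ≤ 2 * (ρ / 5) := by
    have : y - x = (y - p) - (x - p) := by abel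
    rw [hd', this]
    exact (norm_sub_le _ _).trans (by linarith)
  have hshift : ∀ w : 𝔼, ‖w - p‖ < ρ / 5 → w + (2 * d) • e ∈ ball p ρ := by
    intro w hw
    rw [mem_ball, dist_eq_norm, add_sub_right_comm]
    refine (norm_add_le _ _).trans_lt ?_
    rw [norm_smul, he, mul_one, Real.norm_of_nonneg (by positivity)]
    linarith
  have hin : ∀ w : 𝔼, ‖w - p‖ < ρ / 5 → w ∈ ball p ρ := by
    intro w hw
    rw [mem_ball, dist_eq_norm]; linarith
  have hvert : ∀ w ∈ S, ‖w - p‖ < ρ / 5 → ‖h (w + (2 * d) • e) - h w‖ ≤ C * (2 * d) := by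
    intro w hwS hw
    have h1 := hseg w (w + (2 * d) • e) ?_ (hin w hw) (hshift w hw)
    · rwa [add_sub_cancel_left, norm_smul, he, mul_one,
        Real.norm_of_nonneg (show 0 ≤ 2 * d by positivity)] at h1
    · intro z hz
      refine hcone' w hwS (hin w hw) z
        ((convex_ball p ρ).segment_subset (hin w hw) (hshift w hw) hz) ?_
      rw [segment_eq_image'] at hz
      obtain ⟨t, ⟨ht0, ht1⟩, rfl⟩ := hz
      simp only [add_sub_cancel_left]
      rw [norm_smul, norm_smul, he, real_inner_smul_right, real_inner_smul_right,
        real_inner_self_eq_norm_sq, he, Real.norm_of_nonneg ht0,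
        Real.norm_of_nonneg (by positivity)]
      have : 0 ≤ t * (2 * d) := by positivity
      linarith
  have hhor : ‖h (y + (2 * d) • e) - h (x + (2 * d) • e)‖ ≤ C * d := by
    have h1 := hseg (x + (2 * d) • e) (y + (2 * d) • e) ?_ (hshift x hxb) (hshift y hyb)
    · rwa [add_sub_add_right_eq_sub] at h1
    · intro z hz
      refine hcone' x hx (hin x hxb) z
        ((convex_ball p ρ).segment_subset (hshift x hxb) (hshift y hyb) hz) ?_
      rw [segment_eq_image'] at hz
      obtain ⟨t, ⟨ht0, ht1⟩, rfl⟩ := hz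
      have e1 : x + (2 * d) • e + t • (y + (2 * d) • e - (x + (2 * d) • e)) - x =
          (2 * d) • e + t • (y - x) := by
        rw [add_sub_add_right_eq_sub]; abel
      simp only [e1]
      -- On the middle segment the displacement from x has length at most 3d and component at least
      -- 2d - d = d along e, so it lies in the cone.
      have h2 : ‖(2 * d) • e + t • (y - x)‖ ≤ 3 * d := by
        refine (norm_add_le _ _).trans ?_
        rw [norm_smul, norm_smul, he, Real.norm_of_nonneg ht0,
          Real.norm_of_nonneg (by positivity)]
        nlinarith
      have h3 : d ≤ inner ℝ e ((2 * d) • e + t • (y - x)) := by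
        rw [inner_add_right, real_inner_smul_right, real_inner_smul_right,
          real_inner_self_eq_norm_sq, he]
        have h4 := (abs_le.1 (abs_real_inner_le_norm e (y - x))).1
        rw [he, one_mul, ← hd'] at h4
        nlinarith
      linarith
  have v1 := hvert x hx hxb
  have v2 := hvert y hy hyb
  rw [hdd]
  have e2 : h x - h y = (h (y + (2 * d) • e) - h y) - (h (y + (2 * d) • e) - h (x + (2 * d) • e)) -
      (h (x + (2 * d) • e) - h x) := by ring
  rw [e2]
  refine (norm_sub_le _ _).trans ?_
  have := norm_sub_le (h (y + (2 * d) • e) - h y)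
    (h (y + (2 * d) • e) - h (x + (2 * d) • e))
  linarith

namespace IsEntireClassicalSolution

variable {U : 𝔼 → ℝ} (hU : IsEntireClassicalSolution U)
include hU

lemma uniqueDiffOn : UniqueDiffOn ℝ (closure (posPhase U)) :=
  uniqueDiffOn_closure_posPhase hU.continuous hU.smooth_boundary

omit hU in
lemma fderivWithin_eq (hc : Continuous U) {x : 𝔼} (hx : x ∈ posPhase U) :
    fderivWithin ℝ U (closure (posPhase U)) x = fderiv ℝ U x :=
  fderivWithin_of_mem_nhds (mem_of_superset ((isOpen_posPhase hc).mem_nhds hx) subset_closure)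

lemma contDiffOn_fderivWithin :
    ContDiffOn ℝ ∞ (fderivWithin ℝ U (closure (posPhase U))) (closure (posPhase U)) :=
  hU.smooth_up_to_boundary.fderivWithin hU.uniqueDiffOn (by simp)

lemma eq_zero_of_mem_freeBoundary {x : 𝔼} (hx : x ∈ freeBoundary U) : U x = 0 := by
  rw [freeBoundary, (isOpen_posPhase hU.continuous).frontier_eq] at hx
  exact le_antisymm (not_lt.1 hx.2) (hU.nonneg x)

lemma norm_fderivWithin_eq_one {p : 𝔼} (hp : p ∈ freeBoundary U) :
    ‖fderivWithin ℝ U (closure (posPhase U)) p‖ = 1 := by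
  rw [← hU.gradient_eq_one p hp, gradientWithin, LinearIsometryEquiv.norm_map]

lemma lipschitzOnWith_pd (r : ℝ) (i : Fin 2) :
    ∃ C, LipschitzOnWith C (pd i U) (posPhase U ∩ closedBall 0 r) := by
  set S := closure (posPhase U) with hS
  set h : 𝔼 → ℝ := fun x => fderivWithin ℝ U S x (EuclideanSpace.single i 1) with hh
  have h1 : ContDiffOn ℝ 1 h S :=
    (hU.contDiffOn_fderivWithin.of_le (by simp)).clm_apply contDiffOn_const
  have h2 := locallyLipschitzOn_closure_posPhase hU.continuous hU.smooth_boundary h1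
  obtain ⟨C, hC⟩ := (h2.mono (inter_subset_left (t := closedBall 0 r))
    ).exists_lipschitzOnWith_of_compact
      ((isCompact_closedBall (0 : 𝔼) r).inter_left isClosed_closure)
  have he : ∀ x ∈ posPhase U, h x = pd i U x := fun x hx => by
    simp only [hh]
    rw [fderivWithin_eq hU.continuous hx]; rfl
  refine ⟨C, fun x hx y hy => ?_⟩
  rw [← he x hx.1, ← he y hy.1]
  exact hC ⟨subset_closure hx.1, hx.2⟩ ⟨subset_closure hy.1, hy.2⟩

/-- In a ball, the points of the closed phase where ||∇U|² - 1| ≥ δ form a compact set that misses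
the free boundary, so U has a positive lower bound on it. -/
lemma gradient_near_boundary (r δ : ℝ) (hδ : 0 < δ) : ∃ ε > 0, ∀ x ∈ posPhase U,
    x ∈ closedBall (0 : 𝔼) r → U x < ε → |pd 0 U x ^ 2 + pd 1 U x ^ 2 - 1| ≤ δ := by
  set S := closure (posPhase U) with hS
  set h : 𝔼 → ℝ := fun x => |‖fderivWithin ℝ U S x‖ ^ 2 - 1| with hh
  have hc : ContinuousOn h S := by
    have := hU.contDiffOn_fderivWithin.continuousOn
    exact ((this.norm.pow 2).sub continuousOn_const).abs
  set K := closedBall (0 : 𝔼) r ∩ (S ∩ h ⁻¹' Ici δ) with hK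
  have hKc : IsCompact K := (isCompact_closedBall (0 : 𝔼) r).inter_right
    (hc.preimage_isClosed_of_isClosed isClosed_closure isClosed_Ici)
  have hpos : ∀ x ∈ K, 0 < U x := by
    rintro x ⟨-, hxS, hxδ⟩
    rcases mem_closure_posPhase_iff.1 hxS with hx | hx
    · exact hx
    · exfalso
      change δ ≤ |‖fderivWithin ℝ U S x‖ ^ 2 - 1| at hxδ
      rw [hU.norm_fderivWithin_eq_one hx] at hxδ
      norm_num at hxδ
      linarith
  have main : ∃ ε > 0, ∀ x ∈ K, ε ≤ U x := by
    rcases K.eq_empty_or_nonempty with hE | hne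
    · exact ⟨1, one_pos, fun x hx => by rw [hE] at hx; exact hx.elim⟩
    · obtain ⟨x, hx, hmin⟩ := hKc.exists_isMinOn hne hU.continuous.continuousOn
      exact ⟨U x, hpos x hx, fun y hy => hmin hy⟩
  obtain ⟨ε, hε, hεK⟩ := main
  refine ⟨ε, hε, fun x hx hxr hxε => ?_⟩
  have hx2 : h x = |pd 0 U x ^ 2 + pd 1 U x ^ 2 - 1| := by
    simp only [hh]
    rw [fderivWithin_eq hU.continuous hx, norm_sq_clm]
    rfl
  rw [← hx2]
  by_contra! hlt
  exact absurd (hεK x ⟨hxr, subset_closure hx, hlt.le⟩) (not_le.2 hxε)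

lemma pd_pd_add (x : 𝔼) (hx : x ∈ posPhase U) : pd 0 (pd 0 U) x + pd 1 (pd 1 U) x = 0 := by
  have h1 := (hU.harmonic x hx).2.self_of_nhds
  have h2 : ContDiffAt ℝ 2 U x := (hU.harmonic x hx).1
  rw [InnerProductSpace.laplacian_eq_iteratedFDeriv_orthonormalBasis U
    (EuclideanSpace.basisFun (Fin 2) ℝ)] at h1
  have h3 : ∀ i : Fin 2, iteratedFDeriv ℝ 2 U x ![EuclideanSpace.basisFun (Fin 2) ℝ i,
      EuclideanSpace.basisFun (Fin 2) ℝ i] = pd i (pd i U) x := by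
    intro i
    rw [iteratedFDeriv_two_apply]
    have h4 : DifferentiableAt ℝ (fderiv ℝ U) x :=
      (h2.fderiv_right (m := 1) le_rfl).differentiableAt one_ne_zero
    have h5 : HasFDerivAt (pd i U)
        ((fderiv ℝ (fderiv ℝ U) x).flip (EuclideanSpace.single i 1)) x := by
      have := h4.hasFDerivAt.clm_apply (hasFDerivAt_const (EuclideanSpace.single i (1 : ℝ)) x)
      exact this.congr_fderiv (by simp)
    rw [pd, h5.fderiv]
    simp
  rw [← h3, ← h3]
  simpa [Fin.sum_univ_two] using h1

end IsEntireClassicalSolution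

/-! ### Gradient bound -/

open InnerProductSpace in
/-- Harnack's inequality on a disc in the complex plane. -/
lemma harnack_complex {u : ℂ → ℝ} {c w : ℂ} {R : ℝ} (hu : HarmonicContOnCl u (ball c R))
    (h0 : ∀ z ∈ sphere c R, 0 ≤ u z) (hw : w ∈ ball c R) :
    (R - ‖w - c‖) / (R + ‖w - c‖) * u c ≤ u w := by
  have hR : 0 < R := pos_of_mem_ball hw
  have hus : ContinuousOn u (sphere c |R|) := by
    rw [abs_of_pos hR]; exact hu.continuousOn_ball.mono sphere_subset_closedBall
  have hmean : Real.circleAverage u c R = u c := by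
    refine InnerProductSpace.HarmonicContOnCl.circleAverage_eq ?_
    rwa [abs_of_pos hR]
  -- Compare the Poisson formula at w with the mean value at c: on the circle the kernel is at least
  -- (R - |w - c|)/(R + |w - c|).
  rw [← hu.circleAverage_poissonKernel_smul hw, ← hmean, ← smul_eq_mul, ← Real.circleAverage_smul]
  have hk : ContinuousOn (poissonKernel c w) (sphere c |R|) := by
    rw [poissonKernel_eq_re_herglotzRieszKernel]
    exact Complex.continuous_re.comp_continuousOn (continuousOn_herglotzRieszKernel_sphere hw)
  refine Real.circleAverage_mono (continuousOn_const.smul hus).circleIntegrable'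
    (hk.smul hus).circleIntegrable' fun z hz => ?_
  rw [abs_of_pos hR] at hz
  simp only [Pi.smul_apply, Pi.smul_apply', smul_eq_mul]
  refine mul_le_mul_of_nonneg_right ?_ (h0 z hz)
  rw [poissonKernel_eq_re_herglotzRieszKernel]
  exact le_re_herglotzRieszKernel hz hw

open InnerProductSpace in
lemma laplacian_comp_linearIsometryEquiv {E F : Type*} [NormedAddCommGroup E]
    [InnerProductSpace ℝ E] [FiniteDimensional ℝ E] [NormedAddCommGroup F] [InnerProductSpace ℝ F]
    [FiniteDimensional ℝ F] (L : E ≃ₗᵢ[ℝ] F) (f : F → ℝ) (x : E) :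
    Laplacian.laplacian (f ∘ L) x = Laplacian.laplacian f (L x) := by
  rw [laplacian_eq_iteratedFDeriv_orthonormalBasis (f ∘ L) (stdOrthonormalBasis ℝ E),
    laplacian_eq_iteratedFDeriv_orthonormalBasis f ((stdOrthonormalBasis ℝ E).map L)]
  refine Finset.sum_congr rfl fun i _ => ?_
  have h := L.toContinuousLinearEquiv.iteratedFDerivWithin_comp_right f uniqueDiffOn_univ
    (mem_univ (L x)) 2
  rw [preimage_univ, iteratedFDerivWithin_univ, iteratedFDerivWithin_univ] at h
  have h' := congrArg (fun m => m ![stdOrthonormalBasis ℝ E i, stdOrthonormalBasis ℝ E i]) h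
  refine h'.trans ?_
  rw [ContinuousMultilinearMap.compContinuousLinearMap_apply]
  congr 1
  funext j
  fin_cases j <;> simp

namespace IsEntireClassicalSolution

variable {U : 𝔼 → ℝ} (hU : IsEntireClassicalSolution U)
include hU

/-- Harnack's inequality. -/
lemma harnack {x y : 𝔼} {R : ℝ} (hR : ball x R ⊆ posPhase U) (hy : y ∈ ball x R) :
    (R - ‖y - x‖) / (R + ‖y - x‖) * U x ≤ U y := by
  let L : ℂ ≃ₗᵢ[ℝ] 𝔼 := Complex.orthonormalBasisOneI.repr
  have hball : ∀ z, z ∈ ball (L.symm x) R ↔ L z ∈ ball x R := fun z => by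
    rw [mem_ball, mem_ball, ← L.dist_map, L.apply_symm_apply]
  have hharm : InnerProductSpace.HarmonicContOnCl (U ∘ L) (ball (L.symm x) R) := by
    refine ⟨fun z hz => ?_, (hU.continuous.comp L.continuous).continuousOn⟩
    have h1 := hU.harmonic (L z) (hR ((hball z).1 hz))
    refine ⟨h1.1.comp z L.contDiff.contDiffAt, ?_⟩
    filter_upwards [L.continuous.continuousAt.eventually h1.2] with w hw
    rw [laplacian_comp_linearIsometryEquiv, hw]; rfl
  have h := harnack_complex hharm (fun z _ => hU.nonneg _)
    ((hball (L.symm y)).2 (by simpa using hy))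
  rw [← map_sub, L.symm.norm_map] at h
  simpa using h

/-- Harnack's inequality says U(x + tv)(d + t) ≥ (d - t)U(x) for 0 < t < d, with equality at t = 0,
so the derivative of the difference at 0 is nonnegative. Used with v and -v it bounds the gradient
by 2U/d. -/
lemma pd_ge {x v : 𝔼} {d : ℝ} (hd : 0 < d) (hball : ball x d ⊆ posPhase U) (hv : ‖v‖ = 1) :
    -(2 * U x / d) ≤ fderiv ℝ U x v := by
  have hx : x ∈ posPhase U := hball (mem_ball_self hd)
  have hUd : HasFDerivAt U (fderiv ℝ U x) x :=
    ((hU.harmonic x hx).1.differentiableAt (by simp)).hasFDerivAt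
  have hφ : HasDerivAt (fun t : ℝ => U (x + t • v)) (fderiv ℝ U x v) 0 := by
    have h1 : HasDerivAt (fun t : ℝ => x + t • v) v 0 := by
      simpa using ((hasDerivAt_id (0 : ℝ)).smul_const v).const_add x
    refine HasFDerivAt.comp_hasDerivAt (0 : ℝ) (by simpa using hUd) h1
  have hk : HasDerivAt (fun t : ℝ => U (x + t • v) * (d + t) - (d - t) * U x)
      (fderiv ℝ U x v * d + 2 * U x) 0 := by
    have h1 : HasDerivAt (fun t : ℝ => d + t) 1 0 := (hasDerivAt_id (0 : ℝ)).const_add d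
    have h2 : HasDerivAt (fun t : ℝ => d - t) (-1) 0 := (hasDerivAt_id (0 : ℝ)).const_sub d
    refine ((hφ.mul h1).sub (h2.mul_const (U x))).congr_deriv ?_
    simp
    ring
  have hlim := hk.tendsto_slope_zero_right
  have hge : 0 ≤ fderiv ℝ U x v * d + 2 * U x := by
    refine ge_of_tendsto hlim ?_
    filter_upwards [Ioo_mem_nhdsGT hd] with t ht
    have h1 : ‖x + t • v - x‖ = t := by
      rw [add_sub_cancel_left, norm_smul, hv, mul_one, Real.norm_of_nonneg ht.1.le]
    have h2 := hU.harnack hball (y := x + t • v) (by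
      rw [mem_ball, dist_eq_norm, h1]; exact ht.2)
    have h3 : 0 < d + t := by linarith [ht.1]
    rw [h1, div_mul_eq_mul_div, div_le_iff₀ h3] at h2
    have h4 : 0 ≤ t⁻¹ := inv_nonneg.2 ht.1.le
    simp only [smul_eq_mul, zero_add, zero_smul, add_zero, sub_zero]
    refine mul_nonneg h4 ?_
    linarith
  have e : fderiv ℝ U x v = (fderiv ℝ U x v * d) / d := by field_simp
  rw [e, ← neg_div]
  gcongr
  linarith

/-- The growth of `U` away from the free boundary is at most linear. -/
lemma le_two_mul {x p : 𝔼} (hp : p ∈ freeBoundary U) (hd : 0 < dist x p)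
    (hball : ball x (dist x p) ⊆ posPhase U) : U x ≤ 2 * dist x p := by
  set d := dist x p with hd'
  set S := closure (posPhase U) with hS
  have hpS : p ∈ S := mem_closure_posPhase_iff.2 (Or.inr hp)
  set v : 𝔼 := d⁻¹ • (x - p) with hv
  have hvn : ‖v‖ = 1 := by
    rw [hv, norm_smul, norm_inv, Real.norm_of_nonneg hd.le, ← dist_eq_norm, ← hd',
      inv_mul_cancel₀ hd.ne']
  have hxp : x = p + d • v := by
    rw [hv, smul_smul, mul_inv_cancel₀ hd.ne', one_smul, add_sub_cancel]
  have hnorm : ∀ t ∈ Ioo 0 d, ‖p + t • v - x‖ = d - t := by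
    intro t ht
    have : p + t • v - x = (t - d) • v := by
      rw [sub_smul]; nth_rw 1 [hxp]; abel
    rw [this, norm_smul, hvn, mul_one, Real.norm_eq_abs, abs_sub_comm,
      abs_of_pos (by linarith [ht.2])]
  have hmem : ∀ t ∈ Ioo 0 d, p + t • v ∈ ball x d := fun t ht => by
    rw [mem_ball, dist_eq_norm, hnorm t ht]; linarith [ht.1]
  have hUp := hU.eq_zero_of_mem_freeBoundary hp
  have hUd : HasFDerivWithinAt U (fderivWithin ℝ U S p) S p :=
    ((hU.smooth_up_to_boundary p hpS).differentiableWithinAt (by simp)).hasFDerivWithinAt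
  have hφ : HasDerivWithinAt (fun t : ℝ => U (p + t • v)) (fderivWithin ℝ U S p v) (Ioo 0 d) 0 := by
    have h1 : HasDerivWithinAt (fun t : ℝ => p + t • v) v (Ioo 0 d) 0 := by
      simpa using (((hasDerivAt_id (0 : ℝ)).smul_const v).const_add p).hasDerivWithinAt
    refine HasFDerivWithinAt.comp_hasDerivWithinAt (t := S) (0 : ℝ) (by simpa using hUd) h1 ?_
    exact fun t ht => subset_closure (hball (hmem t ht))
  rw [hasDerivWithinAt_iff_tendsto_slope' (by simp), nhdsWithin_Ioo_eq_nhdsGT hd] at hφ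
  have hge : U x / (2 * d) ≤ fderivWithin ℝ U S p v := by
    refine ge_of_tendsto hφ ?_
    filter_upwards [Ioo_mem_nhdsGT hd] with t ht
    -- Along the radius ending at p, U(p + tv) ≥ tU(x)/(2d - t) ≥ tU(x)/(2d). The slope at p is
    -- therefore at least U(x)/(2d), while the free boundary condition makes it at most 1.
    have h1 := hU.harnack hball (hmem t ht)
    rw [hnorm t ht] at h1
    rw [slope_def_field, zero_smul, add_zero, hUp, sub_zero, sub_zero, le_div_iff₀ ht.1]
    refine le_trans ?_ h1
    have e : (d - (d - t)) / (d + (d - t)) * U x = t * U x / (2 * d - t) := by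
      rw [div_mul_eq_mul_div]; ring_nf
    rw [e, div_mul_eq_mul_div, mul_comm (U x)]
    have := ht.1
    have := ht.2
    have := hU.nonneg x
    gcongr
    · linarith
    · linarith
  have hle : fderivWithin ℝ U S p v ≤ 1 := by
    have h1 := (fderivWithin ℝ U S p).le_opNorm v
    rw [hU.norm_fderivWithin_eq_one hp, hvn, mul_one] at h1
    exact (le_abs_self _).trans h1
  have := hge.trans hle
  rwa [div_le_one (by positivity)] at this

/-- The point of the zero set nearest to x lies on the free boundary, at distance d say. Then U(x) ≤
2d, and the gradient bound 2U(x)/d is at most 4. -/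
lemma abs_pd_le_four (hF : (freeBoundary U).Nonempty) {x : 𝔼} (hx : x ∈ posPhase U) (i : Fin 2) :
    |pd i U x| ≤ 4 := by
  have hO := isOpen_posPhase hU.continuous
  obtain ⟨q, hq⟩ := hF
  rw [freeBoundary, hO.frontier_eq] at hq
  obtain ⟨p, hp, hpd⟩ := hO.isClosed_compl.exists_infDist_eq_dist ⟨q, hq.2⟩ x
  have hd : 0 < dist x p := dist_pos.2 fun h => hp (h ▸ hx)
  have hball : ball x (dist x p) ⊆ posPhase U := by
    intro y hy
    by_contra hyc
    have := infDist_le_dist_of_mem (x := x) (s := (posPhase U)ᶜ) hyc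
    rw [hpd] at this
    rw [mem_ball, dist_comm] at hy
    linarith
  have hpF : p ∈ freeBoundary U := by
    rw [freeBoundary, hO.frontier_eq]
    refine ⟨closure_mono hball ?_, hp⟩
    rw [closure_ball x hd.ne', mem_closedBall, dist_comm]
  have h1 := hU.le_two_mul hpF hd hball
  have h2 : 2 * U x / dist x p ≤ 4 := by
    rw [div_le_iff₀ hd]; linarith
  have hn : ‖(EuclideanSpace.single i (1 : ℝ) : 𝔼)‖ = 1 := by simp
  have h3 := hU.pd_ge hd hball hn
  have h4 := hU.pd_ge hd hball ((norm_neg _).trans hn)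
  rw [map_neg] at h4
  rw [pd, abs_le]
  constructor <;> linarith

lemma isRegular (hF : (freeBoundary U).Nonempty) : IsRegular U where
  cont := hU.continuous
  nonneg := hU.nonneg
  smooth := hU.smooth_up_to_boundary.mono subset_closure
  harm := hU.pd_pd_add
  bound := fun _ hx i => hU.abs_pd_le_four hF hx i
  boundary := hU.gradient_near_boundary
  lip := hU.lipschitzOnWith_pd

end IsEntireClassicalSolution

end OnePhase

end

theorem theorem3 (U : EuclideanSpace ℝ (Fin 2) → ℝ)
    (hU : OnePhase.IsEntireClassicalSolution U)
    (hstable : OnePhase.IsStable U)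
    (hF : (OnePhase.freeBoundary U).Nonempty) :
    ∃ T : EuclideanSpace ℝ (Fin 2) ≃ᵃⁱ[ℝ] EuclideanSpace ℝ (Fin 2),
      (∀ x, U x = OnePhase.onePlane (T x)) ∨
      ∃ a : ℝ, 0 < a ∧ ∀ x, U x = OnePhase.twoPlane a (T x) :=
  (hU.isRegular hF).classification_of_flat
    (fun _ hx i j => (hU.isRegular hF).pd_pd_eq_zero hstable hx i j) hF hU.smooth_boundary
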